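/- Let $M$ be a matroid on a finite ground set $S$ with family of bases $\mathcal B$ and rank function $r_M$, and let $r$ be its rank. If $(A_1,A_2)$ is an ordered pair of bases and $e\in A_1-A_2$, $f\in A_2-A_1$ are such that $A_1-e+f$ and $A_2+e-f$ are both bases, then $(A_1-e+f,\,A_2+e-f)$ is said to be obtained from $(A_1,A_2)$ by a symmetric exchange. The exchange distance of two ordered pairs of bases is the minimum number of symmetric exchanges that transform the first into the second, and $+\infty$ if there is no such sequence. Basis pairs $(A_1,A_2)$ and $(B_1,B_2)$ are compatible if $A_1\cap A_2=B_1\cap B_2$ and $A_1\cup A_2=B_1\cup B_2$. Let $P(M)=\operatorname{conv}\{\chi_B : B\in\mathcal B\}\subseteq\mathbb R^S$ be the base polytope and $Q(M)=\operatorname{aff}(P(M))\cap[0,1]^S$ (the hypersimplex if $M$ is connected and $|S|\ge 2$). A split flacet is a set $F\subseteq S$ such that $x(F)\le r_M(F)$ defines a facet of $P(M)$ and the hyperplane $\{x: x(F)=r_M(F)\}$ meets the relative interior of $Q(M)$, and hence splits $Q(M)$. The matroid $M$ is a split matroid if the hyperplanes of split flacets that define distinct facets of $P(M)$ never meet in the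 relative interior of $Q(M)$. **Theorem.** (i) Let $(A_1,A_2)$ and $(B_1,B_2)$ be compatible basis pairs of a rank-$r$ split matroid $M$. Then the exchange distance of $(A_1,A_2)$ and $(B_1,B_2)$ is at most $\min\{r,\ r-|A_1\cap B_1|+1\}$. (ii) There is a polynomial-time algorithm that uses an independence oracle and finds such a sequence: there are a single random access machine program with oracle calls (unit cost for each elementary step, where the arithmetic consists of addition and truncated subtraction of natural numbers, and for each oracle call) and a polynomial $p$ such that, for every $n$, every split matroid $M$ on the ground set $\{0,\dots,n-1\}$ of rank $r$ and all compatible basis pairs $(A_1,A_2)$, $(B_1,B_2)$ of $M$, the program, given $n$ and the characteristic vectors of $A_1,A_2,B_1,B_2$ and access to the independence oracle of $M$, halts after at most $p(n)$ steps and outputs a sequence of at most $\min\{r,\ r-|A_1\cap B_1|+1\}$ symmetric exchanges that transforms $(A_1,A_2)$ into $(B_1,B_2)$. -/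

import Mathlib

/-! ## Symmetric exchanges of basis pairs -/

namespace Matroid

/-- `ExchangeSeq M l P Q`: performing the list `l` of symmetric exchanges one after the other,
starting from the ordered basis pair `P`, is feasible and ends in `Q`. The entry `(e, f)`, performed
at the current pair `(P₁, P₂)`, needs `e ∈ P₁ - P₂` and `f ∈ P₂ - P₁`, and replaces `(P₁, P₂)` by
`(P₁ - e + f, P₂ + e - f)`, both of which have to be bases. -/
def ExchangeSeq {α : Type*} (M : Matroid α) :
    List (α × α) → Set α × Set α → Set α × Set α → Prop
  | [], P, Q => M.IsBase P.1 ∧ M.IsBase P.2 ∧ P = Q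
  | (e, f) :: l, P, Q =>
      M.IsBase P.1 ∧ M.IsBase P.2 ∧ e ∈ P.1 \ P.2 ∧ f ∈ P.2 \ P.1 ∧
        M.IsBase (insert f (P.1 \ {e})) ∧ M.IsBase (insert e (P.2 \ {f})) ∧
        ExchangeSeq M l (insert f (P.1 \ {e}), insert e (P.2 \ {f})) Q

/-- The exchange distance of two basis pairs: the least number of symmetric exchanges that transform
`P` into `Q`, and `⊤` if there is no such sequence. -/
noncomputable def exchangeDist {α : Type*} (M : Matroid α) (P Q : Set α × Set α) : ℕ∞ :=
  ⨅ (l : List (α × α)) (_ : M.ExchangeSeq l P Q), (l.length : ℕ∞)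

/-- The pairs `P` and `Q` are pairs of bases of `M` with the same intersection and the same union. -/
structure CompatibleBasisPairs {α : Type*} (M : Matroid α) (P Q : Set α × Set α) : Prop where
  isBase_left₁ : M.IsBase P.1
  isBase_left₂ : M.IsBase P.2
  isBase_right₁ : M.IsBase Q.1
  isBase_right₂ : M.IsBase Q.2
  inter_eq : P.1 ∩ P.2 = Q.1 ∩ Q.2
  union_eq : P.1 ∪ P.2 = Q.1 ∪ Q.2

/-! ## Split matroids -/

/-- The matroid base polytope: the convex hull of the characteristic vectors of the bases. -/
def basePolytope {α : Type*} (M : Matroid α) : Set (α → ℝ) :=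
  convexHull ℝ {x | ∃ B, M.IsBase B ∧ x = B.indicator 1}

/-- The affine hull of the base polytope intersected with the unit cube. If `M` is a connected
matroid of rank `r` on at least two elements, this is the hypersimplex, that is, the base polytope
of the rank-`r` uniform matroid on the ground set of `M`. -/
def cubeSection {α : Type*} (M : Matroid α) : Set (α → ℝ) :=
  (affineSpan ℝ M.basePolytope : Set (α → ℝ)) ∩ Set.Icc 0 1

/-- The hyperplane `∑_{i ∈ F} x_i = r_M(F)`. -/
def rankHyperplane {α : Type*} (M : Matroid α) (F : Finset α) : Set (α → ℝ) :=
  {x | ∑ i ∈ F, x i = ((M.eRk F).toNat : ℝ)}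

/-- The face of the base polytope on which the valid inequality `∑_{i ∈ F} x_i ≤ r_M(F)` is
attained with equality. -/
def rankFace {α : Type*} (M : Matroid α) (F : Finset α) : Set (α → ℝ) :=
  M.basePolytope ∩ M.rankHyperplane F

/-- `∑_{i ∈ F} x_i ≤ r_M(F)` defines a facet of the base polytope, that is, a face whose dimension
is one less than that of the polytope. (The face is never empty.) -/
def DefinesFacet {α : Type*} (M : Matroid α) (F : Finset α) : Prop :=
  (F : Set α) ⊆ M.E ∧
    Module.finrank ℝ (vectorSpan ℝ (M.rankFace F)) + 1 =
      Module.finrank ℝ (vectorSpan ℝ M.basePolytope)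

/-- A facet-defining `F` is a split flacet if its hyperplane splits the cube section of `M`, that
is, cuts through its relative interior. (Such a hyperplane never separates the two ends of an edge
of the cube section: that polytope has 0/1 vertices and edges of direction `e_i - e_j`. So cutting
through the relative interior is all that it takes to be a split.) -/
def IsSplitFlacet {α : Type*} (M : Matroid α) (F : Finset α) : Prop :=
  M.DefinesFacet F ∧ (M.rankHyperplane F ∩ intrinsicInterior ℝ M.cubeSection).Nonempty

/-- A matroid (on a finite ground set) is a split matroid if its split flacets form a compatible
system of splits of the cube section: the hyperplanes that cut out two distinct facets do not meet
in the relative interior of the cube section. -/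
def IsSplit {α : Type*} (M : Matroid α) : Prop :=
  ∀ F G : Finset α, M.IsSplitFlacet F → M.IsSplitFlacet G → M.rankFace F ≠ M.rankFace G →
    Disjoint (M.rankHyperplane F ∩ intrinsicInterior ℝ M.cubeSection) (M.rankHyperplane G)

end Matroid

/-! ## Algorithms with an oracle

A random access machine, programmed in a structured language. It has registers and arrays that hold
natural numbers; its arithmetic is addition and truncated subtraction only, so that numbers of
polynomially many bits arise in polynomial time and unit cost is an honest measure. -/

namespace OracleRAM

/-- The memory: register `x` holds `reg x`, and entry `i` of array `a` is `mem a i`. -/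
structure Store where
  reg : ℕ → ℕ
  mem : ℕ → ℕ → ℕ

/-- Arithmetic expressions. -/
inductive AExp where
  | lit (c : ℕ) : AExp
  | var (x : ℕ) : AExp
  | get (a : ℕ) (i : AExp) : AExp
  | add (e f : AExp) : AExp
  | sub (e f : AExp) : AExp

/-- The value of an expression (subtraction is truncated at zero). -/
def AExp.val : AExp → Store → ℕ
  | lit c, _ => c
  | var x, s => s.reg x
  | get a i, s => s.mem a (i.val s)
  | add e f, s => e.val s + f.val s
  | sub e f, s => e.val s - f.val s

/-- The number of elementary steps to evaluate an expression. -/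
def AExp.cost : AExp → ℕ
  | lit _ => 1
  | var _ => 1
  | get _ i => i.cost + 1
  | add e f => e.cost + f.cost + 1
  | sub e f => e.cost + f.cost + 1

/-- Programs. A test `e` succeeds if the value of `e` is not zero. The instruction `query x a` asks
the oracle about the set of all indices at which array `a` is not zero, and puts the answer
(`1` for yes, `0` for no) into register `x`. -/
inductive Prog where
  | skip : Prog
  | assign (x : ℕ) (e : AExp) : Prog
  | store (a : ℕ) (i e : AExp) : Prog
  | query (x a : ℕ) : Prog
  | seq (p q : Prog) : Prog
  | ite (e : AExp) (p q : Prog) : Prog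
  | loop (e : AExp) (p : Prog) : Prog

/-- The store with register `x` set to `v`. -/
def Store.setReg (s : Store) (x v : ℕ) : Store :=
  { s with reg := Function.update s.reg x v }

/-- The store with entry `i` of array `a` set to `v`. -/
def Store.setMem (s : Store) (a i v : ℕ) : Store :=
  { s with mem := Function.update s.mem a (Function.update (s.mem a) i v) }

open Classical in
/-- The answer of the oracle `O` on the set of nonzero indices of array `a`. -/
noncomputable def Store.answer (O : Set ℕ → Prop) (s : Store) (a : ℕ) : ℕ :=
  if O {i | s.mem a i ≠ 0} then 1 else 0

/-- `Run O p s t s'`: with oracle `O`, the program `p` started in the store `s` halts in the store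
`s'` after exactly `t` steps, where an oracle call counts as one step. -/
inductive Run (O : Set ℕ → Prop) : Prog → Store → ℕ → Store → Prop where
  | skip (s : Store) : Run O .skip s 1 s
  | assign (x : ℕ) (e : AExp) (s : Store) :
      Run O (.assign x e) s (e.cost + 1) (s.setReg x (e.val s))
  | store (a : ℕ) (i e : AExp) (s : Store) :
      Run O (.store a i e) s (i.cost + e.cost + 1) (s.setMem a (i.val s) (e.val s))
  | query (x a : ℕ) (s : Store) :
      Run O (.query x a) s 1 (s.setReg x (s.answer O a))
  | seq {p q : Prog} {s s' s'' : Store} {t t' : ℕ} :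
      Run O p s t s' → Run O q s' t' s'' → Run O (.seq p q) s (t + t') s''
  | iteTrue {e : AExp} {p q : Prog} {s s' : Store} {t : ℕ} :
      e.val s ≠ 0 → Run O p s t s' → Run O (.ite e p q) s (e.cost + 1 + t) s'
  | iteFalse {e : AExp} {p q : Prog} {s s' : Store} {t : ℕ} :
      e.val s = 0 → Run O q s t s' → Run O (.ite e p q) s (e.cost + 1 + t) s'
  | loopStop {e : AExp} {p : Prog} {s : Store} :
      e.val s = 0 → Run O (.loop e p) s (e.cost + 1) s
  | loopStep {e : AExp} {p : Prog} {s s' s'' : Store} {t t' : ℕ} :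
      e.val s ≠ 0 → Run O p s t s' → Run O (.loop e p) s' t' s'' →
      Run O (.loop e p) s (e.cost + 1 + t + t') s''

/-- The independence oracle of a matroid with ground set `{0, …, n - 1}`. -/
def indepOracle {n : ℕ} (M : Matroid (Fin n)) (X : Set ℕ) : Prop :=
  M.Indep {i : Fin n | (i : ℕ) ∈ X}

open Classical in
/-- The characteristic vector of a subset of `{0, …, n - 1}` as an array (zero from `n` on). -/
noncomputable def charArray {n : ℕ} (X : Set (Fin n)) (i : ℕ) : ℕ :=
  if ∃ j ∈ X, (j : ℕ) = i then 1 else 0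

/-- The input: register `0` holds the size `n` of the ground set, the arrays `0, 1, 2, 3` hold the
characteristic vectors of `P₁, P₂, Q₁, Q₂`, and everything else is zero. -/
noncomputable def inputStore {n : ℕ} (P Q : Set (Fin n) × Set (Fin n)) : Store where
  reg x := if x = 0 then n else 0
  mem a := if a = 0 then charArray P.1 else if a = 1 then charArray P.2
    else if a = 2 then charArray Q.1 else if a = 3 then charArray Q.2 else fun _ => 0

/-- The output is the list `l` of pairs: register `0` holds its length, array `0` the first and
array `1` the second members of its entries. -/
def Store.Outputs {n : ℕ} (s : Store) (l : List (Fin n × Fin n)) : Prop :=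
  s.reg 0 = l.length ∧
    ∀ (i : ℕ) (h : i < l.length), s.mem 0 i = (l[i].1 : ℕ) ∧ s.mem 1 i = (l[i].2 : ℕ)

end OracleRAM

namespace Matroid

/-! ## Exchanges in a base -/

section Exchange

variable {α : Type*} {M : Matroid α} {X B T : Set α} {e f : α}

/-! Call the exchange of e for f at a base X blocked if X - e + f is not a base. A blocked exchange
inside a connected component is a 0/1 point of Q(M) outside P(M), and `IsBase.exists_isSeparating`
produces a split flacet F, tight at X, with f ∈ F and e ∉ F. In a split matroid a point of Q(M) on
the hyperplane of one split flacet cannot violate the inequality of another: the segment to it from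
a suitable relatively interior point would meet both hyperplanes in the relative interior. Hence
blocked exchanges at X that share an element are separated by the same flacet. Within a component
they form disjoint complete bipartite graphs (`IsSplit.not_isBase_exchange`), and only one component
has any (`IsSplit.sameClass_of_not_isBase`). The rest of part (i) is combinatorics of these blocks.

Suppose that no exchange brings (X, Y) closer to (B₁, B₂). The relations blocked at X and blocked at
Y then cover (X \ B₁) × (B₁ \ X), while symmetric exchange leaves a free entry in every row and
column. Two block relations of this kind are complementary, so each consists of two complementary
blocks. A rank count (`IsBase.not_isBase_of_two_blocks`) transports the blocks from X to B₁ and from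
Y to B₂. So a stuck state leaves a trace at the target, `Dead`, which is necessary for being stuck
and is the notion that is tracked.

Exchanges may also be made at the target, to be undone at the end of the sequence. A state that is
not dead then always has a closer one that is not dead (`IsSplit.exists_closer`). If a closer
exchange of the current pair ends in a dead state, then by `IsSplit.exists_repair` either the
two-block pattern extends to the differences before that exchange, or some exchange of the target
creates a free row or column and so destroys the pattern; that the state was not dead excludes the
former. From a dead state, one exchange of the target at unchanged distance leads to a state that is
not dead (`IsSplit.exists_detour`): otherwise the pattern would extend to all of B₁ \ B₂ and B₂ \
B₁, and the rank count would transport it to B₂, where the definition of `Dead` provides a free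
entry. So |X \ B₁| exchanges suffice, plus one if the state is dead. As X ∩ B₁ is nonempty in a dead
state, both bounds follow.

For part (ii), `Dead` involves at most four elements at a time and feasibility of single exchanges,
so it is decided with polynomially many oracle calls. The algorithm searches in each round for a
next step at either end. Its program is assembled from combinators that carry polynomial time
bounds. -/

lemma IsBase.isBase_exchange_iff (hX : M.IsBase X) (he : e ∈ X) (hf : f ∈ M.E) (hfX : f ∉ X) :
    M.IsBase (insert f (X \ {e})) ↔ f ∉ M.closure (X \ {e}) := by
  constructor
  · intro h hcl
    have h1 := h.indep.notMem_closure_sdiff_of_mem (Set.mem_insert f _)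
    rw [Set.insert_sdiff_of_mem _ (Set.mem_singleton f),
      Set.sdiff_singleton_eq_self (fun h' => hfX h'.1)] at h1
    exact h1 hcl
  · intro h
    exact hX.exchange_base_of_notMem_closure he h

lemma IsBase.isBase_exchange_of_mem_fundCircuit (hX : M.IsBase X) (he : e ∈ X) (hf : f ∈ M.E)
    (hfX : f ∉ X) (h : e ∈ M.fundCircuit f X) : M.IsBase (insert f (X \ {e})) := by
  have hne : f ≠ e := by rintro rfl; exact hfX he
  have h1 := (hX.indep.mem_fundCircuit_iff (by rwa [hX.closure_eq]) hfX).1 h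
  rw [← Set.insert_sdiff_singleton_comm hne] at h1
  exact hX.exchange_isBase_of_indep hfX h1

/-- If no exchange of an element of `T` for `f` is feasible, then `X \ T` spans `f`. -/
lemma IsBase.mem_closure_sdiff_of_forall_not_isBase (hX : M.IsBase X) (hf : f ∈ M.E) (hfX : f ∉ X)
    (h : ∀ e ∈ T, e ∈ X → ¬ M.IsBase (insert f (X \ {e}))) : f ∈ M.closure (X \ T) := by
  have hC := hX.fundCircuit_isCircuit hf hfX
  refine M.closure_subset_closure ?_ (hC.mem_closure_sdiff_singleton_of_mem (M.mem_fundCircuit f X))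
  intro x hx
  have hxX : x ∈ X := (M.fundCircuit_subset_insert f X hx.1).resolve_left hx.2
  exact ⟨hxX, fun hxT => h x hxT hxX (hX.isBase_exchange_of_mem_fundCircuit hxX hf hfX hx.1)⟩

/-- The fundamental circuit of e in X has an element other than e that B - e does not span, since
otherwise B - e would span e. -/
lemma IsBase.exists_symmetric_exchange (hX : M.IsBase X) (hB : M.IsBase B) (he : e ∈ B \ X) :
    ∃ f ∈ X \ B, M.IsBase (insert e (X \ {f})) ∧ M.IsBase (insert f (B \ {e})) := by
  have heE := hB.subset_ground he.1
  have hC := hX.fundCircuit_isCircuit heE he.2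
  have : ∃ x ∈ M.fundCircuit e X \ {e}, x ∉ M.closure (B \ {e}) := by
    by_contra! hcon
    have h1 := M.closure_subset_closure_of_subset_closure hcon
      (hC.mem_closure_sdiff_singleton_of_mem (M.mem_fundCircuit e X))
    exact hB.indep.notMem_closure_sdiff_of_mem he.1 h1
  obtain ⟨x, hx, hxcl⟩ := this
  have hxX : x ∈ X := (M.fundCircuit_subset_insert e X hx.1).resolve_left hx.2
  have hxE := hX.subset_ground hxX
  have hxB : x ∉ B := fun h => hxcl (M.mem_closure_of_mem' ⟨h, hx.2⟩ hxE)
  exact ⟨x, ⟨hxX, hxB⟩, hX.isBase_exchange_of_mem_fundCircuit hxX heE he.2 hx.1,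
    (hB.isBase_exchange_iff he.1 hxE hxB).2 hxcl⟩

/-- Two exchanges that form the only perfect matching among four elements can be performed
together. -/
lemma IsBase.isBase_double_exchange {b b' y y' : α} (hB : M.IsBase B) (hb : b ∈ B) (hb' : b' ∈ B)
    (hy : y ∈ M.E \ B) (hy' : y' ∈ M.E \ B) (h1 : M.IsBase (insert y (B \ {b})))
    (h2 : M.IsBase (insert y' (B \ {b'}))) (h3 : ¬ M.IsBase (insert y' (B \ {b}))) :
    M.IsBase (insert y' (insert y (B \ {b}) \ {b'})) := by
  have hbb : b ≠ b' := by rintro rfl; exact h3 h2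
  have hyy : y' ≠ y := by rintro rfl; exact h3 h1
  have hyb : y ≠ b' := by rintro rfl; exact hy.2 hb'
  rw [hB.isBase_exchange_iff hb hy.1 hy.2] at h1
  rw [hB.isBase_exchange_iff hb' hy'.1 hy'.2] at h2
  rw [hB.isBase_exchange_iff hb hy'.1 hy'.2, not_not] at h3
  have hB' := (hB.isBase_exchange_iff hb hy.1 hy.2).2 h1
  rw [hB'.isBase_exchange_iff (Or.inr ⟨hb', hbb.symm⟩) hy'.1
    (by rintro (h | h); exacts [hyy h, hy'.2 h.1]), ← Set.insert_sdiff_singleton_comm hyb]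
  -- By the exchange property of closure, y lies in the closure of I + y'. Both I and y' are spanned
  -- by B - b, hence so is y, against the feasibility of the exchange of b for y.
  intro hcl
  set I := (B \ {b}) \ {b'}
  have hI' : y' ∉ M.closure I := fun h => h2 (M.closure_subset_closure
    (Set.sdiff_subset_sdiff_left Set.sdiff_subset) h)
  have h4 := (M.closure_exchange ⟨hcl, hI'⟩).1
  have h5 : insert b' I = B \ {b} := by
    simp only [I, Set.insert_sdiff_singleton]
    exact Set.insert_eq_of_mem ⟨hb', hbb.symm⟩
  refine h1 (M.closure_subset_closure_of_subset_closure ?_ h4)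
  exact Set.insert_subset h3 (M.subset_closure_of_subset' Set.sdiff_subset
    ((Set.sdiff_subset.trans Set.sdiff_subset).trans hB.subset_ground))

/-- If the infeasible exchanges at `X` contain two blocks that partition both `X \ B` and `B \ X`,
then so do those at `B`. -/
lemma IsBase.not_isBase_of_two_blocks [M.Finite] {P₁ P₂ Q₁ Q₂ : Set α} (hX : M.IsBase X)
    (hB : M.IsBase B) (hP : X \ B = P₁ ∪ P₂) (hPd : Disjoint P₁ P₂) (hQ : B \ X = Q₁ ∪ Q₂)
    (hQd : Disjoint Q₁ Q₂) (h₁ : ∀ p ∈ P₁, ∀ q ∈ Q₁, ¬ M.IsBase (insert q (X \ {p})))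
    (h₂ : ∀ p ∈ P₂, ∀ q ∈ Q₂, ¬ M.IsBase (insert q (X \ {p}))) :
    ∀ q ∈ Q₂, ∀ p ∈ P₂, ¬ M.IsBase (insert p (B \ {q})) := by
  have hXf : X.Finite := M.ground_finite.subset hX.subset_ground
  have hBf : B.Finite := M.ground_finite.subset hB.subset_ground
  -- A block P × Q of infeasible exchanges means that X \ P spans Q. As (X ∩ B) ∪ Q is independent
  -- and X \ P = (X ∩ B) ∪ P', this bounds |Q| by |P'|.
  have key : ∀ {P Q P' Q' : Set α}, X \ B = P ∪ P' → Disjoint P P' → B \ X = Q ∪ Q' →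
      (∀ p ∈ P, ∀ q ∈ Q, ¬ M.IsBase (insert q (X \ {p}))) →
      ((X ∩ B) ∪ Q ⊆ M.closure (X \ P)) ∧ X \ P = (X ∩ B) ∪ P' ∧
        ((X ∩ B) ∪ Q).ncard ≤ (X \ P).ncard ∧ M.Indep ((X ∩ B) ∪ Q) := by
    intro P Q P' Q' hP hPd hQ h
    have hQs : Q ⊆ B \ X := hQ ▸ Set.subset_union_left
    have hXP : X \ P = (X ∩ B) ∪ P' := by
      ext x
      have h1 : x ∈ X \ B ↔ x ∈ P ∪ P' := by rw [hP]
      have h2 : ¬ (x ∈ P ∧ x ∈ P') := fun h => Set.disjoint_left.1 hPd h.1 h.2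
      simp only [Set.mem_sdiff, Set.mem_union, Set.mem_inter_iff] at *
      tauto
    have hsub : (X ∩ B) ∪ Q ⊆ M.closure (X \ P) := by
      apply Set.union_subset
      · refine subset_trans ?_ (M.subset_closure (X \ P) (Set.sdiff_subset.trans hX.subset_ground))
        rw [hXP]
        exact Set.subset_union_left
      · intro q hq
        exact hX.mem_closure_sdiff_of_forall_not_isBase (hB.subset_ground (hQs hq).1) (hQs hq).2
          fun p hp _ => h p hp q hq
    have hind : M.Indep ((X ∩ B) ∪ Q) := hB.indep.subset
      (Set.union_subset Set.inter_subset_right fun q hq => (hQs hq).1)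
    refine ⟨hsub, hXP, ?_, hind⟩
    have h1 := hind.encard_le_eRk_of_subset hsub
    rw [eRk_closure_eq, (hX.indep.subset Set.sdiff_subset).eRk_eq_encard] at h1
    rw [← (M.ground_finite.subset hind.subset_ground).cast_ncard_eq,
      ← (hXf.subset Set.sdiff_subset).cast_ncard_eq] at h1
    exact_mod_cast h1
  obtain ⟨hs, hXP, hc1, hi1⟩ := key hP hPd hQ h₁
  obtain ⟨-, hXP', hc2, -⟩ := key ((Set.union_comm P₁ P₂) ▸ hP) hPd.symm
    ((Set.union_comm Q₁ Q₂) ▸ hQ) h₂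
  have fP : (P₁ ∪ P₂).Finite := hP ▸ hXf.subset Set.sdiff_subset
  have fQ : (Q₁ ∪ Q₂).Finite := hQ ▸ hBf.subset Set.sdiff_subset
  have fP1 := fP.subset Set.subset_union_left
  have fP2 := fP.subset Set.subset_union_right
  have fQ1 := fQ.subset Set.subset_union_left
  have fQ2 := fQ.subset Set.subset_union_right
  have fI : (X ∩ B).Finite := hXf.subset Set.inter_subset_left
  have dis : ∀ {S : Set α}, S ⊆ X \ B ∪ B \ X → Disjoint (X ∩ B) S := by
    intro S hS
    refine Set.disjoint_left.2 fun x hx hxS => ?_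
    rcases hS hxS with h | h
    exacts [h.2 hx.2, h.2 hx.1]
  have card : (P₁ ∪ P₂).ncard = (Q₁ ∪ Q₂).ncard := by
    rw [← hP, ← hQ]
    exact hX.ncard_sdiff_comm hB
  rw [Set.ncard_union_eq hPd fP1 fP2, Set.ncard_union_eq hQd fQ1 fQ2] at card
  have e1 : ((X ∩ B) ∪ Q₁).ncard = (X ∩ B).ncard + Q₁.ncard := Set.ncard_union_eq
    (dis (by rw [hQ]; exact Set.subset_union_left.trans Set.subset_union_right)) fI fQ1
  have e2 : ((X ∩ B) ∪ Q₂).ncard = (X ∩ B).ncard + Q₂.ncard := Set.ncard_union_eq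
    (dis (by rw [hQ]; exact Set.subset_union_right.trans Set.subset_union_right)) fI fQ2
  have e3 : ((X ∩ B) ∪ P₁).ncard = (X ∩ B).ncard + P₁.ncard := Set.ncard_union_eq
    (dis (by rw [hP]; exact Set.subset_union_left.trans Set.subset_union_left)) fI fP1
  have e4 : ((X ∩ B) ∪ P₂).ncard = (X ∩ B).ncard + P₂.ncard := Set.ncard_union_eq
    (dis (by rw [hP]; exact Set.subset_union_right.trans Set.subset_union_left)) fI fP2
  rw [hXP, e1, e4] at hc1
  rw [hXP', e2, e3] at hc2
  -- The bounds |Q₁| ≤ |P₂| and |Q₂| ≤ |P₁| are equalities because the totals agree. So (X ∩ B) ∪ Q₁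
  -- spans X \ P₁, in particular P₂, and it avoids every q ∈ Q₂.
  have hQP : Q₁.ncard = P₂.ncard := by omega
  have hcl : M.closure ((X ∩ B) ∪ Q₁) = M.closure (M.closure (X \ P₁)) := by
    apply IsRkFinite.closure_eq_closure_of_subset_of_eRk_ge_eRk
    · exact M.isRkFinite_set _
    · exact hs
    · rw [eRk_closure_eq, (hX.indep.subset Set.sdiff_subset).eRk_eq_encard, hi1.eRk_eq_encard, hXP]
      rw [← (fI.union fP2).cast_ncard_eq, ← (fI.union fQ1).cast_ncard_eq, e1, e4, hQP]
  rw [closure_closure] at hcl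
  intro q hq p hp hbase
  have hqB : q ∈ B \ X := by rw [hQ]; exact Or.inr hq
  have hpX : p ∈ X \ B := by rw [hP]; exact Or.inr hp
  have hpE := hX.subset_ground hpX.1
  rw [hB.isBase_exchange_iff hqB.1 hpE hpX.2] at hbase
  apply hbase
  have hpcl : p ∈ M.closure (X \ P₁) :=
    M.mem_closure_of_mem' ⟨hpX.1, fun h => Set.disjoint_left.1 hPd h hp⟩ hpE
  rw [← hcl] at hpcl
  refine M.closure_subset_closure ?_ hpcl
  rintro x (hx | hx)
  · exact ⟨hx.2, fun h => hqB.2 (h ▸ hx.1)⟩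
  · have : x ∈ B \ X := by rw [hQ]; exact Or.inl hx
    exact ⟨this.1, fun h => Set.disjoint_left.1 hQd hx (h ▸ hq)⟩

end Exchange
end Matroid

namespace Matroid

/-! ## The linear span of the base polytope -/

section Polytope

open Classical in
/-- The vector `e_f - e_e`. -/
noncomputable def exchangeVector {α : Type*} (e f : α) : α → ℝ := Pi.single f 1 - Pi.single e 1

/-- The linear functional `x ↦ x(F)`. -/
noncomputable def sumOn {α : Type*} (F : Finset α) : (α → ℝ) →ₗ[ℝ] ℝ :=
  ∑ i ∈ F, LinearMap.proj i

/-- The direction space of the base polytope. -/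
noncomputable def direction {α : Type*} (M : Matroid α) : Submodule ℝ (α → ℝ) :=
  vectorSpan ℝ M.basePolytope

/-- The characteristic vectors of the bases that meet `F` in a set of size `r_M(F)`. -/
def tightVectors {α : Type*} (M : Matroid α) (F : Finset α) : Set (α → ℝ) :=
  {x | (∃ B, M.IsBase B ∧ x = B.indicator 1) ∧ sumOn F x = ((M.eRk F).toNat : ℝ)}

/-- `e` and `f` lie in the same connected component, expressed by the affine hull of the base
polytope. -/
def SameClass {α : Type*} (M : Matroid α) (e f : α) : Prop := exchangeVector e f ∈ M.direction

variable {α : Type*} {M : Matroid α} {X B : Set α} {e f g : α} {F G : Finset α}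

lemma sumOn_apply (F : Finset α) (x : α → ℝ) : sumOn F x = ∑ i ∈ F, x i := by
  simp [sumOn]

open Classical in
lemma exchangeVector_apply (e f i : α) :
    exchangeVector e f i = (if i = f then 1 else 0) - (if i = e then 1 else 0) := by
  simp [exchangeVector, Pi.single_apply]

open Classical in
lemma sumOn_exchangeVector (F : Finset α) (e f : α) :
    sumOn F (exchangeVector e f) = (if f ∈ F then 1 else 0) - (if e ∈ F then 1 else 0) := by
  simp [sumOn_apply, exchangeVector_apply]

lemma indicator_exchange (he : e ∈ X) (hf : f ∉ X) :
    (insert f (X \ {e})).indicator (1 : α → ℝ) = X.indicator 1 + exchangeVector e f := by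
  classical
  ext i
  have : f ≠ e := by rintro rfl; exact hf he
  simp only [Pi.add_apply, exchangeVector_apply, Set.indicator_apply, Set.mem_insert_iff,
    Set.mem_sdiff, Set.mem_singleton_iff, Pi.one_apply]
  by_cases h1 : i = f
  · subst h1; simp [hf, this]
  · by_cases h2 : i = e
    · subst h2; simp [he, h1]
    · simp [h1, h2]

lemma sameClass_refl (e : α) : M.SameClass e e := by
  simp [SameClass, exchangeVector]

lemma SameClass.symm (h : M.SameClass e f) : M.SameClass f e := by
  have := M.direction.neg_mem h
  rwa [exchangeVector, neg_sub] at this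

lemma SameClass.trans (h : M.SameClass e f) (h' : M.SameClass f g) : M.SameClass e g := by
  have := M.direction.add_mem h' h
  rwa [exchangeVector, exchangeVector, sub_add_sub_cancel] at this

lemma IsBase.indicator_mem_basePolytope (hX : M.IsBase X) :
    X.indicator 1 ∈ M.basePolytope :=
  subset_convexHull ℝ _ ⟨X, hX, rfl⟩

lemma IsBase.indicator_sub_mem_direction (hX : M.IsBase X) (hB : M.IsBase B) :
    B.indicator 1 - X.indicator 1 ∈ M.direction :=
  vsub_mem_vectorSpan ℝ hB.indicator_mem_basePolytope hX.indicator_mem_basePolytope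

lemma IsBase.sameClass_of_isBase_exchange (hX : M.IsBase X) (he : e ∈ X) (hf : f ∉ X)
    (h : M.IsBase (insert f (X \ {e}))) : M.SameClass e f := by
  have := hX.indicator_sub_mem_direction h
  rwa [indicator_exchange he hf, add_sub_cancel_left] at this

/-- The direction space of the base polytope is spanned by the feasible exchanges at any base. -/
lemma IsBase.direction_le [M.Finite] (hX : M.IsBase X) {W : Submodule ℝ (α → ℝ)}
    (hW : ∀ e ∈ X, ∀ f ∉ X, M.IsBase (insert f (X \ {e})) → exchangeVector e f ∈ W) :
    M.direction ≤ W := by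
  -- The symmetry of the exchange is essential: B - b + x is closer to X, while X - x + b is a base
  -- too, so the difference vector is a feasible exchange at the fixed base X.
  have key : ∀ n : ℕ, ∀ B, M.IsBase B → (B \ X).ncard = n → B.indicator 1 - X.indicator 1 ∈ W := by
    intro n
    induction n with
    | zero =>
      intro B hB hn
      have hfin : (B \ X).Finite := M.ground_finite.subset (Set.sdiff_subset.trans hB.subset_ground)
      rw [Set.ncard_eq_zero hfin, Set.sdiff_eq_empty] at hn
      rw [hB.eq_of_subset_isBase hX hn, sub_self]
      exact W.zero_mem
    | succ n ih =>
      intro B hB hn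
      have hne : (B \ X).Nonempty := by
        rw [Set.nonempty_iff_ne_empty]
        intro h
        rw [h, Set.ncard_empty] at hn
        omega
      obtain ⟨b, hb⟩ := hne
      obtain ⟨x, hx, h1, h2⟩ := hX.exists_symmetric_exchange hB hb
      have hsd : insert x (B \ {b}) \ X = (B \ X) \ {b} := by
        ext i
        simp only [Set.mem_sdiff, Set.mem_insert_iff, Set.mem_singleton_iff]
        constructor
        · rintro ⟨rfl | h, h'⟩
          · exact absurd hx.1 h'
          · exact ⟨⟨h.1, h'⟩, h.2⟩
        · rintro ⟨⟨h, h'⟩, h''⟩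
          exact ⟨Or.inr ⟨h, h''⟩, h'⟩
      have h3 := ih _ h2 (by rw [hsd, Set.ncard_sdiff_singleton_of_mem hb, hn]; rfl)
      have h4 := W.add_mem h3 (hW x hx.1 b hb.2 h1)
      rw [indicator_exchange hb.1 hx.2] at h4
      convert h4 using 1
      simp only [exchangeVector]
      abel
  rw [direction, basePolytope, ← direction_affineSpan, affineSpan_convexHull, direction_affineSpan,
    vectorSpan_def, Submodule.span_le]
  rintro _ ⟨_, ⟨B, hB, rfl⟩, _, ⟨B', hB', rfl⟩, rfl⟩
  have := W.sub_mem (key _ B hB rfl) (key _ B' hB' rfl)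
  rwa [sub_sub_sub_cancel_right] at this

lemma sumOn_indicator (F : Finset α) (X : Set α) :
    sumOn F (X.indicator 1) = ((X ∩ F).ncard : ℝ) := by
  classical
  rw [sumOn_apply]
  have : X ∩ (F : Set α) = ((F.filter (· ∈ X) : Finset α) : Set α) := by
    ext; simp [and_comm]
  rw [this, Set.ncard_coe_finset]
  simp [Set.indicator_apply]

lemma IsBase.sumOn_indicator_le (hB : M.IsBase B) (F : Finset α) :
    sumOn F (B.indicator 1) ≤ ((M.eRk F).toNat : ℝ) := by
  rw [sumOn_indicator]
  have hI : M.Indep (B ∩ F) := hB.indep.subset Set.inter_subset_left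
  have h1 := hI.encard_le_eRk_of_subset (Set.inter_subset_right (t := (F : Set α)))
  have h2 : M.eRk F ≠ ⊤ := by
    rw [eRk_ne_top_iff]
    exact M.isRkFinite_of_finite F.finite_toSet
  have h3 : (B ∩ (F : Set α)).ncard ≤ (M.eRk F).toNat := by
    rw [Set.ncard_def]
    exact ENat.toNat_le_toNat h1 h2
  exact_mod_cast h3

lemma sumOn_le_of_mem_basePolytope {x : α → ℝ} (hx : x ∈ M.basePolytope) (F : Finset α) :
    sumOn F x ≤ ((M.eRk F).toNat : ℝ) := by
  have : M.basePolytope ⊆ {x | sumOn F x ≤ ((M.eRk F).toNat : ℝ)} := by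
    apply convexHull_min
    · rintro _ ⟨B, hB, rfl⟩
      exact hB.sumOn_indicator_le F
    · exact convex_halfSpace_le (sumOn F).isLinear _
  exact this hx

lemma rankHyperplane_eq (M : Matroid α) (F : Finset α) :
    M.rankHyperplane F = {x | sumOn F x = ((M.eRk F).toNat : ℝ)} := by
  ext; simp [rankHyperplane, sumOn_apply]

lemma tightVectors_subset_rankFace (M : Matroid α) (F : Finset α) :
    M.tightVectors F ⊆ M.rankFace F := by
  rintro _ ⟨⟨B, hB, rfl⟩, h⟩
  exact ⟨hB.indicator_mem_basePolytope, by rwa [rankHyperplane_eq]⟩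

lemma vectorSpan_rankFace_le (M : Matroid α) (F : Finset α) :
    vectorSpan ℝ (M.rankFace F) ≤ M.direction ⊓ LinearMap.ker (sumOn F) := by
  rw [vectorSpan_def, Submodule.span_le]
  rintro _ ⟨x, ⟨hx, hx'⟩, y, ⟨hy, hy'⟩, rfl⟩
  rw [rankHyperplane_eq] at hx' hy'
  refine ⟨vsub_mem_vectorSpan ℝ hx hy, ?_⟩
  simp only [SetLike.mem_coe, LinearMap.mem_ker, vsub_eq_sub, map_sub]
  rw [hx', hy', sub_self]

lemma apply_eq_zero_of_mem_direction {u : α → ℝ} (hu : u ∈ M.direction) {v : α} (hv : v ∉ M.E) :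
    u v = 0 := by
  have : M.direction ≤ LinearMap.ker (LinearMap.proj v : (α → ℝ) →ₗ[ℝ] ℝ) := by
    rw [direction, basePolytope, ← direction_affineSpan, affineSpan_convexHull,
      direction_affineSpan, vectorSpan_def, Submodule.span_le]
    rintro _ ⟨_, ⟨B, hB, rfl⟩, _, ⟨B', hB', rfl⟩, rfl⟩
    have h1 : v ∉ B := fun h => hv (hB.subset_ground h)
    have h2 : v ∉ B' := fun h => hv (hB'.subset_ground h)
    simp [h1, h2]
  exact this hu

lemma IsBase.mem_affineSpan (hX : M.IsBase X) {u : α → ℝ} (hu : u ∈ M.direction) :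
    X.indicator 1 + u ∈ affineSpan ℝ M.basePolytope := by
  have h1 := subset_affineSpan ℝ _ hX.indicator_mem_basePolytope
  rw [direction, ← direction_affineSpan] at hu
  have := AffineSubspace.vadd_mem_of_mem_direction hu h1
  rwa [vadd_eq_add, add_comm] at this

lemma mem_direction_of_mem_affineSpan {x y : α → ℝ} (hx : x ∈ affineSpan ℝ M.basePolytope)
    (hy : y ∈ affineSpan ℝ M.basePolytope) : x - y ∈ M.direction := by
  rw [direction, ← direction_affineSpan]
  exact AffineSubspace.vsub_mem_direction hx hy

/-- A point of the cube section is in the relative interior if it lies strictly between the bounds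
in each coordinate that varies over the base polytope. -/
lemma mem_intrinsicInterior_cubeSection [M.Finite] {z : α → ℝ} (hz : z ∈ M.cubeSection)
    (h : ∀ v, (∀ u ∈ M.direction, u v = 0) ∨ (0 < z v ∧ z v < 1)) :
    z ∈ intrinsicInterior ℝ M.cubeSection := by
  have hsub : affineSpan ℝ M.cubeSection ≤ affineSpan ℝ M.basePolytope :=
    affineSpan_le.2 Set.inter_subset_left
  rw [mem_intrinsicInterior]
  refine ⟨⟨z, subset_affineSpan ℝ _ hz⟩, ?_, rfl⟩
  rw [mem_interior]
  -- The type may be infinite, so the open set constrains only the finitely many coordinates that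
  -- vary; the others are constant on the affine hull.
  let U : Set (α → ℝ) :=
    ⋂ v ∈ {v | v ∈ M.E ∧ ¬ ∀ u ∈ M.direction, u v = 0}, {x | 0 < x v ∧ x v < 1}
  have hU : IsOpen U := by
    apply Set.Finite.isOpen_biInter (M.ground_finite.subset fun v hv => hv.1)
    intro v _
    exact (isOpen_lt continuous_const (continuous_apply v)).inter
      (isOpen_lt (continuous_apply v) continuous_const)
  refine ⟨(↑) ⁻¹' U, ?_, hU.preimage continuous_subtype_val, ?_⟩
  · rintro ⟨x, hx⟩ hxU
    have hxa := hsub hx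
    have hbd : ∀ v, 0 ≤ x v ∧ x v ≤ 1 := by
      intro v
      by_cases hv : ∀ u ∈ M.direction, u v = 0
      · have h1 := hv _ (mem_direction_of_mem_affineSpan hxa hz.1)
        have h2 : x v = z v := by simpa [sub_eq_zero] using h1
        rw [h2]
        exact ⟨hz.2.1 v, hz.2.2 v⟩
      · have hvE : v ∈ M.E := by
          by_contra hvE
          exact hv fun u hu => apply_eq_zero_of_mem_direction hu hvE
        have := Set.mem_iInter₂.1 hxU v ⟨hvE, hv⟩
        exact ⟨this.1.le, this.2.le⟩
    exact ⟨hxa, fun v => (hbd v).1, fun v => (hbd v).2⟩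
  · refine Set.mem_iInter₂.2 fun v hv => ?_
    exact (h v).resolve_left hv.2

end Polytope
end Matroid

namespace Matroid

/-! ## Flacets that separate an infeasible exchange -/

section Flacet

variable {α : Type*} {M : Matroid α} {X B : Set α} {e f g : α} {F G : Finset α}

/-- `F` is a set of full rank in `X` whose rank inequality defines a facet and shows that `e` cannot
be exchanged for `f` at the base `X`. -/
structure IsSeparating (M : Matroid α) (X : Set α) (e f : α) (F : Finset α) : Prop where
  isBase : M.IsBase X
  left_mem : e ∈ X
  right_notMem : f ∉ X
  sameClass : M.SameClass e f
  subset_ground : (F : Set α) ⊆ M.E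
  right_mem_set : f ∈ F
  left_notMem_set : e ∉ F
  sameClass_of_mem : ∀ v ∈ F, M.SameClass v f
  tight : sumOn F (X.indicator 1) = ((M.eRk F).toNat : ℝ)
  direction_le : M.direction ≤
    vectorSpan ℝ (M.tightVectors F) ⊔ Submodule.span ℝ {exchangeVector e f}

lemma finite_setOf_indicator_isBase (M : Matroid α) [M.Finite] :
    {x : α → ℝ | ∃ B, M.IsBase B ∧ x = B.indicator 1}.Finite := by
  refine (M.ground_finite.finite_subsets.image fun B => B.indicator (1 : α → ℝ)).subset ?_
  rintro _ ⟨B, hB, rfl⟩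
  exact ⟨B, hB.subset_ground, rfl⟩

lemma finiteDimensional_direction (M : Matroid α) [M.Finite] :
    FiniteDimensional ℝ M.direction := by
  rw [direction, basePolytope, ← direction_affineSpan, affineSpan_convexHull, direction_affineSpan]
  exact finiteDimensional_vectorSpan_of_finite ℝ M.finite_setOf_indicator_isBase

namespace IsSeparating

lemma sumOn_exchangeVector_eq_one (h : M.IsSeparating X e f F) :
    sumOn F (exchangeVector e f) = 1 := by
  rw [sumOn_exchangeVector, if_pos h.right_mem_set, if_neg h.left_notMem_set, sub_zero]

/-- The functional x(F) vanishes on differences of tight vectors and is 1 on `exchangeVector e f`,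
so a direction in its kernel has no component along that vector. -/
lemma inf_ker_le (h : M.IsSeparating X e f F) :
    M.direction ⊓ LinearMap.ker (sumOn F) ≤ vectorSpan ℝ (M.tightVectors F) := by
  rintro u ⟨hu, hu'⟩
  obtain ⟨a, ha, b, hb, rfl⟩ := Submodule.mem_sup.1 (h.direction_le hu)
  obtain ⟨c, rfl⟩ := Submodule.mem_span_singleton.1 hb
  have ha' := vectorSpan_rankFace_le M F (vectorSpan_mono ℝ (tightVectors_subset_rankFace M F) ha)
  have h1 : sumOn F a = 0 := ha'.2
  have h2 : sumOn F (a + c • exchangeVector e f) = 0 := hu'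
  rw [map_add, h1, map_smul, h.sumOn_exchangeVector_eq_one] at h2
  have hc : c = 0 := by simpa using h2
  simpa [hc] using ha

lemma vectorSpan_rankFace (h : M.IsSeparating X e f F) :
    vectorSpan ℝ (M.rankFace F) = M.direction ⊓ LinearMap.ker (sumOn F) :=
  (vectorSpan_rankFace_le M F).antisymm
    (h.inf_ker_le.trans (vectorSpan_mono ℝ (tightVectors_subset_rankFace M F)))

/-- The direction space of the face is the kernel of x(F) on the direction space of the polytope,
and the line of `exchangeVector e f` is a complement of it. -/
lemma definesFacet [M.Finite] (h : M.IsSeparating X e f F) : M.DefinesFacet F := by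
  refine ⟨h.subset_ground, ?_⟩
  rw [h.vectorSpan_rankFace]
  change _ = Module.finrank ℝ M.direction
  have := M.finiteDimensional_direction
  set K := M.direction ⊓ LinearMap.ker (sumOn F)
  set W := Submodule.span ℝ {exchangeVector e f}
  have : FiniteDimensional ℝ K := Submodule.finiteDimensional_inf_left _ _
  have hinf : K ⊓ W = ⊥ := by
    rw [eq_bot_iff]
    rintro u ⟨hu, hu'⟩
    obtain ⟨c, rfl⟩ := Submodule.mem_span_singleton.1 hu'
    have h2 : sumOn F (c • exchangeVector e f) = 0 := hu.2
    rw [map_smul, h.sumOn_exchangeVector_eq_one] at h2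
    have hc : c = 0 := by simpa using h2
    simp [hc]
  have hsup : K ⊔ W = M.direction := by
    apply le_antisymm
    · refine sup_le inf_le_left ?_
      rw [Submodule.span_singleton_le_iff_mem]
      exact h.sameClass
    · refine h.direction_le.trans (sup_le_sup_right ?_ _)
      exact (vectorSpan_mono ℝ (tightVectors_subset_rankFace M F)).trans (vectorSpan_rankFace_le M F)
  have hne : exchangeVector e f ≠ 0 := by
    intro h0
    have := h.sumOn_exchangeVector_eq_one
    rw [h0, map_zero] at this
    exact zero_ne_one this
  have h3 := Submodule.finrank_sup_add_finrank_inf_eq K W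
  rw [hinf, hsup, finrank_bot, finrank_span_singleton hne] at h3
  omega

/-- As F is tight at X, no feasible exchange can enlarge the intersection with F. -/
lemma crossing (h : M.IsSeparating X e f F) {x y : α} (hx : x ∈ X) (hy : y ∉ X)
    (hb : M.IsBase (insert y (X \ {x}))) (hyF : y ∈ F) : x ∈ F := by
  by_contra hxF
  have h1 := hb.sumOn_indicator_le F
  rw [indicator_exchange hx hy, map_add, h.tight, sumOn_exchangeVector, if_pos hyF,
    if_neg hxF] at h1
  linarith

/-- A coordinate that varies over the base polytope also varies over the facet. -/
lemma exists_tight_varying [M.Finite] (h : M.IsSeparating X e f F) {v : α}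
    (hv : ¬ ∀ u ∈ M.direction, u v = 0) :
    ∃ w ∈ M.direction ⊓ LinearMap.ker (sumOn F), w v ≠ 0 := by
  -- Feasible exchanges at X span the direction space, so one of them moves v. If it does not cross
  -- the boundary of F, its vector already lies in the kernel of x(F).
  have hedge : ∃ x ∈ X, ∃ y ∉ X, M.IsBase (insert y (X \ {x})) ∧ (v = x ∨ v = y) := by
    by_contra! hcon
    have hle : M.direction ≤ LinearMap.ker (LinearMap.proj v : (α → ℝ) →ₗ[ℝ] ℝ) := by
      refine h.isBase.direction_le fun x hx y hy hb => ?_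
      have := hcon x hx y hy hb
      simp [exchangeVector_apply, this.1, this.2]
    exact hv fun u hu => hle hu
  obtain ⟨x, hx, y, hy, hb, hvxy⟩ := hedge
  have hxy : x ≠ y := by rintro rfl; exact hy hx
  have hcl := h.isBase.sameClass_of_isBase_exchange hx hy hb
  by_cases hyF : y ∈ F
  · have hxF := h.crossing hx hy hb hyF
    refine ⟨exchangeVector x y, ⟨hcl, ?_⟩, ?_⟩
    · simp [sumOn_exchangeVector, hxF, hyF]
    · rcases hvxy with rfl | rfl <;> simp [exchangeVector_apply, hxy, hxy.symm]
  -- A crossing exchange goes from x ∈ F to y ∉ F. Then v is paired instead with whichever of f, e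
  -- lies on its side of F; the new vector is in the direction space even though it need not come
  -- from a feasible exchange.
  · by_cases hxF : x ∈ F
    · rcases hvxy with rfl | rfl
      · have hvf : v ≠ f := by rintro rfl; exact h.right_notMem hx
        refine ⟨exchangeVector v f, ⟨h.sameClass_of_mem v hxF, ?_⟩, ?_⟩
        · simp [sumOn_exchangeVector, hxF, h.right_mem_set]
        · simp [exchangeVector_apply, hvf]
      · have hve : v ≠ e := by rintro rfl; exact hy h.left_mem
        refine ⟨exchangeVector v e,
          ⟨(hcl.symm.trans (h.sameClass_of_mem x hxF)).trans h.sameClass.symm, ?_⟩, ?_⟩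
        · simp [sumOn_exchangeVector, hyF, h.left_notMem_set]
        · simp [exchangeVector_apply, hve]
    · refine ⟨exchangeVector x y, ⟨hcl, ?_⟩, ?_⟩
      · simp [sumOn_exchangeVector, hxF, hyF]
      · rcases hvxy with rfl | rfl <;> simp [exchangeVector_apply, hxy, hxy.symm]

/-- The barycenter of the vertices of the facet is in the relative interior of the cube section. -/
lemma exists_interior_point [M.Finite] (h : M.IsSeparating X e f F) :
    ∃ p ∈ M.basePolytope, sumOn F p = ((M.eRk F).toNat : ℝ) ∧
      ∀ v, (∀ u ∈ M.direction, u v = 0) ∨ (0 < p v ∧ p v < 1) := by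
  have hfin : (M.tightVectors F).Finite :=
    M.finite_setOf_indicator_isBase.subset fun x hx => hx.1
  set T := hfin.toFinset with hT
  have hmem : ∀ x, x ∈ T ↔ x ∈ M.tightVectors F := fun x => hfin.mem_toFinset
  have hXT : X.indicator 1 ∈ T := (hmem _).2 ⟨⟨X, h.isBase, rfl⟩, h.tight⟩
  have hcard : (0 : ℝ) < T.card := by exact_mod_cast Finset.card_pos.2 ⟨_, hXT⟩
  set w : ℝ := (T.card : ℝ)⁻¹ with hw
  have hwpos : 0 < w := inv_pos.2 hcard
  have hwsum : ∑ _x ∈ T, w = 1 := by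
    rw [Finset.sum_const, nsmul_eq_mul, hw, mul_inv_cancel₀ hcard.ne']
  refine ⟨∑ x ∈ T, w • x, ?_, ?_, ?_⟩
  · refine (convex_convexHull ℝ _).sum_mem (fun _ _ => hwpos.le) hwsum fun x hx => ?_
    exact subset_convexHull ℝ _ ((hmem x).1 hx).1
  · rw [map_sum, Finset.sum_congr rfl (g := fun _ => w * ((M.eRk F).toNat : ℝ)), ← Finset.sum_mul,
      hwsum, one_mul]
    intro x hx
    rw [map_smul, ((hmem x).1 hx).2, smul_eq_mul]
  · intro v
    by_cases hv : ∀ u ∈ M.direction, u v = 0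
    · exact Or.inl hv
    right
    obtain ⟨u, hu, huv⟩ := h.exists_tight_varying hv
    have h01 : ∀ x ∈ T, x v = 0 ∨ x v = 1 := by
      intro x hx
      obtain ⟨⟨B, -, rfl⟩, -⟩ := (hmem x).1 hx
      by_cases hB : v ∈ B <;> simp [hB]
    -- If all tight vertices agreed at v, then so would all points of the facet, against
    -- `exists_tight_varying`. Taking c = 0 and c = 1 makes both values occur.
    have hvar : ∀ c : ℝ, ∃ x ∈ T, x v ≠ c := by
      intro c
      by_contra! hcon
      have hle : vectorSpan ℝ (M.tightVectors F) ≤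
          LinearMap.ker (LinearMap.proj v : (α → ℝ) →ₗ[ℝ] ℝ) := by
        rw [vectorSpan_def, Submodule.span_le]
        rintro _ ⟨x, hx, y, hy, rfl⟩
        simp [hcon x ((hmem x).2 hx), hcon y ((hmem y).2 hy)]
      exact huv (hle (h.inf_ker_le hu))
    obtain ⟨x, hx, hx0⟩ := hvar 0
    obtain ⟨y, hy, hy1⟩ := hvar 1
    have hev : (∑ x ∈ T, w • x) v = ∑ x ∈ T, w * x v := by
      simp [Finset.sum_apply]
    rw [hev]
    constructor
    · apply Finset.sum_pos'
      · intro z hz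
        rcases h01 z hz with h | h <;> simp [h, hwpos.le]
      · refine ⟨x, hx, ?_⟩
        rw [(h01 x hx).resolve_left hx0, mul_one]
        exact hwpos
    · rw [← hwsum]
      apply Finset.sum_lt_sum
      · intro z hz
        rcases h01 z hz with h | h <;> simp [h, hwpos.le]
      · refine ⟨y, hy, ?_⟩
        rw [(h01 y hy).resolve_right hy1, mul_zero]
        exact hwpos

lemma basePolytope_subset_cubeSection (M : Matroid α) : M.basePolytope ⊆ M.cubeSection := by
  refine Set.subset_inter (subset_affineSpan ℝ _) (convexHull_min ?_ (convex_Icc _ _))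
  rintro _ ⟨B, -, rfl⟩
  refine ⟨fun v => ?_, fun v => ?_⟩ <;> by_cases hB : v ∈ B <;> simp [hB]

lemma isSplitFlacet [M.Finite] (h : M.IsSeparating X e f F) : M.IsSplitFlacet F := by
  refine ⟨h.definesFacet, ?_⟩
  obtain ⟨p, hp, hpF, hpv⟩ := h.exists_interior_point
  refine ⟨p, ?_, mem_intrinsicInterior_cubeSection (basePolytope_subset_cubeSection M hp) hpv⟩
  rwa [rankHyperplane_eq]

/-- In a split matroid, the part of the cube section in the hyperplane of one of two distinct facets
satisfies the rank inequality of the other. -/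
lemma sumOn_le_of_isSplit [M.Finite] (hM : M.IsSplit) (h : M.IsSeparating X e f F) {X' : Set α}
    {e' f' : α} (h' : M.IsSeparating X' e' f' G) (hFG : M.rankFace F ≠ M.rankFace G) {q : α → ℝ}
    (hq : q ∈ M.cubeSection) (hqF : sumOn F q = ((M.eRk F).toNat : ℝ)) :
    sumOn G q ≤ ((M.eRk G).toNat : ℝ) := by
  by_contra! hlt
  obtain ⟨p, hp, hpF, hpv⟩ := h.exists_interior_point
  have hpQ := basePolytope_subset_cubeSection M hp
  have hpG := sumOn_le_of_mem_basePolytope hp G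
  set a := sumOn G p
  set b := sumOn G q
  set r := ((M.eRk G).toNat : ℝ)
  have hab : 0 < b - a := by linarith
  -- This is the parameter at which the segment from p to q meets the hyperplane of G. It is less
  -- than 1 because q lies strictly beyond it, so the point keeps a positive weight on p and
  -- inherits its strict coordinate bounds.
  set t := (r - a) / (b - a) with ht
  have ht0 : 0 ≤ t := div_nonneg (by linarith) hab.le
  have ht1 : t < 1 := by rw [ht, div_lt_one hab]; linarith
  set z := (1 - t) • p + t • q with hz
  have hconv : Convex ℝ M.cubeSection := (AffineSubspace.convex _).inter (convex_Icc _ _)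
  have hzQ : z ∈ M.cubeSection := hconv hpQ hq (by linarith) ht0 (by ring)
  have hzF : sumOn F z = ((M.eRk F).toNat : ℝ) := by
    rw [hz, map_add, map_smul, map_smul, hpF, hqF, smul_eq_mul, smul_eq_mul]
    ring
  have hzG : sumOn G z = r := by
    have : t * (b - a) = r - a := div_mul_cancel₀ _ hab.ne'
    rw [hz, map_add, map_smul, map_smul, smul_eq_mul, smul_eq_mul]
    change (1 - t) * a + t * b = r
    linarith
  have hzint : z ∈ intrinsicInterior ℝ M.cubeSection := by
    refine mem_intrinsicInterior_cubeSection hzQ fun v => (hpv v).imp_right fun hv => ?_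
    have h0 : 0 ≤ q v := hq.2.1 v
    have h1 : q v ≤ 1 := hq.2.2 v
    have hzv : z v = (1 - t) * p v + t * q v := by simp [hz]
    rw [hzv]
    constructor
    · have := mul_pos (sub_pos.2 ht1) hv.1
      have := mul_nonneg ht0 h0
      linarith
    · have h2 : (1 - t) * p v < (1 - t) * 1 := mul_lt_mul_of_pos_left hv.2 (sub_pos.2 ht1)
      have h3 : t * q v ≤ t * 1 := mul_le_mul_of_nonneg_left h1 ht0
      linarith
  refine Set.disjoint_left.1 (hM F G h.isSplitFlacet h'.isSplitFlacet hFG)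
    ⟨?_, hzint⟩ ?_ <;> rw [rankHyperplane_eq]
  exacts [hzF, hzG]

end IsSeparating

/-! ### Construction -/

/-- `u` and `w` can be exchanged for each other at `X`. -/
def Exchangeable (M : Matroid α) (X : Set α) (u w : α) : Prop :=
  u ∈ X ∧ w ∉ X ∧ M.IsBase (insert w (X \ {u})) ∨ w ∈ X ∧ u ∉ X ∧ M.IsBase (insert u (X \ {w}))

/-- The elements that can be reached from `e` by feasible exchanges at `X`, avoiding `f` and all
elements that can be exchanged for `f`. -/
def farSide (M : Matroid α) (X : Set α) (e f : α) : Set α :=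
  {v | Relation.ReflTransGen
    (fun u w => M.Exchangeable X u w ∧ ¬ (w = f ∨ w ∈ X ∧ M.IsBase (insert f (X \ {w})))) e v}

lemma Exchangeable.symm {u w : α} (h : M.Exchangeable X u w) : M.Exchangeable X w u := Or.symm h

lemma IsBase.sameClass_of_exchangeable (hX : M.IsBase X) {u w : α} (h : M.Exchangeable X u w) :
    M.SameClass u w := by
  rcases h with ⟨h1, h2, h3⟩ | ⟨h1, h2, h3⟩
  · exact hX.sameClass_of_isBase_exchange h1 h2 h3
  · exact (hX.sameClass_of_isBase_exchange h1 h2 h3).symm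

lemma IsBase.mem_ground_of_exchangeable (hX : M.IsBase X) {u w : α} (h : M.Exchangeable X u w) :
    u ∈ M.E := by
  rcases h with ⟨h1, h2, h3⟩ | ⟨h1, h2, h3⟩
  · exact hX.subset_ground h1
  · exact h3.subset_ground (Set.mem_insert _ _)

/-- For the set S of elements reachable from u, the functional x(S) vanishes on all feasible
exchanges at X, hence on the direction space. On `exchangeVector u w` it would be -1 if w were not
reachable. -/
lemma IsBase.reflTransGen_exchangeable [M.Finite] (hX : M.IsBase X) {u w : α} (hu : u ∈ M.E)
    (h : M.SameClass u w) : Relation.ReflTransGen (M.Exchangeable X) u w := by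
  classical
  set S : Finset α := M.ground_finite.toFinset.filter (Relation.ReflTransGen (M.Exchangeable X) u)
  have hS : ∀ v, v ∈ S ↔ v ∈ M.E ∧ Relation.ReflTransGen (M.Exchangeable X) u v := by
    intro v; simp [S]
  have hle : M.direction ≤ LinearMap.ker (sumOn S) := by
    refine hX.direction_le fun x hx y hy hb => ?_
    have hxy : M.Exchangeable X x y := Or.inl ⟨hx, hy, hb⟩
    have hiff : x ∈ S ↔ y ∈ S := by
      rw [hS, hS]
      exact ⟨fun h => ⟨hX.mem_ground_of_exchangeable hxy.symm, h.2.tail hxy⟩,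
        fun h => ⟨hX.mem_ground_of_exchangeable hxy, h.2.tail hxy.symm⟩⟩
    simp [sumOn_exchangeVector, hiff]
  have h1 : sumOn S (exchangeVector u w) = 0 := hle h
  have huS : u ∈ S := (hS u).2 ⟨hu, .refl⟩
  by_contra hcon
  have hwS : w ∉ S := fun h => hcon ((hS w).1 h).2
  rw [sumOn_exchangeVector, if_pos huS, if_neg hwS] at h1
  norm_num at h1

/-- Every infeasible exchange within a component is separated by a split flacet. -/
theorem IsBase.exists_isSeparating [M.Finite] (hX : M.IsBase X) (he : e ∈ X) (hf : f ∈ M.E)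
    (hfX : f ∉ X) (hbad : ¬ M.IsBase (insert f (X \ {e}))) (hc : M.SameClass e f) :
    ∃ F, M.IsSeparating X e f F := by
  classical
  set D := M.farSide X e f with hD
  -- The component is cut into D, which is connected to e, and F, which will be connected to f.
  -- Since D keeps away from f and its neighbours, feasible exchanges cross the cut in one direction
  -- only; tightness comes from this and the facet property from the two connectivities.
  set F : Finset α := M.ground_finite.toFinset.filter fun v => M.SameClass v f ∧ v ∉ D with hF
  have hmF : ∀ v, v ∈ F ↔ v ∈ M.E ∧ M.SameClass v f ∧ v ∉ D := by intro v; simp [hF]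
  have hef : e ≠ f := by rintro rfl; exact hfX he
  have heE := hX.subset_ground he
  have hDnear : ∀ v ∈ D, ¬ (v = f ∨ v ∈ X ∧ M.IsBase (insert f (X \ {v}))) := by
    intro v hv
    rcases Relation.ReflTransGen.cases_tail hv with rfl | ⟨u, -, huv⟩
    · rintro (h | h)
      exacts [hef h, hbad h.2]
    · exact huv.2
  have hDE : ∀ v ∈ D, v ∈ M.E ∧ M.SameClass v f := by
    intro v hv
    induction hv with
    | refl => exact ⟨heE, hc⟩
    | tail _ h ih =>
      exact ⟨hX.mem_ground_of_exchangeable h.1.symm,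
        (hX.sameClass_of_exchangeable h.1.symm).trans ih.2⟩
  have hstep : ∀ {u w : α}, u ∈ D → M.Exchangeable X u w →
      ¬ (w = f ∨ w ∈ X ∧ M.IsBase (insert f (X \ {w}))) → w ∈ D := fun hu h hw =>
    Relation.ReflTransGen.tail hu ⟨h, hw⟩
  have heD : e ∈ D := Relation.ReflTransGen.refl
  have hfD : f ∉ D := fun h => hDnear f h (Or.inl rfl)
  have hfF : f ∈ F := (hmF f).2 ⟨hf, sameClass_refl f, hfD⟩
  have heF : e ∉ F := fun h => ((hmF e).1 h).2.2 heD
  have hcross : ∀ x ∈ X, ∀ y ∉ X, M.IsBase (insert y (X \ {x})) → y ∈ F → x ∈ F := by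
    intro x hx y hy hb hyF
    have hxy : M.Exchangeable X x y := Or.inl ⟨hx, hy, hb⟩
    have hyF' := (hmF y).1 hyF
    refine (hmF x).2 ⟨hX.subset_ground hx, (hX.sameClass_of_exchangeable hxy).trans hyF'.2.1, ?_⟩
    intro hxD
    by_cases hnear : y = f ∨ y ∈ X ∧ M.IsBase (insert f (X \ {y}))
    · rcases hnear with rfl | h
      · exact hDnear x hxD (Or.inr ⟨hx, hb⟩)
      · exact hy h.1
    · exact hyF'.2.2 (hstep hxD hxy hnear)
  -- An element of F \ X can be exchanged only with elements of X ∩ F, so X ∩ F spans it.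
  have htight : sumOn F (X.indicator 1) = ((M.eRk F).toNat : ℝ) := by
    have hbasis : M.IsBasis (X ∩ F) F := by
      rw [isBasis_iff_indep_closure]
      refine ⟨hX.indep.subset Set.inter_subset_left, ?_, Set.inter_subset_right⟩
      intro y hy
      have hyE := ((hmF y).1 hy).1
      by_cases hyX : y ∈ X
      · exact M.mem_closure_of_mem' ⟨hyX, hy⟩ hyE
      · have := hX.mem_closure_sdiff_of_forall_not_isBase (T := (F : Set α)ᶜ) hyE hyX
          fun x hxF hx hb => hxF (hcross x hx y hyX hb hy)
        rwa [Set.sdiff_compl] at this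
    rw [sumOn_indicator, ← hbasis.encard_eq_eRk, Set.ncard_def]
  have hXt : X.indicator 1 ∈ M.tightVectors F := ⟨⟨X, hX, rfl⟩, htight⟩
  set VT := vectorSpan ℝ (M.tightVectors F) with hVT
  have hnon' : ∀ x ∈ X, ∀ y ∉ X, M.IsBase (insert y (X \ {x})) → (x ∈ F ↔ y ∈ F) →
      exchangeVector x y ∈ VT := by
    intro x hx y hy hb hiff
    have h1 : (insert y (X \ {x})).indicator 1 ∈ M.tightVectors F := by
      refine ⟨⟨_, hb, rfl⟩, ?_⟩
      rw [indicator_exchange hx hy, map_add, htight, sumOn_exchangeVector]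
      simp [hiff]
    have := vsub_mem_vectorSpan ℝ h1 hXt
    rwa [vsub_eq_sub, indicator_exchange hx hy, add_sub_cancel_left] at this
  have hneg : ∀ {u w : α}, exchangeVector u w ∈ VT → exchangeVector w u ∈ VT := by
    intro u w h
    have := VT.neg_mem h
    rwa [exchangeVector, neg_sub] at this
  have hadd : ∀ {u v w : α}, exchangeVector u v ∈ VT → exchangeVector v w ∈ VT →
      exchangeVector u w ∈ VT := by
    intro u v w h h'
    have := VT.add_mem h' h
    rwa [exchangeVector, exchangeVector, sub_add_sub_cancel] at this
  have hnon : ∀ {u w : α}, M.Exchangeable X u w → (u ∈ F ↔ w ∈ F) → exchangeVector u w ∈ VT := by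
    rintro u w (⟨h1, h2, h3⟩ | ⟨h1, h2, h3⟩) hiff
    · exact hnon' u h1 w h2 h3 hiff
    · exact hneg (hnon' w h1 u h2 h3 hiff.symm)
  have hDconn : ∀ v ∈ D, exchangeVector e v ∈ VT := by
    intro v hv
    have hv' : Relation.ReflTransGen _ e v := hv
    induction hv' with
    | refl => simp [exchangeVector]
    | @tail b c h1 h2 ih =>
      have hbD : b ∈ D := h1
      exact hadd (ih hbD) (hnon h2.1 (iff_of_false (fun h => ((hmF b).1 h).2.2 hbD)
        fun h => ((hmF c).1 h).2.2 hv))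
  -- Follow a path of feasible exchanges from v to f. Until it reaches f or a neighbour of f it
  -- cannot enter D, because a step from D back to such an element would put that element into D.
  have hFconn : ∀ v ∈ F, exchangeVector v f ∈ VT := by
    intro v hv
    have hv' := (hmF v).1 hv
    have hr := hX.reflTransGen_exchangeable hv'.1 hv'.2.1
    clear hv'
    induction hr using Relation.ReflTransGen.head_induction_on with
    | refl => simp [exchangeVector]
    | @head a c h1 _ ih =>
      have ha := (hmF a).1 hv
      by_cases hnear : a = f ∨ a ∈ X ∧ M.IsBase (insert f (X \ {a}))
      · rcases hnear with rfl | h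
        · simp [exchangeVector]
        · exact hnon (Or.inl ⟨h.1, hfX, h.2⟩) (iff_of_true hv hfF)
      · have hcF : c ∈ F := (hmF c).2 ⟨hX.mem_ground_of_exchangeable h1.symm,
          (hX.sameClass_of_exchangeable h1.symm).trans ha.2.1,
          fun hcD => ha.2.2 (hstep hcD h1.symm hnear)⟩
        exact hadd (hnon h1 (iff_of_true hv hcF)) (ih hcF)
  refine ⟨F, hX, he, hfX, hc, fun v hv => ((hmF v).1 hv).1, hfF, heF,
    fun v hv => ((hmF v).1 hv).2.1, htight, ?_⟩
  refine hX.direction_le fun x hx y hy hb => ?_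
  have hxy : M.Exchangeable X x y := Or.inl ⟨hx, hy, hb⟩
  by_cases hiff : x ∈ F ↔ y ∈ F
  · exact Submodule.mem_sup_left (hnon hxy hiff)
  · have hyF : y ∉ F := fun hyF => hiff (iff_of_true (hcross x hx y hy hb hyF) hyF)
    have hxF : x ∈ F := by by_contra hxF; exact hiff (iff_of_false hxF hyF)
    have hyD : y ∈ D := by
      by_contra hyD
      exact hyF ((hmF y).2 ⟨hX.mem_ground_of_exchangeable hxy.symm,
        (hX.sameClass_of_exchangeable hxy.symm).trans ((hmF x).1 hxF).2.1, hyD⟩)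
    -- A crossing exchange differs from that of e and f only by connections inside F and inside D,
    -- so the crossing exchanges add a single dimension.
    have h1 : exchangeVector x y =
        (exchangeVector x f + exchangeVector e y) + (-1 : ℝ) • exchangeVector e f := by
      simp only [exchangeVector, neg_smul, one_smul]
      abel
    rw [h1]
    exact Submodule.add_mem_sup (VT.add_mem (hFconn x hxF) (hDconn y hyD))
      (Submodule.smul_mem _ _ (Submodule.mem_span_singleton_self _))

end Flacet
end Matroid

namespace Matroid

/-! ## Infeasible exchanges in a split matroid -/

section Split

variable {α : Type*} {M : Matroid α} {X X' : Set α} {e f e' f' : α} {F G : Finset α}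

/-- The exchanged set need not be a base. These points of Q(M), possibly outside P(M), are the test
points against which compatibility of the splits is used. -/
lemma IsBase.exchange_mem_cubeSection (hX : M.IsBase X) {x y : α} (hx : x ∈ X) (hy : y ∉ X)
    (h : M.SameClass x y) : X.indicator 1 + exchangeVector x y ∈ M.cubeSection := by
  refine ⟨hX.mem_affineSpan h, ?_⟩
  rw [← indicator_exchange hx hy]
  refine ⟨fun v => ?_, fun v => ?_⟩ <;> by_cases hB : v ∈ insert y (X \ {x}) <;> simp [hB]

namespace IsSeparating

lemma sumOn_eq_zero_iff (h : M.IsSeparating X e f F) (h' : M.IsSeparating X' e' f' G)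
    (hFG : M.rankFace F = M.rankFace G) {u : α → ℝ} (hu : u ∈ M.direction) :
    sumOn F u = 0 ↔ sumOn G u = 0 := by
  have h1 := h.vectorSpan_rankFace
  rw [hFG, h'.vectorSpan_rankFace] at h1
  have h2 : u ∈ M.direction ⊓ LinearMap.ker (sumOn G) ↔
    u ∈ M.direction ⊓ LinearMap.ker (sumOn F) := by rw [h1]
  simpa [hu] using h2.symm

/-- If the faces agreed, x(F) and x(G) would have the same zeros on the direction space. Whether
`exchangeVector x v` is such a zero tells whether v and x lie on the same side of a set, and x lies
on the same side of F as of G, so F = G would follow. -/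
lemma rankFace_ne (h : M.IsSeparating X e f F) (h' : M.IsSeparating X' e' f' G) (hFG : F ≠ G)
    (hff : M.SameClass f f') {x : α} (hx : M.SameClass x f) (hxFG : x ∈ F ↔ x ∈ G) :
    M.rankFace F ≠ M.rankFace G := by
  intro heq
  apply hFG
  have hz := fun {u : α → ℝ} => h.sumOn_eq_zero_iff h' heq (u := u)
  ext v
  constructor
  · intro hv
    by_contra hvG
    have hxv : M.SameClass x v := hx.trans (h.sameClass_of_mem v hv).symm
    have := hz hxv
    rw [sumOn_exchangeVector, sumOn_exchangeVector, if_pos hv, if_neg hvG] at this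
    by_cases hxF : x ∈ F
    · simp [hxF, hxFG.1 hxF] at this
    · have hxG : x ∉ G := fun h => hxF (hxFG.2 h)
      simp [hxF, hxG] at this
  · intro hv
    by_contra hvF
    have hxv : M.SameClass x v := (hx.trans hff).trans (h'.sameClass_of_mem v hv).symm
    have := hz hxv
    rw [sumOn_exchangeVector, sumOn_exchangeVector, if_pos hv, if_neg hvF] at this
    by_cases hxF : x ∈ F
    · simp [hxF, hxFG.1 hxF] at this
    · have hxG : x ∉ G := fun h => hxF (hxFG.2 h)
      simp [hxF, hxG] at this

/-- An exchange within a component that keeps the size of the intersection with one of two distinct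
facets cannot increase the size of the intersection with the other. -/
lemma mem_of_exchange [M.Finite] (hM : M.IsSplit) (h : M.IsSeparating X e f F)
    (h' : M.IsSeparating X e' f' G) (hFG : M.rankFace F ≠ M.rankFace G) {x y : α} (hx : x ∈ X)
    (hy : y ∉ X) (hxy : M.SameClass x y) (hF : x ∈ F ↔ y ∈ F) (hyG : y ∈ G) : x ∈ G := by
  by_contra hxG
  have h1 := sumOn_le_of_isSplit hM h h' hFG (h.isBase.exchange_mem_cubeSection hx hy hxy)
    (by rw [map_add, h.tight, sumOn_exchangeVector]; by_cases hyF : y ∈ F <;> simp [hF, hyF])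
  rw [map_add, h'.tight, sumOn_exchangeVector, if_pos hyG, if_neg hxG] at h1
  linarith

/-- Let v ∈ F \ G. If v ∈ X, exchanging v for f keeps the size of the intersection with F and raises
that with G; if v ∉ X, exchanging e for v keeps G and raises F. Either contradicts
`mem_of_exchange`, and G \ F is treated alike. -/
lemma eq_of_notMem_of_mem [M.Finite] (hM : M.IsSplit) (h : M.IsSeparating X e f F)
    (h' : M.IsSeparating X e' f' G) (hff : M.SameClass f f') (he : e ∉ G) (hf : f ∈ G) : F = G := by
  by_contra hne
  have hFG := h.rankFace_ne h' hne hff h.sameClass (iff_of_false h.left_notMem_set he)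
  have hGF := hFG.symm
  apply hne
  ext v
  constructor
  · intro hv
    by_contra hvG
    by_cases hvX : v ∈ X
    · exact hvG (mem_of_exchange hM h h' hFG hvX h.right_notMem (h.sameClass_of_mem v hv)
        (iff_of_true hv h.right_mem_set) hf)
    · exact h.left_notMem_set (mem_of_exchange hM h' h hGF h.left_mem hvX
        (h.sameClass.trans (h.sameClass_of_mem v hv).symm) (iff_of_false he hvG) hv)
  · intro hv
    by_contra hvF
    by_cases hvX : v ∈ X
    · exact hvF (mem_of_exchange hM h' h hGF hvX h.right_notMem
        ((h'.sameClass_of_mem v hv).trans hff.symm) (iff_of_true hv hf) h.right_mem_set)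
    · exact he (mem_of_exchange hM h h' hFG h.left_mem hvX
        ((h.sameClass.trans hff).trans (h'.sameClass_of_mem v hv).symm)
        (iff_of_false h.left_notMem_set hvF) hv)

/-- If f were not in G, exchanging e for f would leave the intersection with G unchanged and raise
that with F. -/
lemma eq_of_left [M.Finite] (hM : M.IsSplit) (h : M.IsSeparating X e f F)
    (h' : M.IsSeparating X e f' G) : F = G := by
  have hff : M.SameClass f f' := h.sameClass.symm.trans h'.sameClass
  refine eq_of_notMem_of_mem hM h h' hff h'.left_notMem_set ?_
  by_contra hfG
  have hne : F ≠ G := by rintro rfl; exact hfG h.right_mem_set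
  have hFG := h.rankFace_ne h' hne hff h.sameClass (iff_of_false h.left_notMem_set h'.left_notMem_set)
  exact h.left_notMem_set (mem_of_exchange hM h' h hFG.symm h.left_mem h.right_notMem h.sameClass
    (iff_of_false h'.left_notMem_set hfG) h.right_mem_set)

/-- If e were in G, then e and f would both be, and exchanging e for f would again leave G unchanged
and raise F. -/
lemma eq_of_right [M.Finite] (hM : M.IsSplit) (h : M.IsSeparating X e f F)
    (h' : M.IsSeparating X e' f G) : F = G := by
  refine eq_of_notMem_of_mem hM h h' (sameClass_refl f) ?_ h'.right_mem_set
  intro heG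
  have hne : F ≠ G := by rintro rfl; exact h.left_notMem_set heG
  have hFG := h.rankFace_ne h' hne (sameClass_refl f) (sameClass_refl f)
    (iff_of_true h.right_mem_set h'.right_mem_set)
  exact h.left_notMem_set (mem_of_exchange hM h' h hFG.symm h.left_mem h.right_notMem h.sameClass
    (iff_of_true heG h'.right_mem_set) h.right_mem_set)

end IsSeparating

/-- In a split matroid, the infeasible exchanges at a base within a component form a disjoint union
of complete bipartite graphs. -/
theorem IsSplit.not_isBase_exchange [M.Finite] (hM : M.IsSplit) (hX : M.IsBase X) (he : e ∈ X)
    (he' : e' ∈ X) (hf : f ∈ M.E \ X) (hf' : f' ∈ M.E \ X) (hee : M.SameClass e e')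
    (hef : M.SameClass e f) (hff : M.SameClass f f') (h1 : ¬ M.IsBase (insert f (X \ {e})))
    (h2 : ¬ M.IsBase (insert f' (X \ {e}))) (h3 : ¬ M.IsBase (insert f (X \ {e'}))) :
    ¬ M.IsBase (insert f' (X \ {e'})) := by
  obtain ⟨F, hF⟩ := hX.exists_isSeparating he hf.1 hf.2 h1 hef
  obtain ⟨G, hG⟩ := hX.exists_isSeparating he hf'.1 hf'.2 h2 (hef.trans hff)
  obtain ⟨H, hH⟩ := hX.exists_isSeparating he' hf.1 hf.2 h3 (hee.symm.trans hef)
  obtain rfl := IsSeparating.eq_of_left hM hF hG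
  obtain rfl := IsSeparating.eq_of_right hM hF hH
  -- One set F now separates all three infeasible exchanges. It contains f' and not e', so the
  -- fourth exchange would cross it in the forbidden direction.
  intro hb
  exact hH.left_notMem_set (hF.crossing he' hf'.2 hb hG.right_mem_set)

/-- Each exchange vector that spans the direction space lies entirely inside or entirely outside a
class. This allows points to be glued from different bases on different components. -/
lemma indicator_mem_direction [M.Finite] {X : Set α} (hX : M.IsBase X) (e : α) {u : α → ℝ}
    (hu : u ∈ M.direction) : {v | M.SameClass v e}.indicator u ∈ M.direction := by
  let φ : (α → ℝ) →ₗ[ℝ] (α → ℝ) :=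
    { toFun := fun u => {v | M.SameClass v e}.indicator u
      map_add' := fun u w => by ext v; by_cases hv : v ∈ {v | M.SameClass v e} <;> simp [hv]
      map_smul' := fun c u => by ext v; by_cases hv : v ∈ {v | M.SameClass v e} <;> simp [hv] }
  have : M.direction ≤ M.direction.comap φ := by
    refine hX.direction_le fun x hx y hy hb => ?_
    have hxy := hX.sameClass_of_isBase_exchange hx hy hb
    change {v | M.SameClass v e}.indicator (exchangeVector x y) ∈ M.direction
    by_cases hxe : M.SameClass x e
    · have : {v | M.SameClass v e}.indicator (exchangeVector x y) = exchangeVector x y := by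
        ext v
        by_cases hv : M.SameClass v e
        · simp [hv]
        · have h1 : v ≠ y := by rintro rfl; exact hv (hxy.symm.trans hxe)
          have h2 : v ≠ x := by rintro rfl; exact hv hxe
          simp [hv, exchangeVector_apply, h1, h2]
      rw [this]
      exact hxy
    · have hye : ¬ M.SameClass y e := fun h => hxe (hxy.trans h)
      have : {v | M.SameClass v e}.indicator (exchangeVector x y) = 0 := by
        ext v
        by_cases hv : M.SameClass v e
        · have h1 : v ≠ y := by rintro rfl; exact hye hv
          have h2 : v ≠ x := by rintro rfl; exact hxe hv
          simp [exchangeVector_apply, h1, h2]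
        · simp [hv]
      rw [this]
      exact M.direction.zero_mem
  exact this hu

/-- In a split matroid, at most one component has infeasible exchanges. -/
theorem IsSplit.sameClass_of_not_isBase [M.Finite] (hM : M.IsSplit) (hX : M.IsBase X)
    (hX' : M.IsBase X') (he : e ∈ X) (hf : f ∈ M.E \ X) (he' : e' ∈ X') (hf' : f' ∈ M.E \ X')
    (hef : M.SameClass e f) (hef' : M.SameClass e' f') (h : ¬ M.IsBase (insert f (X \ {e})))
    (h' : ¬ M.IsBase (insert f' (X' \ {e'}))) : M.SameClass e e' := by
  by_contra hcon
  obtain ⟨F, hF⟩ := hX.exists_isSeparating he hf.1 hf.2 h hef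
  obtain ⟨G, hG⟩ := hX'.exists_isSeparating he' hf'.1 hf'.2 h' hef'
  have hFf : ∀ v ∈ F, ¬ M.SameClass v f' := fun v hv hvf =>
    hcon ((hef.trans (hF.sameClass_of_mem v hv).symm).trans (hvf.trans hef'.symm))
  have hne : M.rankFace F ≠ M.rankFace G := by
    intro heq
    have := hF.sumOn_eq_zero_iff hG heq hef'
    rw [hG.sumOn_exchangeVector_eq_one, sumOn_exchangeVector, if_neg fun h => hFf _ h hef',
      if_neg fun h => hFf _ h (sameClass_refl f')] at this
    norm_num at this
  set C := {v | M.SameClass v f'} with hC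
  -- The test point q equals X' - e' + f' on the component C and X elsewhere. It is tight for F,
  -- which avoids C, and violates the inequality of G, which is contained in C.
  set u := C.indicator (X'.indicator (1 : α → ℝ) - X.indicator 1) + exchangeVector e' f' with hu
  have hud : u ∈ M.direction := M.direction.add_mem
    (indicator_mem_direction hX f' (hX.indicator_sub_mem_direction hX')) hef'
  set q := X.indicator (1 : α → ℝ) + u with hq
  have hqout : ∀ v, v ∉ C → q v = X.indicator 1 v := by
    intro v hv
    have h1 : v ≠ f' := by rintro rfl; exact hv (sameClass_refl v)
    have h2 : v ≠ e' := by rintro rfl; exact hv hef'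
    simp [hq, hu, hv, exchangeVector_apply, h1, h2]
  have hqin : ∀ v, v ∈ C → q v = (X'.indicator (1 : α → ℝ) + exchangeVector e' f') v := by
    intro v hv
    simp [hq, hu, hv]
    ring
  have hQ : q ∈ M.cubeSection := by
    refine ⟨hX.mem_affineSpan hud, ?_⟩
    have hb : ∀ v, 0 ≤ q v ∧ q v ≤ 1 := by
      intro v
      by_cases hv : v ∈ C
      · have := hX'.exchange_mem_cubeSection he' hf'.2 hef'
        rw [hqin v hv]
        exact ⟨this.2.1 v, this.2.2 v⟩
      · rw [hqout v hv]
        by_cases hvX : v ∈ X <;> simp [hvX]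
    exact ⟨fun v => (hb v).1, fun v => (hb v).2⟩
  have h1 := IsSeparating.sumOn_le_of_isSplit hM hF hG hne hQ (by
    rw [← hF.tight, sumOn_apply, sumOn_apply]
    exact Finset.sum_congr rfl fun v hv => hqout v (hFf v hv))
  have h2 : sumOn G q = sumOn G (X'.indicator 1 + exchangeVector e' f') := by
    rw [sumOn_apply, sumOn_apply]
    exact Finset.sum_congr rfl fun v hv => hqin v (hG.sameClass_of_mem v hv)
  rw [h2, map_add, hG.tight, hG.sumOn_exchangeVector_eq_one] at h1
  linarith

end Split
end Matroid

/-! ## Relations all of whose rows are equal or disjoint -/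

section BlockRel

variable {α : Type*} {R R' : α → α → Prop} {P Q P' Q' : Set α} {p p' q q' : α}

/-- Any two rows of the restriction of `R` to `P × Q` are equal or disjoint. -/
def BlockRel (R : α → α → Prop) (P Q : Set α) : Prop :=
  ∀ p ∈ P, ∀ p' ∈ P, ∀ q ∈ Q, ∀ q' ∈ Q, R p q → R p q' → R p' q → R p' q'

lemma BlockRel.mono (h : BlockRel R P' Q') (hP : P ⊆ P') (hQ : Q ⊆ Q') : BlockRel R P Q :=
  fun p hp p' hp' q hq q' hq' => h p (hP hp) p' (hP hp') q (hQ hq) q' (hQ hq')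

lemma BlockRel.swap (h : BlockRel R P Q) : BlockRel (fun q p => R p q) Q P :=
  fun q hq q' hq' p hp p' hp' h1 h2 h3 => h p hp p' hp' q hq q' hq' h1 h3 h2

/-- The restriction of `R` to `P × Q` has a `2 × 2` submatrix with exactly one related pair. -/
def HasSingleton (R : α → α → Prop) (P Q : Set α) : Prop :=
  ∃ p ∈ P, ∃ p' ∈ P, ∃ q ∈ Q, ∃ q' ∈ Q, R p q ∧ ¬ R p' q ∧ ¬ R p q' ∧ ¬ R p' q'

/-- Without a singleton, everything outside the rows and columns of a block is a second full block.
So p' and q' are related exactly if both belong to the block of (p, q) or both do not. -/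
lemma BlockRel.iff_of_not_hasSingleton (h : BlockRel R P Q) (h' : ¬ HasSingleton R P Q)
    (hp : p ∈ P) (hp' : p' ∈ P) (hq : q ∈ Q) (hq' : q' ∈ Q) (hR : R p q) :
    R p' q' ↔ (R p' q ↔ R p q') := by
  have h1 := h p hp p' hp' q hq q' hq' hR
  have h2 := h p' hp' p hp q hq q' hq'
  have h3 := h p hp p' hp' q' hq' q hq
  have h4 : ¬ (R p q ∧ ¬ R p' q ∧ ¬ R p q' ∧ ¬ R p' q') := fun hh =>
    h' ⟨p, hp, p', hp', q, hq, q', hq', hh⟩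
  tauto

/-- If two block relations cover `P × Q`, but neither of them contains a full row or column, then
they are complementary. -/
lemma BlockRel.compl_of_cover (h : BlockRel R P Q) (h' : BlockRel R' P Q)
    (hcov : ∀ p ∈ P, ∀ q ∈ Q, R p q ∨ R' p q) (hrow : ∀ p ∈ P, ∃ q ∈ Q, ¬ R' p q)
    (hcol : ∀ q ∈ Q, ∃ p ∈ P, ¬ R p q) (hp : p ∈ P) (hq : q ∈ Q) : R' p q ↔ ¬ R p q := by
  refine ⟨fun hR' hR => ?_, (hcov p hp q hq).resolve_left⟩
  obtain ⟨p', hp', hp'q⟩ := hcol q hq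
  obtain ⟨q', hq', hpq'⟩ := hrow p hp
  have h1 := (hcov p' hp' q hq).resolve_left hp'q
  have h2 : ¬ R' p' q' := fun h2 => hpq' (h' p' hp' p hp q hq q' hq' h1 h2 hR')
  have h3 := (hcov p hp q' hq').resolve_right hpq'
  have h4 := (hcov p' hp' q' hq').resolve_right h2
  exact hp'q (h p hp p' hp' q' hq' q hq h3 hR h4)

/-- A singleton of R is a 2 × 2 submatrix in which the complement has exactly three entries, but a
block relation with three of them contains the fourth. -/
lemma BlockRel.not_hasSingleton (h' : BlockRel R' P Q)
    (hc : ∀ p ∈ P, ∀ q ∈ Q, (R' p q ↔ ¬ R p q)) : ¬ HasSingleton R P Q := by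
  rintro ⟨p, hp, p', hp', q, hq, q', hq', h1, h2, h3, h4⟩
  rw [← hc _ ‹_› _ ‹_›] at h2 h3 h4
  exact (hc p hp q hq).1 (h' p' hp' p hp q' hq' q hq h4 h2 h3) h1

/-- Suppose that the rows of `P' ⊇ P` and the columns of `Q' ⊇ Q` all meet the relation within
`P' × Q` and `P × Q'`, respectively. If the restriction to `P × Q` consists of two complementary
blocks, then so does the restriction to `P' × Q'`. -/
lemma BlockRel.iff_of_extension (h : BlockRel R P' Q') (hP : P ⊆ P') (hQ : Q ⊆ Q')
    (h' : ¬ HasSingleton R P Q) {p₁ q₁ : α} (hp₁ : p₁ ∈ P) (hq₁ : q₁ ∈ Q) (hR : R p₁ q₁)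
    (hrow : ∀ p ∈ P', ∃ q ∈ Q, R p q) (hcol : ∀ q ∈ Q', ∃ p ∈ P, R p q) (hp : p ∈ P') (hq : q ∈ Q') :
    R p q ↔ (R p q₁ ↔ R p₁ q) := by
  have hf := fun {p q} (hp : p ∈ P) (hq : q ∈ Q) =>
    (h.mono hP hQ).iff_of_not_hasSingleton h' hp₁ hp hq₁ hq hR
  have h1 := h p₁ (hP hp₁) p hp q₁ (hQ hq₁) q hq hR
  have h2 := h p hp p₁ (hP hp₁) q₁ (hQ hq₁) q hq
  have h3 := h p₁ (hP hp₁) p hp q hq q₁ (hQ hq₁)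
  -- Only the second block is in question. The row of p and the column of q meet the relation at q₀
  -- ∈ Q and p₀ ∈ P, which avoid the first block, so p₀ and q₀ are related and the block property
  -- joins p to q.
  suffices ¬ R p q₁ → ¬ R p₁ q → R p q by tauto
  intro h4 h5
  obtain ⟨q₀, hq₀, hpq₀⟩ := hrow p hp
  obtain ⟨p₀, hp₀, hp₀q⟩ := hcol q hq
  have h6 : ¬ R p₁ q₀ := fun h6 =>
    h4 (h p₁ (hP hp₁) p hp q₀ (hQ hq₀) q₁ (hQ hq₁) h6 hR hpq₀)
  have h7 : ¬ R p₀ q₁ := fun h7 => h5 (h p₀ (hP hp₀) p₁ (hP hp₁) q₁ (hQ hq₁) q hq h7 hp₀q hR)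
  exact h p₀ (hP hp₀) p hp q₀ (hQ hq₀) q hq ((hf hp₀ hq₀).2 (iff_of_false h7 h6)) hp₀q hpq₀

end BlockRel

namespace Matroid

/-! ## Exchanges between compatible basis pairs -/

section Pairs

variable {α : Type*} {M : Matroid α} {X Y Z B B₁ B₂ : Set α} {e f p q b c x : α}

/-- The set `B - e + f` is not a base. -/
def Blocked (M : Matroid α) (B : Set α) (e f : α) : Prop := ¬ M.IsBase (insert f (B \ {e}))

lemma isBase_of_not_blocked (h : ¬ M.Blocked B e f) : M.IsBase (insert f (B \ {e})) := not_not.1 h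

/-- The pair `(X - e + f, Y + e - f)` is obtained from `(X, Y)` by a symmetric exchange. -/
structure Feasible (M : Matroid α) (X Y : Set α) (e f : α) : Prop where
  left : e ∈ X \ Y
  right : f ∈ Y \ X
  isBase₁ : M.IsBase (insert f (X \ {e}))
  isBase₂ : M.IsBase (insert e (Y \ {f}))

/-- From the state `(X, ·)` with target `(B₁, B₂)`, the infeasible exchanges at `B₁` and at `B₂`
between `X \ B₁` and `B₁ \ X` form an obstruction to reaching the target monotonically. -/
def Dead (M : Matroid α) (X B₁ B₂ : Set α) : Prop :=
  ¬ HasSingleton (M.Blocked B₁) (B₁ \ X) (X \ B₁) ∧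
  ¬ HasSingleton (M.Blocked B₂) (X \ B₁) (B₁ \ X) ∧
  (∃ p ∈ X \ B₁, ∃ q ∈ B₁ \ X, M.Blocked B₁ q p ∧ ¬ M.Blocked B₂ p q) ∧
  (∃ p ∈ X \ B₁, ∃ q ∈ B₁ \ X, ¬ M.Blocked B₁ q p ∧ M.Blocked B₂ p q)

lemma Feasible.swap (h : M.Feasible X Y e f) : M.Feasible Y X f e :=
  ⟨h.right, h.left, h.isBase₂, h.isBase₁⟩

namespace CompatibleBasisPairs

lemma swap (h : M.CompatibleBasisPairs (X, Y) (B₁, B₂)) :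
    M.CompatibleBasisPairs (Y, X) (B₂, B₁) where
  isBase_left₁ := h.isBase_left₂
  isBase_left₂ := h.isBase_left₁
  isBase_right₁ := h.isBase_right₂
  isBase_right₂ := h.isBase_right₁
  inter_eq := by simpa [Set.inter_comm] using h.inter_eq
  union_eq := by simpa [Set.union_comm] using h.union_eq

lemma symm (h : M.CompatibleBasisPairs (X, Y) (B₁, B₂)) :
    M.CompatibleBasisPairs (B₁, B₂) (X, Y) where
  isBase_left₁ := h.isBase_right₁
  isBase_left₂ := h.isBase_right₂
  isBase_right₁ := h.isBase_left₁
  isBase_right₂ := h.isBase_left₂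
  inter_eq := h.inter_eq.symm
  union_eq := h.union_eq.symm

lemma mem_iff (h : M.CompatibleBasisPairs (X, Y) (B₁, B₂)) (v : α) :
    (v ∈ X ∧ v ∈ Y ↔ v ∈ B₁ ∧ v ∈ B₂) ∧ (v ∈ X ∨ v ∈ Y ↔ v ∈ B₁ ∨ v ∈ B₂) :=
  ⟨Set.ext_iff.1 h.inter_eq v, Set.ext_iff.1 h.union_eq v⟩

lemma sdiff_eq (h : M.CompatibleBasisPairs (X, Y) (B₁, B₂)) : X \ B₁ = B₂ \ Y := by
  ext v
  have := h.mem_iff v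
  simp only [Set.mem_sdiff]
  tauto

lemma exchange (h : M.CompatibleBasisPairs (X, Y) (B₁, B₂)) (hf : M.Feasible X Y e f) :
    M.CompatibleBasisPairs (insert f (X \ {e}), insert e (Y \ {f})) (B₁, B₂) where
  isBase_left₁ := hf.isBase₁
  isBase_left₂ := hf.isBase₂
  isBase_right₁ := h.isBase_right₁
  isBase_right₂ := h.isBase_right₂
  inter_eq := by
    rw [← h.inter_eq]
    have h1 := hf.left
    have h2 := hf.right
    ext v
    simp only [Set.mem_inter_iff, Set.mem_insert_iff, Set.mem_sdiff, Set.mem_singleton_iff] at *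
    grind
  union_eq := by
    rw [← h.union_eq]
    have h1 := hf.left
    have h2 := hf.right
    ext v
    simp only [Set.mem_union, Set.mem_insert_iff, Set.mem_sdiff, Set.mem_singleton_iff] at *
    grind

/-- By this symmetry a singleton at B₂ is reduced to one at B₁. -/
lemma dead_swap (h : M.CompatibleBasisPairs (X, Y) (B₁, B₂)) :
    M.Dead Y B₂ B₁ ↔ M.Dead X B₁ B₂ := by
  simp only [Dead, ← h.sdiff_eq, h.symm.sdiff_eq]
  grind

end CompatibleBasisPairs

lemma IsSplit.blockRel [M.Finite] (hM : M.IsSplit) (hB : M.IsBase B) (v : α) :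
    BlockRel (M.Blocked B) {e | e ∈ B ∧ M.SameClass e v} {f | f ∈ M.E \ B ∧ M.SameClass f v} :=
  fun _ he _ he' _ hf _ hf' h1 h2 h3 =>
    hM.not_isBase_exchange hB he.1 he'.1 hf.1 hf'.1 (he.2.trans he'.2.symm) (he.2.trans hf.2.symm)
      (hf.2.trans hf'.2.symm) h1 h2 h3

lemma IsBase.sameClass_of_not_blocked (hB : M.IsBase B) (he : e ∈ B) (hf : f ∉ B)
    (h : ¬ M.Blocked B e f) : M.SameClass e f :=
  hB.sameClass_of_isBase_exchange he hf (isBase_of_not_blocked h)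

/-- Symmetric exchange leaves a free entry in every row of the blocked relation between two bases;
the primed version does so for columns. -/
lemma IsBase.exists_not_blocked (hB : M.IsBase B) (hX : M.IsBase X) (he : e ∈ B \ X) :
    ∃ f ∈ X \ B, ¬ M.Blocked B e f := by
  obtain ⟨f, hf, _, h⟩ := hX.exists_symmetric_exchange hB he
  exact ⟨f, hf, not_not.2 h⟩

lemma IsBase.exists_not_blocked' (hB : M.IsBase B) (hX : M.IsBase X) (hf : f ∈ X \ B) :
    ∃ e ∈ B \ X, ¬ M.Blocked B e f := by
  obtain ⟨e, he, h, _⟩ := hB.exists_symmetric_exchange hX hf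
  exact ⟨e, he, not_not.2 h⟩

/-- If the infeasible exchanges at `X` towards `B` form two complementary blocks, then they are
infeasible at `B` as well. -/
lemma IsBase.blocked_of_blocked [M.Finite] (hX : M.IsBase X) (hB : M.IsBase B)
    (h : BlockRel (M.Blocked X) (X \ B) (B \ X)) (h' : ¬ HasSingleton (M.Blocked X) (X \ B) (B \ X))
    (hp : p ∈ X \ B) (hq : q ∈ B \ X) (hb : M.Blocked X p q) : M.Blocked B q p := by
  have hiff := fun {p' q'} (hp' : p' ∈ X \ B) (hq' : q' ∈ B \ X) =>
    h.iff_of_not_hasSingleton h' hp hp' hq hq' hb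
  -- The blocks are numbered so that (p, q) lies in the second one, the one to which the conclusion
  -- applies.
  refine hX.not_isBase_of_two_blocks hB
    (P₁ := {p' ∈ X \ B | ¬ M.Blocked X p' q}) (P₂ := {p' ∈ X \ B | M.Blocked X p' q})
    (Q₁ := {q' ∈ B \ X | ¬ M.Blocked X p q'}) (Q₂ := {q' ∈ B \ X | M.Blocked X p q'})
    ?_ ?_ ?_ ?_ ?_ ?_ q ⟨hq, hb⟩ p ⟨hp, hb⟩
  · ext v; simp only [Set.mem_union, Set.mem_ofPred_eq]; tauto
  · exact Set.disjoint_left.2 fun v h1 h2 => h1.2 h2.2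
  · ext v; simp only [Set.mem_union, Set.mem_ofPred_eq]; tauto
  · exact Set.disjoint_left.2 fun v h1 h2 => h1.2 h2.2
  · exact fun p' hp' q' hq' => (hiff hp'.1 hq'.1).2 (iff_of_false hp'.2 hq'.2)
  · exact fun a ha b hb => (hiff ha.1 hb.1).2 (iff_of_true ha.2 hb.2)

/-- If no exchange brings `(X, Y)` closer to the target, then the state is dead. -/
lemma IsSplit.dead_of_stuck [M.Finite] (hM : M.IsSplit)
    (h : M.CompatibleBasisPairs (X, Y) (B₁, B₂)) (hne : (X \ B₁).Nonempty)
    (hst : ∀ p ∈ X \ B₁, ∀ q ∈ B₁ \ X, M.Blocked X p q ∨ M.Blocked Y q p) : M.Dead X B₁ B₂ := by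
  have hX : M.IsBase X := h.isBase_left₁
  have hY : M.IsBase Y := h.isBase_left₂
  have hB₁ : M.IsBase B₁ := h.isBase_right₁
  have hB₂ : M.IsBase B₂ := h.isBase_right₂
  have e1 : X \ B₁ = B₂ \ Y := h.sdiff_eq
  have e2 : B₁ \ X = Y \ B₂ := h.symm.sdiff_eq
  obtain ⟨p₀, hp₀⟩ := hne
  -- A free partner q of p at X lies in the component of p, and stuckness makes the reverse exchange
  -- blocked at Y. As only one component has blocked exchanges, all differences lie in a single
  -- component, where the block structure is available.
  have hbad : ∀ p ∈ X \ B₁, ∃ q ∈ B₁ \ X, M.SameClass p q ∧ M.Blocked Y q p := by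
    intro p hp
    obtain ⟨q, hq, hb⟩ := hX.exists_not_blocked hB₁ hp
    exact ⟨q, hq, hX.sameClass_of_not_blocked hp.1 hq.2 hb, (hst p hp q hq).resolve_left hb⟩
  have hclP : ∀ p ∈ X \ B₁, M.SameClass p p₀ := by
    intro p hp
    obtain ⟨q, hq, hpq, hb⟩ := hbad p hp
    obtain ⟨q₀, hq₀, hpq₀, hb₀⟩ := hbad p₀ hp₀
    have := hM.sameClass_of_not_isBase hY hY (e2 ▸ hq).1
      ⟨hX.subset_ground hp.1, (e1 ▸ hp).2⟩ (e2 ▸ hq₀).1 ⟨hX.subset_ground hp₀.1, (e1 ▸ hp₀).2⟩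
      hpq.symm hpq₀.symm hb hb₀
    exact (hpq.trans this).trans hpq₀.symm
  have hclQ : ∀ q ∈ B₁ \ X, M.SameClass q p₀ := by
    intro q hq
    obtain ⟨p, hp, hb⟩ := hX.exists_not_blocked' hB₁ hq
    exact (hX.sameClass_of_not_blocked hp.1 hq.2 hb).symm.trans (hclP p hp)
  have hEX : ∀ p ∈ X \ B₁, p ∈ M.E := fun p hp => hX.subset_ground hp.1
  have hEB : ∀ q ∈ B₁ \ X, q ∈ M.E := fun q hq => hB₁.subset_ground hq.1
  have bX : BlockRel (M.Blocked X) (X \ B₁) (B₁ \ X) := (hM.blockRel hX p₀).mono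
    (fun p hp => ⟨hp.1, hclP p hp⟩) (fun q hq => ⟨⟨hEB q hq, hq.2⟩, hclQ q hq⟩)
  have bB₁ : BlockRel (M.Blocked B₁) (B₁ \ X) (X \ B₁) := (hM.blockRel hB₁ p₀).mono
    (fun q hq => ⟨hq.1, hclQ q hq⟩) (fun p hp => ⟨⟨hEX p hp, hp.2⟩, hclP p hp⟩)
  have bY : BlockRel (M.Blocked Y) (B₁ \ X) (X \ B₁) := (hM.blockRel hY p₀).mono
    (fun q hq => ⟨(e2 ▸ hq).1, hclQ q hq⟩)
    (fun p hp => ⟨⟨hEX p hp, (e1 ▸ hp).2⟩, hclP p hp⟩)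
  have bB₂ : BlockRel (M.Blocked B₂) (X \ B₁) (B₁ \ X) := (hM.blockRel hB₂ p₀).mono
    (fun p hp => ⟨(e1 ▸ hp).1, hclP p hp⟩)
    (fun q hq => ⟨⟨hEB q hq, (e2 ▸ hq).2⟩, hclQ q hq⟩)
  -- Complementary block relations have no singletons, so each is a pair of complementary blocks and
  -- can be transported to the target by the rank count.
  have cXY := fun {p q} (hp : p ∈ X \ B₁) (hq : q ∈ B₁ \ X) =>
    bX.compl_of_cover bY.swap hst
      (fun p hp => by
        obtain ⟨q, hq, hb⟩ := hY.exists_not_blocked' hB₂ (e1 ▸ hp)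
        exact ⟨q, e2 ▸ hq, hb⟩)
      (fun q hq => hX.exists_not_blocked' hB₁ hq) hp hq
  have sX := bY.swap.not_hasSingleton fun p hp q hq => cXY hp hq
  have sY := bX.swap.not_hasSingleton (R := M.Blocked Y) fun q hq p hp => by
    have := cXY hp hq; tauto
  have k1 : ∀ p ∈ X \ B₁, ∀ q ∈ B₁ \ X, M.Blocked X p q → M.Blocked B₁ q p :=
    fun p hp q hq => hX.blocked_of_blocked hB₁ bX sX hp hq
  have k2 : ∀ p ∈ X \ B₁, ∀ q ∈ B₁ \ X, M.Blocked Y q p → M.Blocked B₂ p q := by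
    rw [e1, e2] at bY sY ⊢
    exact fun p hp q hq => hY.blocked_of_blocked hB₂ bY sY hq hp
  -- The transported relations still cover the rectangle and still leave free entries, so they are
  -- complementary at B₁ and B₂ too.
  have cB := fun {p q} (hp : p ∈ X \ B₁) (hq : q ∈ B₁ \ X) =>
    bB₁.swap.compl_of_cover bB₂
      (fun p hp q hq => (hst p hp q hq).imp (k1 p hp q hq) (k2 p hp q hq))
      (fun p hp => by
        obtain ⟨q, hq, hb⟩ := hB₂.exists_not_blocked hY (e1 ▸ hp)
        exact ⟨q, e2 ▸ hq, hb⟩)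
      (fun q hq => hB₁.exists_not_blocked hX hq) hp hq
  refine ⟨bB₂.swap.not_hasSingleton fun q hq p hp => cB hp hq,
    bB₁.swap.not_hasSingleton fun p hp q hq => ?_, ?_, ?_⟩
  · have := cB hp hq; tauto
  · obtain ⟨q, hq, hb⟩ := hB₂.exists_not_blocked hY (e1 ▸ hp₀)
    rw [← e2] at hq
    have := cB hp₀ hq
    exact ⟨p₀, hp₀, q, hq, by tauto, hb⟩
  · obtain ⟨q, hq, hb⟩ := hB₁.exists_not_blocked' hX hp₀
    exact ⟨p₀, hp₀, q, hq, hb, (cB hp₀ hq).2 hb⟩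

end Pairs
end Matroid

lemma HasSingleton.mono {α : Type*} {R : α → α → Prop} {P Q P' Q' : Set α}
    (h : HasSingleton R P Q) (hP : P ⊆ P') (hQ : Q ⊆ Q') : HasSingleton R P' Q' := by
  obtain ⟨p, hp, p', hp', q, hq, q', hq', hR⟩ := h
  exact ⟨p, hP hp, p', hP hp', q, hQ hq, q', hQ hq', hR⟩

namespace Matroid

/-! ### Destroying the obstruction by an exchange of the target -/

section Repair

variable {α : Type*} {M : Matroid α} {X Y Z W B B₁ B₂ : Set α} {e f a p q b c x v : α}

/-- The element `v` lies in the only component with infeasible exchanges. -/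
def IsAnchor (M : Matroid α) (v : α) : Prop :=
  ∀ ⦃B e f⦄, M.IsBase B → e ∈ B → f ∈ M.E \ B → M.SameClass e f → M.Blocked B e f →
    M.SameClass e v

lemma IsSplit.isAnchor [M.Finite] (hM : M.IsSplit) (hB : M.IsBase B) (he : e ∈ B)
    (hf : f ∈ M.E \ B) (hef : M.SameClass e f) (h : M.Blocked B e f) : M.IsAnchor e :=
  fun _ _ _ hB' he' hf' hef' h' => hM.sameClass_of_not_isBase hB' hB he' hf' he hf hef' hef h' h

/-- A row b without blocked entries, together with the row of a blocked entry (q, p) and a free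
entry (q, p') of that row, forms a singleton at B₁. -/
lemma IsAnchor.not_dead_of_left (hv : M.IsAnchor v) (h : M.CompatibleBasisPairs (X, Y) (B₁, B₂))
    (hb : b ∈ B₁ \ X) (hgood : ∀ p ∈ X \ B₁, M.SameClass p v → ¬ M.Blocked B₁ b p) :
    ¬ M.Dead X B₁ B₂ := by
  rintro ⟨hs, -, ⟨p, hp, q, hq, h1, h2⟩, -⟩
  have hX : M.IsBase X := h.isBase_left₁
  have hB₁ : M.IsBase B₁ := h.isBase_right₁
  have hpB := hp
  have hqY := hq
  rw [h.sdiff_eq] at hpB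
  rw [h.symm.sdiff_eq] at hqY
  have hpq := h.isBase_right₂.sameClass_of_not_blocked hpB.1 hqY.2 h2
  have hqv := hv hB₁ hq.1 ⟨hX.subset_ground hp.1, hp.2⟩ hpq.symm h1
  obtain ⟨p', hp', h3⟩ := hB₁.exists_not_blocked hX hq
  exact hs ⟨q, hq, b, hb, p, hp, p', hp', h1, hgood p hp (hpq.trans hqv), h3,
    hgood p' hp' ((hB₁.sameClass_of_not_blocked hq.1 hp'.2 h3).symm.trans hqv)⟩

/-- A free column a produces a singleton in the same way, next to the column of a blocked entry and
a free entry of it. -/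
lemma IsAnchor.not_dead_of_right (hv : M.IsAnchor v) (h : M.CompatibleBasisPairs (X, Y) (B₁, B₂))
    (ha : a ∈ X \ B₁) (hgood : ∀ q ∈ B₁ \ X, M.SameClass q v → ¬ M.Blocked B₁ q a) :
    ¬ M.Dead X B₁ B₂ := by
  rintro ⟨hs, -, ⟨p, hp, q, hq, h1, h2⟩, -⟩
  have hX : M.IsBase X := h.isBase_left₁
  have hB₁ : M.IsBase B₁ := h.isBase_right₁
  have hpB := hp
  have hqY := hq
  rw [h.sdiff_eq] at hpB
  rw [h.symm.sdiff_eq] at hqY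
  have hpq := h.isBase_right₂.sameClass_of_not_blocked hpB.1 hqY.2 h2
  have hqv := hv hB₁ hq.1 ⟨hX.subset_ground hp.1, hp.2⟩ hpq.symm h1
  obtain ⟨q', hq', h3⟩ := hB₁.exists_not_blocked' hX hp
  exact hs ⟨q, hq, q', hq', p, hp, a, ha, h1, h3, hgood q hq hqv,
    hgood q' hq' ((hB₁.sameClass_of_not_blocked hq'.1 hp.2 h3).trans (hpq.trans hqv))⟩

/-- Between {q, b} and {c, p} exactly one exchange is blocked, so there is a unique perfect matching
of feasible exchanges and `isBase_double_exchange` applies. Either matching yields the same set. -/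
lemma IsBase.not_blocked_exchange_left (hB : M.IsBase B) (hq : q ∈ B) (hb : b ∈ B)
    (hc : c ∈ M.E \ B) (hp : p ∈ M.E \ B) (hqc : ¬ M.Blocked B q c) (hbc : ¬ M.Blocked B b c)
    (hx : ¬ (M.Blocked B q p ↔ M.Blocked B b p)) : ¬ M.Blocked (insert c (B \ {q})) b p := by
  refine not_not.2 ?_
  by_cases h : M.Blocked B q p
  · exact hB.isBase_double_exchange hq hb hc hp (isBase_of_not_blocked hqc)
      (isBase_of_not_blocked (by tauto)) h
  · have h1 : M.IsBase (insert p (insert c (B \ {b}) \ {q})) := hB.isBase_double_exchange hb hq hc hp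
      (isBase_of_not_blocked hbc) (isBase_of_not_blocked h) (by change M.Blocked B b p; tauto)
    have h2 : c ≠ q := by rintro rfl; exact hc.2 hq
    have h3 : c ≠ b := by rintro rfl; exact hc.2 hb
    convert h1 using 2
    ext v
    simp only [Set.mem_sdiff, Set.mem_insert_iff, Set.mem_singleton_iff]
    grind

/-- Here too a single blocked exchange between {x, q} and {p, a} leaves a unique perfect matching.
-/
lemma IsBase.not_blocked_exchange_right (hB : M.IsBase B) (hx : x ∈ B) (hq : q ∈ B)
    (hp : p ∈ M.E \ B) (ha : a ∈ M.E \ B) (hxp : ¬ M.Blocked B x p) (hxa : ¬ M.Blocked B x a)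
    (h : ¬ (M.Blocked B q p ↔ M.Blocked B q a)) : ¬ M.Blocked (insert p (B \ {x})) q a := by
  refine not_not.2 ?_
  have h2 : p ≠ q := by rintro rfl; exact hp.2 hq
  have h3 : p ≠ x := by rintro rfl; exact hp.2 hx
  have h4 : a ≠ q := by rintro rfl; exact ha.2 hq
  have h5 : a ≠ x := by rintro rfl; exact ha.2 hx
  by_cases hqp : M.Blocked B q p
  · have h1 : M.IsBase (insert p (insert a (B \ {q}) \ {x})) := hB.isBase_double_exchange hq hx ha hp
      (isBase_of_not_blocked (by tauto)) (isBase_of_not_blocked hxp) hqp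
    convert h1 using 1
    ext v
    simp only [Set.mem_sdiff, Set.mem_insert_iff, Set.mem_singleton_iff]
    grind
  · have h1 : M.IsBase (insert a (insert p (B \ {q}) \ {x})) := hB.isBase_double_exchange hq hx hp ha
      (isBase_of_not_blocked hqp) (isBase_of_not_blocked hxa) (by change M.Blocked B q a; tauto)
    convert h1 using 1
    ext v
    simp only [Set.mem_sdiff, Set.mem_insert_iff, Set.mem_singleton_iff]
    grind

/-- In a dead state, either the infeasible exchanges at `B₁` between `Q'` and `P'` form two
complementary blocks as well, or some exchange of the target destroys the obstruction. -/
lemma IsSplit.exists_repair [M.Finite] (hM : M.IsSplit)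
    (h : M.CompatibleBasisPairs (Z, W) (B₁, B₂)) (hd : M.Dead Z B₁ B₂) {P' Q' : Set α}
    (hP' : P' ⊆ B₂ \ B₁) (hQ' : Q' ⊆ B₁ \ B₂) (hZP : Z \ B₁ ⊆ P') (hZQ : B₁ \ Z ⊆ Q') :
    ∃ v, M.IsAnchor v ∧
      ((∃ p₁ ∈ Z \ B₁, ∃ q₁ ∈ B₁ \ Z, M.SameClass p₁ v ∧ M.SameClass q₁ v ∧ M.Blocked B₁ q₁ p₁ ∧
          ¬ M.Blocked B₂ p₁ q₁ ∧ ∀ p ∈ P', ∀ q ∈ Q', M.SameClass p v → M.SameClass q v →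
            (M.Blocked B₁ q p ↔ (M.Blocked B₁ q p₁ ↔ M.Blocked B₁ q₁ p))) ∨
        (∃ c ∈ P' \ Z, ∃ q ∈ B₁ \ Z, M.Feasible B₁ B₂ q c ∧ ∃ b ∈ B₁ \ Z, b ≠ q ∧
          ∀ p ∈ Z \ B₁, M.SameClass p v → ¬ M.Blocked (insert c (B₁ \ {q})) b p) ∨
        (∃ x ∈ Q' ∩ Z, ∃ p ∈ Z \ B₁, M.Feasible B₁ B₂ x p ∧ ∃ a ∈ Z \ B₁, a ≠ p ∧
          ∀ q ∈ B₁ \ Z, M.SameClass q v → ¬ M.Blocked (insert p (B₁ \ {x})) q a)) := by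
  obtain ⟨hs, -, ⟨p₁, hp₁, q₁, hq₁, hb₁, hg₁⟩, ⟨p₂, hp₂, q₂, hq₂, hg₂, hb₂⟩⟩ := hd
  have hZ : M.IsBase Z := h.isBase_left₁
  have hW : M.IsBase W := h.isBase_left₂
  have hB₁ : M.IsBase B₁ := h.isBase_right₁
  have hB₂ : M.IsBase B₂ := h.isBase_right₂
  have e1 : Z \ B₁ = B₂ \ W := h.sdiff_eq
  have e2 : B₁ \ Z = W \ B₂ := h.symm.sdiff_eq
  have hQ'B : ∀ {x}, x ∈ Q' → x ∈ B₁ ∧ x ∈ M.E \ B₂ := fun hx =>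
    ⟨(hQ' hx).1, hB₁.subset_ground (hQ' hx).1, (hQ' hx).2⟩
  have hP'B : ∀ {x}, x ∈ P' → x ∈ B₂ ∧ x ∈ M.E \ B₁ := fun hx =>
    ⟨(hP' hx).1, hB₂.subset_ground (hP' hx).1, (hP' hx).2⟩
  have hpq₁ : M.SameClass p₁ q₁ := hB₂.sameClass_of_not_blocked (hP'B (hZP hp₁)).1
    (hQ'B (hZQ hq₁)).2.2 hg₁
  have hv : M.IsAnchor q₁ := hM.isAnchor hB₁ hq₁.1 (hP'B (hZP hp₁)).2 hpq₁.symm hb₁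
  have hpq₂ : M.SameClass q₂ p₂ := hB₁.sameClass_of_not_blocked hq₂.1 hp₂.2 hg₂
  have hp₂v : M.SameClass p₂ q₁ := hv hB₂ (hP'B (hZP hp₂)).1 (hQ'B (hZQ hq₂)).2 hpq₂.symm hb₂
  have hq₂v := hpq₂.trans hp₂v
  refine ⟨q₁, hv, ?_⟩
  set P₀ := {p | p ∈ Z \ B₁ ∧ M.SameClass p q₁} with hP₀
  set Q₀ := {q | q ∈ B₁ \ Z ∧ M.SameClass q q₁} with hQ₀
  have hp₁0 : p₁ ∈ P₀ := ⟨hp₁, hpq₁⟩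
  have hq₁0 : q₁ ∈ Q₀ := ⟨hq₁, sameClass_refl q₁⟩
  have bB₁ : BlockRel (M.Blocked B₁) {q | q ∈ Q' ∧ M.SameClass q q₁}
      {p | p ∈ P' ∧ M.SameClass p q₁} := (hM.blockRel hB₁ q₁).mono
    (fun q hq => ⟨(hQ'B hq.1).1, hq.2⟩) (fun p hp => ⟨(hP'B hp.1).2, hp.2⟩)
  have bB₂ : BlockRel (M.Blocked B₂) {p | p ∈ P' ∧ M.SameClass p q₁}
      {q | q ∈ Q' ∧ M.SameClass q q₁} := (hM.blockRel hB₂ q₁).mono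
    (fun p hp => ⟨(hP'B hp.1).1, hp.2⟩) (fun q hq => ⟨(hQ'B hq.1).2, hq.2⟩)
  have hQQ : Q₀ ⊆ {q | q ∈ Q' ∧ M.SameClass q q₁} := fun q hq => ⟨hZQ hq.1, hq.2⟩
  have hPP : P₀ ⊆ {p | p ∈ P' ∧ M.SameClass p q₁} := fun p hp => ⟨hZP hp.1, hp.2⟩
  have hs0 : ¬ HasSingleton (M.Blocked B₁) Q₀ P₀ := fun hs' =>
    hs (hs'.mono (fun q hq => hq.1) (fun p hp => hp.1))
  have hiff := fun {p q} (hp : p ∈ P₀) (hq : q ∈ Q₀) =>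
    (bB₁.mono hQQ hPP).iff_of_not_hasSingleton hs0 hq₁0 hq hp₁0 hp hb₁
  -- Here q₃ and p₃ lie on the sides opposite to q₁ and p₁, so both blocks of the pattern on Q₀ × P₀
  -- are nonempty and each of its rows and columns meets a block.
  obtain ⟨q₃, hq₃, hg₃⟩ := hB₁.exists_not_blocked' hZ hp₁
  have hq₃0 : q₃ ∈ Q₀ := ⟨hq₃, (hB₁.sameClass_of_not_blocked hq₃.1 hp₁.2 hg₃).trans hpq₁⟩
  obtain ⟨p₃, hp₃, hg₃'⟩ := hB₁.exists_not_blocked hZ hq₁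
  have hp₃0 : p₃ ∈ P₀ := ⟨hp₃, (hB₁.sameClass_of_not_blocked hq₁.1 hp₃.2 hg₃').symm⟩
  -- If all new rows and columns meet the pattern on Q₀ × P₀, it extends. Otherwise a row x or a
  -- column c is free on it and serves for an exchange of the target.
  by_cases hcol : ∀ p, p ∈ P' ∧ M.SameClass p q₁ → ∃ q ∈ Q₀, M.Blocked B₁ q p
  · by_cases hrow : ∀ q, q ∈ Q' ∧ M.SameClass q q₁ → ∃ p ∈ P₀, M.Blocked B₁ q p
    · refine Or.inl ⟨p₁, hp₁, q₁, hq₁, hpq₁, sameClass_refl q₁, hb₁, hg₁, ?_⟩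
      intro p hp q hq hpv hqv
      exact bB₁.iff_of_extension hQQ hPP hs0 hq₁0 hp₁0 hb₁ hrow hcol ⟨hq, hqv⟩ ⟨hp, hpv⟩
    · push Not at hrow
      obtain ⟨x, hx, hfree⟩ := hrow
      have hxZ : x ∈ Z := by
        by_contra hxZ
        have hx0 : x ∈ Q₀ := ⟨⟨(hQ'B hx.1).1, hxZ⟩, hx.2⟩
        exact hfree p₃ hp₃0 ((hiff hp₃0 hx0).2 (iff_of_false (hfree p₁ hp₁0) hg₃'))
      -- The exchange must be feasible at B₂ as well. If x were blocked there against all of P₀, the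
      -- block property and the blocked pair (p₂, q₂) would make q₂ blocked against all of P₀,
      -- although it has a free partner.
      obtain ⟨p, hp, hg⟩ : ∃ p ∈ P₀, ¬ M.Blocked B₂ p x := by
        by_contra! hall
        obtain ⟨p', hp', hg'⟩ := hB₂.exists_not_blocked' hW (e2 ▸ hq₂)
        rw [← e1] at hp'
        have hp'v : M.SameClass p' q₁ := (hB₂.sameClass_of_not_blocked (hP'B (hZP hp')).1
          (hQ'B (hZQ hq₂)).2.2 hg').trans hq₂v
        exact hg' (bB₂ p₂ ⟨hZP hp₂, hp₂v⟩ p' ⟨hZP hp', hp'v⟩ x hx q₂ ⟨hZQ hq₂, hq₂v⟩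
          (hall p₂ ⟨hp₂, hp₂v⟩) hb₂ (hall p' ⟨hp', hp'v⟩))
      refine Or.inr (Or.inr ⟨x, ⟨hx.1, hxZ⟩, p, hp.1,
        ⟨hQ' hx.1, hP' (hZP hp.1), isBase_of_not_blocked (hfree p hp), isBase_of_not_blocked hg⟩, ?_⟩)
      -- Take a on the side opposite to p: every q in the component is blocked with exactly one of
      -- them, so after exchanging x for p the column a is free.
      obtain ⟨a, ha, hap⟩ : ∃ a ∈ P₀, ¬ (M.Blocked B₁ q₁ p ↔ M.Blocked B₁ q₁ a) := by
        by_cases hq₁p : M.Blocked B₁ q₁ p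
        · exact ⟨p₃, hp₃0, by tauto⟩
        · exact ⟨p₁, hp₁0, by tauto⟩
      refine ⟨a, ha.1, by rintro rfl; exact hap Iff.rfl, fun q hq hqv => ?_⟩
      refine hB₁.not_blocked_exchange_right (hQ'B hx.1).1 hq.1 (hP'B (hZP hp.1)).2
        (hP'B (hZP ha.1)).2 (hfree p hp) (hfree a ha) ?_
      have i1 := hiff hp ⟨hq, hqv⟩
      have i2 := hiff ha ⟨hq, hqv⟩
      tauto
  · push Not at hcol
    obtain ⟨c, hc, hfree⟩ := hcol
    have hcZ : c ∉ Z := by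
      intro hcZ
      have hc0 : c ∈ P₀ := ⟨⟨hcZ, (hP' hc.1).2⟩, hc.2⟩
      exact hfree q₃ hq₃0 ((hiff hc0 hq₃0).2 (iff_of_false hg₃ (hfree q₁ hq₁0)))
    obtain ⟨q, hq, hg⟩ : ∃ q ∈ Q₀, ¬ M.Blocked B₂ c q := by
      by_contra! hall
      obtain ⟨q', hq', hg'⟩ := hB₂.exists_not_blocked hW (e1 ▸ hp₂)
      rw [← e2] at hq'
      have hq'v : M.SameClass q' q₁ := (hB₂.sameClass_of_not_blocked (hP'B (hZP hp₂)).1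
        (hQ'B (hZQ hq')).2.2 hg').symm.trans hp₂v
      exact hg' (bB₂ c hc p₂ ⟨hZP hp₂, hp₂v⟩ q₂ ⟨hZQ hq₂, hq₂v⟩ q' ⟨hZQ hq', hq'v⟩
        (hall q₂ ⟨hq₂, hq₂v⟩) (hall q' ⟨hq', hq'v⟩) hb₂)
    refine Or.inr (Or.inl ⟨c, ⟨hc.1, hcZ⟩, q, hq.1,
      ⟨hQ' (hZQ hq.1), hP' hc.1, isBase_of_not_blocked (hfree q hq), isBase_of_not_blocked hg⟩, ?_⟩)
    obtain ⟨b, hb, hbq⟩ : ∃ b ∈ Q₀, ¬ (M.Blocked B₁ q p₁ ↔ M.Blocked B₁ b p₁) := by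
      by_cases hqp : M.Blocked B₁ q p₁
      · exact ⟨q₃, hq₃0, by tauto⟩
      · exact ⟨q₁, hq₁0, by tauto⟩
    refine ⟨b, hb.1, by rintro rfl; exact hbq Iff.rfl, fun p hp hpv => ?_⟩
    refine hB₁.not_blocked_exchange_left hq.1.1 hb.1.1 (hP'B hc.1).2 (hP'B (hZP hp)).2
      (hfree q hq) (hfree b hb) ?_
    have i1 := hiff ⟨hp, hpv⟩ hq
    have i2 := hiff ⟨hp, hpv⟩ hb
    tauto

end Repair
end Matroid

namespace Matroid

/-! ### Steps towards the target and the length of the sequence -/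

section Steps

variable {α : Type*} {M : Matroid α} {X Y B₁ B₂ : Set α} {e f : α}

lemma CompatibleBasisPairs.exchange_right (h : M.CompatibleBasisPairs (X, Y) (B₁, B₂))
    (hf : M.Feasible B₁ B₂ e f) :
    M.CompatibleBasisPairs (X, Y) (insert f (B₁ \ {e}), insert e (B₂ \ {f})) :=
  (h.symm.exchange hf).symm

/-- A dead state is left by an exchange of the target within or outside of `X`. -/
lemma IsSplit.exists_detour [M.Finite] (hM : M.IsSplit)
    (h : M.CompatibleBasisPairs (X, Y) (B₁, B₂)) (hd : M.Dead X B₁ B₂) :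
    ∃ e f, M.Feasible B₁ B₂ e f ∧ ¬ M.Dead X (insert f (B₁ \ {e})) (insert e (B₂ \ {f})) ∧
      (e ∈ X ↔ f ∈ X) := by
  have hB₁ : M.IsBase B₁ := h.isBase_right₁
  have hB₂ : M.IsBase B₂ := h.isBase_right₂
  have e1 : X \ B₁ ⊆ B₂ \ B₁ := by
    rw [Set.subset_def]; intro v hv; exact ⟨(h.sdiff_eq ▸ hv).1, hv.2⟩
  have e2 : B₁ \ X ⊆ B₁ \ B₂ := by
    rw [Set.subset_def]; intro v hv; exact ⟨hv.1, (h.symm.sdiff_eq ▸ hv).2⟩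
  obtain ⟨v, hv, ⟨p₁, hp₁, q₁, hq₁, hp₁v, hq₁v, hb₁, hg₁, hiff⟩ | ⟨c, hc, q, hq, hf, b, hb, hbq, hgood⟩ |
    ⟨x, hx, p, hp, hf, a, ha, hap, hgood⟩⟩ :=
    hM.exists_repair h hd Set.Subset.rfl Set.Subset.rfl e1 e2
  -- The pattern would now partition all of B₁ \ B₂ and B₂ \ B₁. The rank count then makes (p₁, q₁)
  -- blocked at B₂, where it is free.
  · exfalso
    have hcl : ∀ {q p}, q ∈ B₁ \ B₂ → p ∈ B₂ \ B₁ → ¬ (M.SameClass p v ↔ M.SameClass q v) →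
        M.Blocked B₁ q p := by
      intro q p hq hp hpq
      by_contra hcon
      have := hB₁.sameClass_of_not_blocked hq.1 hp.2 hcon
      exact hpq ⟨this.trans, this.symm.trans⟩
    -- Exchanges between different components are blocked anyway. Rows and columns outside the
    -- component are put into opposite blocks, so that they never have to be blocked with each
    -- other.
    refine hB₁.not_isBase_of_two_blocks hB₂
      (P₁ := {q ∈ B₁ \ B₂ | ¬ (M.SameClass q v ∧ M.Blocked B₁ q p₁)})
      (P₂ := {q ∈ B₁ \ B₂ | M.SameClass q v ∧ M.Blocked B₁ q p₁})
      (Q₁ := {p ∈ B₂ \ B₁ | M.SameClass p v ∧ ¬ M.Blocked B₁ q₁ p})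
      (Q₂ := {p ∈ B₂ \ B₁ | ¬ (M.SameClass p v ∧ ¬ M.Blocked B₁ q₁ p)})
      ?_ ?_ ?_ ?_ ?_ ?_ p₁ ⟨e1 hp₁, by tauto⟩ q₁ ⟨e2 hq₁, by tauto⟩ (isBase_of_not_blocked hg₁)
    · ext v; simp only [Set.mem_union, Set.mem_ofPred_eq]; tauto
    · exact Set.disjoint_left.2 fun v h1 h2 => h1.2 h2.2
    · ext v; simp only [Set.mem_union, Set.mem_ofPred_eq]; tauto
    · exact Set.disjoint_left.2 fun v h1 h2 => h2.2 h1.2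
    · intro q hq p hp
      have h1 := hcl hq.1 hp.1
      have h2 := hiff p hp.1 q hq.1 hp.2.1
      have h3 := hq.2
      have h4 := hp.2
      change M.Blocked B₁ q p
      tauto
    · intro q hq p hp
      have h1 := hcl hq.1 hp.1
      have h2 := fun h => hiff p hp.1 q hq.1 h hq.2.1
      have h3 := hq.2
      have h4 := hp.2
      change M.Blocked B₁ q p
      tauto
  · refine ⟨q, c, hf, ?_, iff_of_false hq.2 hc.2⟩
    refine hv.not_dead_of_left (b := b) (h.exchange_right hf) ?_ fun p hp => hgood p ?_
    · grind
    · grind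
  · refine ⟨x, p, hf, ?_, iff_of_true hx.2 hp.1⟩
    refine hv.not_dead_of_right (a := a) (h.exchange_right hf) ?_ fun q hq => hgood q ?_
    · grind
    · grind

/-- This gives the bound r despite the extra exchange. If X and B₁ were disjoint, then X = B₂, so
the detour would exchange e ∉ X for f ∈ X, which `exists_detour` excludes. -/
lemma IsSplit.inter_nonempty_of_dead [M.Finite] (hM : M.IsSplit)
    (h : M.CompatibleBasisPairs (X, Y) (B₁, B₂)) (hd : M.Dead X B₁ B₂) : (X ∩ B₁).Nonempty := by
  by_contra hem
  rw [Set.not_nonempty_iff_eq_empty] at hem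
  obtain ⟨e, f, hf, -, hiff⟩ := hM.exists_detour h hd
  have hXB : X ⊆ B₂ := by
    intro v hv
    have h1 := h.mem_iff v
    have h2 : v ∉ B₁ := fun h2 => by
      have : v ∈ X ∩ B₁ := ⟨hv, h2⟩
      simp [hem] at this
    tauto
  have hX : M.IsBase X := h.isBase_left₁
  have heq := hX.eq_of_subset_isBase h.isBase_right₂ hXB
  have heX : e ∈ X := hiff.2 (heq ▸ hf.right.1)
  have : e ∈ X ∩ B₁ := ⟨heX, hf.left.1⟩
  simp [hem] at this

/-- The repair is computed at the dead successor X - e + f, with the differences of X as the larger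
sets. The singleton forbids extending the pattern to them, so an exchange of the target remains, and
it is made from X, where it shortens the distance. -/
lemma IsSplit.exists_repair_of_hasSingleton [M.Finite] (hM : M.IsSplit)
    (h : M.CompatibleBasisPairs (X, Y) (B₁, B₂)) (he : e ∈ X \ B₁) (hf : f ∈ B₁ \ X)
    (hef : M.Feasible X Y e f) (hd : M.Dead (insert f (X \ {e})) B₁ B₂)
    (hs : HasSingleton (M.Blocked B₁) (B₁ \ X) (X \ B₁)) :
    ∃ p ∈ X \ B₁, ∃ q ∈ B₁ \ X, M.Feasible B₁ B₂ q p ∧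
      ¬ M.Dead X (insert p (B₁ \ {q})) (insert q (B₂ \ {p})) := by
  have hX : M.IsBase X := h.isBase_left₁
  have hB₁ : M.IsBase B₁ := h.isBase_right₁
  have e1 : X \ B₁ ⊆ B₂ \ B₁ := by
    rw [Set.subset_def]; intro v hv; exact ⟨(h.sdiff_eq ▸ hv).1, hv.2⟩
  have e2 : B₁ \ X ⊆ B₁ \ B₂ := by
    rw [Set.subset_def]; intro v hv; exact ⟨hv.1, (h.symm.sdiff_eq ▸ hv).2⟩
  obtain ⟨v, hv, ⟨p₁, hp₁, q₁, hq₁, hp₁v, hq₁v, hb₁, hg₁, hiff⟩ |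
    ⟨c, hc, q, hq, hqc, b, hb, hbq, hgood⟩ | ⟨x, hx, p, hp, hxp, a, ha, hap, hgood⟩⟩ :=
    hM.exists_repair (h.exchange hef) hd e1 e2 (by grind) (by grind)
  -- The three free entries connect the four elements, so they all lie in the component of the
  -- blocked entry and are subject to the two-block pattern.
  · exfalso
    obtain ⟨q, hq, q', hq', p, hp, p', hp', h1, h2, h3, h4⟩ := hs
    have c2 := hB₁.sameClass_of_not_blocked hq'.1 hp.2 h2
    have c3 := hB₁.sameClass_of_not_blocked hq.1 hp'.2 h3
    have c4 := hB₁.sameClass_of_not_blocked hq'.1 hp'.2 h4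
    have cq := hv hB₁ hq.1 ⟨hX.subset_ground hp.1, hp.2⟩ (c3.trans (c4.symm.trans c2)) h1
    have cp' := c3.symm.trans cq
    have cq' := c4.trans cp'
    have cp := c2.symm.trans cq'
    have i1 := hiff p hp q hq cp cq
    have i2 := hiff p hp q' hq' cp cq'
    have i3 := hiff p' hp' q hq cp' cq
    have i4 := hiff p' hp' q' hq' cp' cq'
    tauto
  · refine ⟨c, hc.1, q, by grind, hqc, ?_⟩
    refine hv.not_dead_of_left (b := b) (h.exchange_right hqc) ?_ fun p hp => hgood p ?_
    · grind
    · grind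
  · refine ⟨p, by grind, x, hx.1, hxp, ?_⟩
    refine hv.not_dead_of_right (a := a) (h.exchange_right hxp) ?_ fun q hq => hgood q ?_
    · grind
    · grind

/-- From a state that is not dead, an exchange of the current pair or of the target brings them
closer and leads to a state that is not dead. -/
lemma IsSplit.exists_closer [M.Finite] (hM : M.IsSplit)
    (h : M.CompatibleBasisPairs (X, Y) (B₁, B₂)) (hd : ¬ M.Dead X B₁ B₂) (hne : (X \ B₁).Nonempty) :
    ∃ p ∈ X \ B₁, ∃ q ∈ B₁ \ X,
      (M.Feasible X Y p q ∧ ¬ M.Dead (insert q (X \ {p})) B₁ B₂) ∨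
      (M.Feasible B₁ B₂ q p ∧ ¬ M.Dead X (insert p (B₁ \ {q})) (insert q (B₂ \ {p}))) := by
  have e1 := h.sdiff_eq
  have e2 := h.symm.sdiff_eq
  obtain ⟨c, hc, f, hf, h1, h2⟩ : ∃ c ∈ X \ B₁, ∃ f ∈ B₁ \ X, ¬ M.Blocked X c f ∧ ¬ M.Blocked Y f c := by
    by_contra! hcon
    exact hd (hM.dead_of_stuck h hne fun p hp q hq => by have := hcon p hp q hq; tauto)
  have hcf : M.Feasible X Y c f := ⟨⟨hc.1, (e1 ▸ hc).2⟩, ⟨(e2 ▸ hf).1, hf.2⟩,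
    isBase_of_not_blocked h1, isBase_of_not_blocked h2⟩
  by_cases hdZ : M.Dead (insert f (X \ {c})) B₁ B₂
  swap
  · exact ⟨c, hc, f, hf, Or.inl ⟨hcf, hdZ⟩⟩
  -- The two existential clauses of `Dead` pass from the successor to the larger differences of X,
  -- so a clause about singletons must fail at X.
  obtain hs | hs : HasSingleton (M.Blocked B₁) (B₁ \ X) (X \ B₁) ∨
      HasSingleton (M.Blocked B₂) (X \ B₁) (B₁ \ X) := by
    obtain ⟨-, -, ⟨p, hp, q, hq, k1⟩, ⟨p', hp', q', hq', k2⟩⟩ := hdZ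
    by_contra! hcon
    exact hd ⟨hcon.1, hcon.2, ⟨p, by grind, q, by grind, k1⟩, ⟨p', by grind, q', by grind, k2⟩⟩
  · obtain ⟨p, hp, q, hq, k⟩ := hM.exists_repair_of_hasSingleton h hc hf hcf hdZ hs
    exact ⟨p, hp, q, hq, Or.inr k⟩
  · obtain ⟨p, hp, q, hq, k1, k2⟩ := hM.exists_repair_of_hasSingleton h.swap (e2 ▸ hf) (e1 ▸ hc)
      hcf.swap ((h.exchange hcf).dead_swap.2 hdZ) (e1 ▸ e2 ▸ hs)
    refine ⟨q, e1 ▸ hq, p, e2 ▸ hp, Or.inr ⟨k1.swap, fun hcon => k2 ?_⟩⟩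
    exact (h.exchange_right k1.swap).dead_swap.2 hcon

/-- The state `(X, Y)` with target `(B₁, B₂)` can be finished within `k` exchanges: it is at
distance `k` from the target and not dead, or at distance `k - 1` and dead. -/
def Within (M : Matroid α) (X B₁ B₂ : Set α) (k : ℕ) : Prop :=
  (¬ M.Dead X B₁ B₂ ∧ (X \ B₁).ncard = k) ∨ (M.Dead X B₁ B₂ ∧ (X \ B₁).ncard + 1 = k)

/-- The extra unit in `Within` is spent at once: a dead state is left by a detour that keeps the
distance, and no later state is dead. -/
lemma IsSplit.exists_step [M.Finite] (hM : M.IsSplit)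
    (h : M.CompatibleBasisPairs (X, Y) (B₁, B₂)) {k : ℕ} (hk : M.Within X B₁ B₂ (k + 1)) :
    (∃ e f, M.Feasible X Y e f ∧ ¬ M.Dead (insert f (X \ {e})) B₁ B₂ ∧
      (insert f (X \ {e}) \ B₁).ncard = k) ∨
    (∃ e f, M.Feasible B₁ B₂ e f ∧ ¬ M.Dead X (insert f (B₁ \ {e})) (insert e (B₂ \ {f})) ∧
      (X \ insert f (B₁ \ {e})).ncard = k) := by
  have hX : M.IsBase X := h.isBase_left₁
  have hB₁ : M.IsBase B₁ := h.isBase_right₁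
  obtain ⟨hd, hk⟩ | ⟨hd, hk⟩ := hk
  · have hne : (X \ B₁).Nonempty := by
      rw [Set.nonempty_iff_ne_empty]; intro hcon; simp [hcon] at hk
    obtain ⟨p, hp, q, hq, ⟨hf, hd'⟩ | ⟨hf, hd'⟩⟩ := hM.exists_closer h hd hne
    · refine Or.inl ⟨p, q, hf, hd', ?_⟩
      have : insert q (X \ {p}) \ B₁ = (X \ B₁) \ {p} := by grind
      rw [this, Set.ncard_sdiff_singleton_of_mem hp, hk, Nat.add_sub_cancel]
    · refine Or.inr ⟨q, p, hf, hd', ?_⟩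
      have : X \ insert p (B₁ \ {q}) = (X \ B₁) \ {p} := by grind
      rw [this, Set.ncard_sdiff_singleton_of_mem hp, hk, Nat.add_sub_cancel]
  · obtain ⟨e, f, hf, hd', hiff⟩ := hM.exists_detour h hd
    refine Or.inr ⟨e, f, hf, hd', ?_⟩
    have hk : (X \ B₁).ncard = k := by omega
    by_cases heX : e ∈ X
    · have : insert f (B₁ \ {e}) \ X = B₁ \ X := by grind
      rw [hX.ncard_sdiff_comm hf.isBase₁, this, hB₁.ncard_sdiff_comm hX, hk]
    · have : X \ insert f (B₁ \ {e}) = X \ B₁ := by grind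
      rw [this, hk]

lemma exchangeSeq_cons (hf : M.Feasible X Y e f) (hX : M.IsBase X) (hY : M.IsBase Y)
    {l : List (α × α)} {Q : Set α × Set α}
    (hl : M.ExchangeSeq l (insert f (X \ {e}), insert e (Y \ {f})) Q) :
    M.ExchangeSeq ((e, f) :: l) (X, Y) Q :=
  ⟨hX, hY, hf.left, hf.right, hf.isBase₁, hf.isBase₂, hl⟩

lemma ExchangeSeq.append {l l' : List (α × α)} {P Q Q' : Set α × Set α}
    (h : M.ExchangeSeq l P Q) (h' : M.ExchangeSeq l' Q Q') : M.ExchangeSeq (l ++ l') P Q' := by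
  induction l generalizing P with
  | nil => exact h.2.2 ▸ h'
  | cons a l ih =>
    obtain ⟨h1, h2, h3, h4, h5, h6, h7⟩ := h
    exact ⟨h1, h2, h3, h4, h5, h6, ih h7⟩

/-- An exchange of the target is undone by a final exchange. -/
lemma exchangeSeq_of_feasible (hf : M.Feasible B₁ B₂ e f) (h₁ : M.IsBase B₁) (h₂ : M.IsBase B₂) :
    M.ExchangeSeq [(f, e)] (insert f (B₁ \ {e}), insert e (B₂ \ {f})) (B₁, B₂) := by
  have hl := hf.left
  have hr := hf.right
  have k1 : insert e (insert f (B₁ \ {e}) \ {f}) = B₁ := by grind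
  have k2 : insert f (insert e (B₂ \ {f}) \ {e}) = B₂ := by grind
  refine ⟨hf.isBase₁, hf.isBase₂, ?_, ?_, ?_, ?_, ?_⟩
  · grind
  · grind
  · simpa only [k1] using h₁
  · simpa only [k2] using h₂
  · simp only [k1, k2]
    exact ⟨h₁, h₂, rfl⟩

lemma CompatibleBasisPairs.eq_of_ncard_eq_zero [M.Finite]
    (h : M.CompatibleBasisPairs (X, Y) (B₁, B₂)) (h0 : (X \ B₁).ncard = 0) : X = B₁ ∧ Y = B₂ := by
  have hX : M.IsBase X := h.isBase_left₁
  have hB₂ : M.IsBase B₂ := h.isBase_right₂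
  rw [Set.ncard_eq_zero (hX.finite.sdiff), Set.sdiff_eq_empty] at h0
  have hXB := hX.eq_of_subset_isBase h.isBase_right₁ h0
  refine ⟨hXB, (hB₂.eq_of_subset_isBase h.isBase_left₂ ?_).symm⟩
  rw [← Set.sdiff_eq_empty, ← h.sdiff_eq, hXB, Set.sdiff_self]

/-- An exchange of the current pair is put in front of the remaining sequence, while one of the
target is reversed and put at its end. -/
lemma IsSplit.exists_exchangeSeq [M.Finite] (hM : M.IsSplit) {k : ℕ}
    (h : M.CompatibleBasisPairs (X, Y) (B₁, B₂)) (hk : M.Within X B₁ B₂ k) :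
    ∃ l, M.ExchangeSeq l (X, Y) (B₁, B₂) ∧ l.length = k := by
  induction k generalizing X Y B₁ B₂ with
  | zero =>
    obtain ⟨-, hk⟩ | ⟨-, hk⟩ := hk
    · obtain ⟨rfl, rfl⟩ := h.eq_of_ncard_eq_zero hk
      exact ⟨[], ⟨h.isBase_left₁, h.isBase_left₂, rfl⟩, rfl⟩
    · omega
  | succ k ih =>
    obtain ⟨e, f, hf, hk'⟩ | ⟨e, f, hf, hk'⟩ := hM.exists_step h hk
    · obtain ⟨l, hl, hlk⟩ := ih (h.exchange hf) (Or.inl hk')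
      exact ⟨(e, f) :: l, exchangeSeq_cons hf h.isBase_left₁ h.isBase_left₂ hl, by simp [hlk]⟩
    · obtain ⟨l, hl, hlk⟩ := ih (h.exchange_right hf) (Or.inl hk')
      exact ⟨l ++ [(f, e)],
        hl.append (exchangeSeq_of_feasible hf h.isBase_right₁ h.isBase_right₂), by simp [hlk]⟩

lemma IsSplit.within_le [M.Finite] (hM : M.IsSplit) (h : M.CompatibleBasisPairs (X, Y) (B₁, B₂))
    {r k : ℕ} (hr : M.eRank = r) (hk : M.Within X B₁ B₂ k) : k ≤ min r (r - (X ∩ B₁).ncard + 1) := by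
  have hX : M.IsBase X := h.isBase_left₁
  have hXr : X.ncard = r := by
    rw [← hX.encard_eq_eRank, ← hX.finite.cast_ncard_eq] at hr
    exact_mod_cast hr
  have h1 : (X ∩ B₁).ncard + (X \ B₁).ncard = X.ncard :=
    Set.ncard_inter_add_ncard_sdiff_eq_ncard X B₁ hX.finite
  obtain ⟨-, hk⟩ | ⟨hd, hk⟩ := hk
  · omega
  · have := (Set.ncard_pos (hX.finite.inter_of_left _)).2 (hM.inter_nonempty_of_dead h hd)
    omega

lemma exists_within (M : Matroid α) (X B₁ B₂ : Set α) : ∃ k, M.Within X B₁ B₂ k := by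
  by_cases hd : M.Dead X B₁ B₂
  · exact ⟨_, Or.inr ⟨hd, rfl⟩⟩
  · exact ⟨_, Or.inl ⟨hd, rfl⟩⟩

theorem IsSplit.exchangeDist_le [M.Finite] (hM : M.IsSplit)
    (h : M.CompatibleBasisPairs (X, Y) (B₁, B₂)) {r : ℕ} (hr : M.eRank = r) :
    M.exchangeDist (X, Y) (B₁, B₂) ≤ (min r (r - (X ∩ B₁).ncard + 1) : ℕ) := by
  obtain ⟨k, hk⟩ := M.exists_within X B₁ B₂
  obtain ⟨l, hl, hlk⟩ := hM.exists_exchangeSeq h hk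
  refine (iInf₂_le l hl).trans ?_
  rw [hlk]
  exact_mod_cast hM.within_le h hr hk

end Steps
end Matroid

namespace OracleRAM

/-! ## Composing programs -/

section Compose

/-- The program variables of a store are its even registers; the odd ones hold intermediate
results. -/
def Store.vars (s : Store) : Store := ⟨fun x => s.reg (2 * x), s.mem⟩

/-- The stores agree in all arrays and in the registers below `j`. -/
def Agree (j : ℕ) (σ τ : Store) : Prop := σ.mem = τ.mem ∧ ∀ x < j, σ.reg x = τ.reg x

/-- The stores agree in the odd registers from `3` up to, but not including, `2 * m + 1`. -/
def Keeps (m : ℕ) (s s' : Store) : Prop :=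
  ∀ x, 1 ≤ x → x < m → s'.reg (2 * x + 1) = s.reg (2 * x + 1)

variable {j m x y a c k : ℕ} {s s' s'' σ τ : Store}

lemma Agree.refl (j : ℕ) (σ : Store) : Agree j σ σ := ⟨rfl, fun _ _ => rfl⟩

lemma Agree.trans {υ : Store} (h : Agree j σ τ) (h' : Agree j τ υ) : Agree j σ υ :=
  ⟨h.1.trans h'.1, fun x hx => (h.2 x hx).trans (h'.2 x hx)⟩

lemma Agree.mono (h : Agree k σ τ) (hjk : j ≤ k) : Agree j σ τ :=
  ⟨h.1, fun x hx => h.2 x (hx.trans_le hjk)⟩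

lemma Agree.setReg (h : Agree j σ τ) (x v : ℕ) : Agree j (σ.setReg x v) (τ.setReg x v) := by
  refine ⟨h.1, fun y hy => ?_⟩
  by_cases hyx : y = x
  · simp [Store.setReg, hyx]
  · simp [Store.setReg, hyx, h.2 y hy]

lemma Agree.setReg_succ (h : Agree j σ τ) (v : ℕ) :
    Agree (j + 1) (σ.setReg j v) (τ.setReg j v) := by
  refine ⟨h.1, fun y hy => ?_⟩
  by_cases hyx : y = j
  · simp [Store.setReg, hyx]
  · simp [Store.setReg, hyx, h.2 y (by omega)]

lemma Agree.setMem (h : Agree j σ τ) (a i v : ℕ) : Agree j (σ.setMem a i v) (τ.setMem a i v) :=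
  ⟨by simp [Store.setMem, h.1], h.2⟩

lemma agree_setReg_self (j : ℕ) (σ : Store) (v : ℕ) : Agree j (σ.setReg j v) σ :=
  ⟨rfl, fun x hx => by simp [Store.setReg, hx.ne]⟩

lemma Agree.reg_zero (h : Agree j s'.vars s.vars) (hj : 0 < j) : s'.reg 0 = s.reg 0 := h.2 0 hj

lemma Keeps.refl (m : ℕ) (s : Store) : Keeps m s s := fun _ _ _ => rfl

lemma Keeps.trans (h : Keeps m s s') (h' : Keeps m s' s'') : Keeps m s s'' :=
  fun x h1 h2 => (h' x h1 h2).trans (h x h1 h2)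

lemma Keeps.mono (h : Keeps k s s') (hmk : m ≤ k) : Keeps m s s' :=
  fun x h1 h2 => h x h1 (h2.trans_le hmk)

lemma keeps_setReg_even (m : ℕ) (s : Store) (x v : ℕ) : Keeps m s (s.setReg (2 * x) v) := by
  intro y _ _
  simp only [Store.setReg]
  rw [Function.update_of_ne (by omega)]

lemma keeps_setReg_one (m : ℕ) (s : Store) (v : ℕ) : Keeps m s (s.setReg 1 v) := by
  intro y _ _
  simp only [Store.setReg]
  rw [Function.update_of_ne (by omega)]

lemma keeps_setReg_odd (m : ℕ) (s : Store) (v : ℕ) : Keeps m s (s.setReg (2 * m + 1) v) := by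
  intro y _ _
  simp only [Store.setReg]
  rw [Function.update_of_ne (by omega)]

lemma keeps_setMem (m : ℕ) (s : Store) (a i v : ℕ) : Keeps m s (s.setMem a i v) :=
  fun _ _ _ => rfl

lemma Store.setReg_reg_self (s : Store) (x v : ℕ) : (s.setReg x v).reg x = v := by
  simp [Store.setReg]

lemma Store.setReg_reg_of_ne (s : Store) {x y : ℕ} (v : ℕ) (h : y ≠ x) :
    (s.setReg x v).reg y = s.reg y := by
  simp [Store.setReg, h]

lemma Store.setReg_mem (s : Store) (x v : ℕ) : (s.setReg x v).mem = s.mem := rfl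

lemma Store.setMem_reg (s : Store) (a i v : ℕ) : (s.setMem a i v).reg = s.reg := rfl

lemma Store.vars_setReg_odd (s : Store) (x v : ℕ) : (s.setReg (2 * x + 1) v).vars = s.vars := by
  simp only [Store.vars, Store.setReg]
  congr 1
  funext y
  rw [Function.update_of_ne (by omega)]

lemma Store.vars_setReg_one (s : Store) (v : ℕ) : (s.setReg 1 v).vars = s.vars :=
  s.vars_setReg_odd 0 v

lemma Store.vars_setReg_even (s : Store) (x v : ℕ) :
    (s.setReg (2 * x) v).vars = s.vars.setReg x v := by
  simp only [Store.vars, Store.setReg]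
  congr 1
  funext y
  by_cases h : y = x
  · simp [h]
  · rw [Function.update_of_ne h, Function.update_of_ne (by omega)]

/-- The value `v` depends only on the arrays and on the first `j` program variables, and is computed
in polynomial time, without changing them, by some program with its intermediate results in any
prescribed range of odd registers. -/
structure Comp (j : ℕ) (v : (Set ℕ → Prop) → Store → ℕ) : Prop where
  pos : 0 < j
  congr : ∀ O σ τ, Agree j σ τ → v O σ = v O τ
  run : ∀ m, 1 ≤ m → ∃ (p : Prog) (T : Polynomial ℕ), ∀ O s, ∃ t s', Run O p s t s' ∧
    t ≤ T.eval (s.reg 0) ∧ Agree j s'.vars s.vars ∧ Keeps m s s' ∧ s'.reg 1 = v O s.vars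

variable {v w : (Set ℕ → Prop) → Store → ℕ}

lemma Comp.lit (hj : 0 < j) (c : ℕ) : Comp j fun _ _ => c := by
  refine ⟨hj, fun _ _ _ _ => rfl, fun m _ => ⟨.assign 1 (.lit c), 2, fun O s => ?_⟩⟩
  refine ⟨_, _, .assign _ _ _, by simp [AExp.cost], ?_, keeps_setReg_one _ _ _,
    s.setReg_reg_self _ _⟩
  rw [s.vars_setReg_one]
  exact Agree.refl _ _

lemma Comp.var (hx : x < j) : Comp j fun _ σ => σ.reg x := by
  refine ⟨by omega, fun _ _ _ h => h.2 x hx, fun m _ => ⟨.assign 1 (.var (2 * x)), 2, fun O s => ?_⟩⟩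
  refine ⟨_, _, .assign _ _ _, by simp [AExp.cost], ?_, keeps_setReg_one _ _ _,
    s.setReg_reg_self _ _⟩
  rw [s.vars_setReg_one]
  exact Agree.refl _ _

lemma Comp.get (a : ℕ) (hx : x < j) : Comp j fun _ σ => σ.mem a (σ.reg x) := by
  refine ⟨by omega, fun _ _ _ h => by simp only [h.1, h.2 x hx],
    fun m _ => ⟨.assign 1 (.get a (.var (2 * x))), 3, fun O s => ?_⟩⟩
  refine ⟨_, _, .assign _ _ _, by simp [AExp.cost], ?_, keeps_setReg_one _ _ _,
    s.setReg_reg_self _ _⟩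
  rw [s.vars_setReg_one]
  exact Agree.refl _ _

lemma Comp.query (hj : 0 < j) (a : ℕ) : Comp j fun O σ => σ.answer O a := by
  refine ⟨hj, fun _ _ _ h => by rw [Store.answer, h.1]; rfl,
    fun m _ => ⟨.query 1 a, 1, fun O s => ?_⟩⟩
  refine ⟨_, _, .query _ _ _, by simp, ?_, keeps_setReg_one _ _ _, s.setReg_reg_self _ _⟩
  rw [s.vars_setReg_one]
  exact Agree.refl _ _

/-- The first operand is saved in the odd register `2 * m + 1`, and the second one is computed with
its intermediate results above it. This is why `Comp.run` has to provide a program for every m. -/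
lemma Comp.op (hv : Comp j v) (hw : Comp j w) (e : AExp → AExp → AExp) (g : ℕ → ℕ → ℕ)
    (hval : ∀ e₁ e₂ s, (e e₁ e₂).val s = g (e₁.val s) (e₂.val s))
    (hcost : ∀ e₁ e₂, (e e₁ e₂).cost = e₁.cost + e₂.cost + 1) :
    Comp j fun O σ => g (v O σ) (w O σ) := by
  refine ⟨hv.pos, fun O σ τ h => by rw [hv.congr O σ τ h, hw.congr O σ τ h], fun m hm => ?_⟩
  obtain ⟨p, T, hp⟩ := hv.run m hm
  obtain ⟨q, U, hq⟩ := hw.run (m + 1) (by omega)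
  refine ⟨.seq p (.seq (.assign (2 * m + 1) (.var 1)) (.seq q
    (.assign 1 (e (.var (2 * m + 1)) (.var 1))))), T + U + 6, fun O s => ?_⟩
  obtain ⟨t₁, s₁, r₁, ht₁, ha₁, hk₁, hv₁⟩ := hp O s
  obtain ⟨t₂, s₂, r₂, ht₂, ha₂, hk₂, hv₂⟩ := hq O (s₁.setReg (2 * m + 1) (s₁.reg 1))
  rw [s₁.vars_setReg_odd] at ha₂ hv₂
  refine ⟨_, _, .seq r₁ (.seq (.assign _ _ _) (.seq r₂ (.assign _ _ _))), ?_, ?_, ?_, ?_⟩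
  · rw [s₁.setReg_reg_of_ne _ (by omega), ha₁.reg_zero hv.pos] at ht₂
    simp only [hcost, AExp.cost, Polynomial.eval_add, Polynomial.eval_ofNat]
    omega
  · rw [Store.vars_setReg_one]
    exact ha₂.trans ha₁
  · exact (hk₁.trans ((keeps_setReg_odd m s₁ _).trans (hk₂.mono (by omega)))).trans
      (keeps_setReg_one _ _ _)
  · rw [Store.setReg_reg_self, hval]
    simp only [AExp.val]
    rw [hv₂, hk₂ m hm (by omega), Store.setReg_reg_self, hv₁, hw.congr O _ _ ha₁]

lemma Comp.add (hv : Comp j v) (hw : Comp j w) : Comp j fun O σ => v O σ + w O σ :=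
  hv.op hw .add _ (fun _ _ _ => rfl) (fun _ _ => rfl)

lemma Comp.sub (hv : Comp j v) (hw : Comp j w) : Comp j fun O σ => v O σ - w O σ :=
  hv.op hw .sub _ (fun _ _ _ => rfl) (fun _ _ => rfl)

lemma Comp.ite {u : (Set ℕ → Prop) → Store → ℕ} (hu : Comp j u) (hv : Comp j v) (hw : Comp j w) :
    Comp j fun O σ => if u O σ ≠ 0 then v O σ else w O σ := by
  refine ⟨hv.pos, fun O σ τ h => by
    rw [hu.congr O σ τ h, hv.congr O σ τ h, hw.congr O σ τ h], fun m hm => ?_⟩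
  obtain ⟨p, T, hp⟩ := hu.run m hm
  obtain ⟨q, U, hq⟩ := hv.run m hm
  obtain ⟨q', U', hq'⟩ := hw.run m hm
  refine ⟨.seq p (.ite (.var 1) q q'), T + U + U' + 2, fun O s => ?_⟩
  obtain ⟨t₁, s₁, r₁, ht₁, ha₁, hk₁, hv₁⟩ := hp O s
  by_cases h : u O s.vars ≠ 0
  · obtain ⟨t₂, s₂, r₂, ht₂, ha₂, hk₂, hv₂⟩ := hq O s₁
    refine ⟨_, _, .seq r₁ (.iteTrue (by simpa [AExp.val, hv₁] using h) r₂), ?_, ha₂.trans ha₁,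
      hk₁.trans hk₂, ?_⟩
    · rw [ha₁.reg_zero hv.pos] at ht₂
      simp only [AExp.cost, Polynomial.eval_add, Polynomial.eval_ofNat]
      omega
    · rw [hv₂, if_pos h, hv.congr O _ _ ha₁]
  · obtain ⟨t₂, s₂, r₂, ht₂, ha₂, hk₂, hv₂⟩ := hq' O s₁
    refine ⟨_, _, .seq r₁ (.iteFalse (by simpa [AExp.val, hv₁] using h) r₂), ?_, ha₂.trans ha₁,
      hk₁.trans hk₂, ?_⟩
    · rw [ha₁.reg_zero hv.pos] at ht₂
      simp only [AExp.cost, Polynomial.eval_add, Polynomial.eval_ofNat]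
      omega
    · rw [hv₂, if_neg h, hw.congr O _ _ ha₁]

lemma Store.setMem_setMem_self (s : Store) (a i u : ℕ) :
    (s.setMem a i u).setMem a i (s.mem a i) = s := by
  simp [Store.setMem]

/-- The entry is saved, overwritten and finally restored, so a value can be computed for a
hypothetical store. In this way the oracle is asked about sets after an exchange. -/
lemma Comp.withMem (hw : Comp j w) (a c : ℕ) (hx : x < j) :
    Comp j fun O σ => w O (σ.setMem a (σ.reg x) c) := by
  refine ⟨hw.pos, fun O σ τ h => ?_, fun m hm => ?_⟩
  · rw [h.2 x hx]
    exact hw.congr _ _ _ (h.setMem _ _ _)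
  obtain ⟨p, T, hp⟩ := hw.run (m + 1) (by omega)
  refine ⟨.seq (.assign (2 * m + 1) (.get a (.var (2 * x)))) (.seq (.store a (.var (2 * x)) (.lit c))
    (.seq p (.store a (.var (2 * x)) (.var (2 * m + 1))))), T + 9, fun O s => ?_⟩
  set s₁ := s.setReg (2 * m + 1) (s.mem a (s.reg (2 * x))) with hs₁
  have hx₁ : s₁.reg (2 * x) = s.reg (2 * x) := s.setReg_reg_of_ne _ (by omega)
  obtain ⟨t₂, s₂, r₂, ht₂, ha₂, hk₂, hv₂⟩ := hp O (s₁.setMem a (s.reg (2 * x)) c)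
  have hvars : (s₁.setMem a (s.reg (2 * x)) c).vars = s.vars.setMem a (s.vars.reg x) c := by
    change s₁.vars.setMem a (s.reg (2 * x)) c = _
    rw [hs₁, s.vars_setReg_odd]
    rfl
  rw [hvars] at ha₂ hv₂
  have hx₂ : s₂.reg (2 * x) = s.reg (2 * x) := ha₂.2 x hx
  have hm₂ : s₂.reg (2 * m + 1) = s.mem a (s.reg (2 * x)) := by
    rw [hk₂ m hm (by omega), Store.setMem_reg, hs₁, Store.setReg_reg_self]
  have q₁ := Run.store (O := O) a (.var (2 * x)) (.lit c) s₁
  rw [show (AExp.var (2 * x)).val s₁ = s.reg (2 * x) from hx₁] at q₁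
  have q₂ := Run.store (O := O) a (.var (2 * x)) (.var (2 * m + 1)) s₂
  rw [show (AExp.var (2 * x)).val s₂ = s.reg (2 * x) from hx₂,
    show (AExp.var (2 * m + 1)).val s₂ = s.mem a (s.reg (2 * x)) from hm₂] at q₂
  refine ⟨_, _, .seq (.assign _ _ _) (.seq q₁ (.seq r₂ q₂)), ?_, ?_, ?_, ?_⟩
  · rw [Store.setMem_reg, hs₁, s.setReg_reg_of_ne _ (by omega)] at ht₂
    simp only [AExp.cost, Polynomial.eval_add, Polynomial.eval_ofNat]
    omega
  · have h := ha₂.setMem a (s.reg (2 * x)) (s.mem a (s.reg (2 * x)))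
    rwa [show (s.vars.setMem a (s.vars.reg x) c).setMem a (s.reg (2 * x))
      (s.mem a (s.reg (2 * x))) = s.vars from s.vars.setMem_setMem_self _ _ _] at h
  · exact ((keeps_setReg_odd m s _).trans ((keeps_setMem m s₁ a _ c).trans
      (hk₂.mono (by omega)))).trans (keeps_setMem m s₂ a _ _)
  · exact hv₂

/-- Program variable j is the running index and is free to change because results may depend only on
variables below j. The sum is accumulated in an odd register. -/
lemma Comp.sum {F : (Set ℕ → Prop) → Store → ℕ → ℕ} (hj : 0 < j)
    (hF : Comp (j + 1) fun O σ => F O σ (σ.reg j))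
    (hF' : ∀ O σ i, F O (σ.setReg j i) i = F O σ i) :
    Comp j fun O σ => ∑ i ∈ Finset.range (σ.reg 0), F O σ i := by
  have hcongr : ∀ O σ τ i, Agree j σ τ → F O σ i = F O τ i := by
    intro O σ τ i h
    rw [← hF' O σ i, ← hF' O τ i]
    have := hF.congr O _ _ (h.setReg_succ i)
    simpa only [Store.setReg_reg_self] using this
  refine ⟨hj, fun O σ τ h => ?_, fun m hm => ?_⟩
  · rw [h.2 0 hj]
    exact Finset.sum_congr rfl fun i _ => hcongr O σ τ i h
  obtain ⟨p, T, hp⟩ := hF.run (m + 1) (by omega)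
  let body : Prog := .seq p (.seq (.assign (2 * m + 1) (.add (.var (2 * m + 1)) (.var 1)))
    (.assign (2 * j) (.add (.var (2 * j)) (.lit 1))))
  let cond : AExp := .sub (.var 0) (.var (2 * j))
  have hloop : ∀ O k s, s.reg (2 * j) + k = s.reg 0 → ∃ t s', Run O (.loop cond body) s t s' ∧
      t ≤ k * (T.eval (s.reg 0) + 12) + 4 ∧ Agree j s'.vars s.vars ∧ Keeps m s s' ∧
      s'.reg (2 * m + 1) =
        s.reg (2 * m + 1) + ∑ i ∈ Finset.range k, F O s.vars (s.reg (2 * j) + i) := by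
    intro O k
    induction k with
    | zero =>
      intro s hs
      refine ⟨_, _, .loopStop ?_, ?_, Agree.refl _ _, Keeps.refl _ _, by simp⟩
      · simp only [cond, AExp.val]; omega
      · simp [cond, AExp.cost]
    | succ k ih =>
      intro s hs
      obtain ⟨t₁, s₁, r₁, ht₁, ha₁, hk₁, hv₁⟩ := hp O s
      have hj₁ : s₁.reg (2 * j) = s.reg (2 * j) := ha₁.2 j (by omega)
      have h0₁ : s₁.reg 0 = s.reg 0 := ha₁.reg_zero (by omega)
      have hm₁ : s₁.reg (2 * m + 1) = s.reg (2 * m + 1) := hk₁ m hm (by omega)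
      set s₂ := s₁.setReg (2 * m + 1) (s₁.reg (2 * m + 1) + s₁.reg 1) with hs₂
      have hj₂ : s₂.reg (2 * j) = s.reg (2 * j) := by
        rw [hs₂, s₁.setReg_reg_of_ne _ (by omega), hj₁]
      set s₃ := s₂.setReg (2 * j) (s₂.reg (2 * j) + 1) with hs₃
      have hv₃ : Agree j s₃.vars s.vars := by
        rw [hs₃, s₂.vars_setReg_even, hs₂, s₁.vars_setReg_odd]
        exact (agree_setReg_self _ _ _).trans (ha₁.mono (by omega))
      have hj₃ : s₃.reg (2 * j) = s.reg (2 * j) + 1 := by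
        rw [hs₃, Store.setReg_reg_self, hj₂]
      have h0₃ : s₃.reg 0 = s.reg 0 := hv₃.reg_zero hj
      have hm₃ : s₃.reg (2 * m + 1) = s.reg (2 * m + 1) + F O s.vars (s.reg (2 * j)) := by
        rw [hs₃, s₂.setReg_reg_of_ne _ (by omega), hs₂, Store.setReg_reg_self, hm₁, hv₁]
        rfl
      obtain ⟨t₄, s₄, r₄, ht₄, ha₄, hk₄, hv₄⟩ := ih s₃ (by omega)
      refine ⟨_, s₄, .loopStep (s' := s₃) ?_ (.seq r₁ (.seq (.assign _ _ _) (.assign _ _ _))) r₄,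
        ?_, ha₄.trans hv₃, ?_, ?_⟩
      · simp only [cond, AExp.val]; omega
      · rw [h0₃] at ht₄
        simp only [cond, AExp.cost]
        rw [add_mul]
        omega
      · exact (((hk₁.mono (by omega)).trans (keeps_setReg_odd m s₁ _)).trans
          (keeps_setReg_even m s₂ j _)).trans hk₄
      · rw [hv₄, hm₃, hj₃, Finset.sum_range_succ', add_zero, add_assoc, add_right_inj, add_comm]
        refine congrArg₂ _ (Finset.sum_congr rfl fun i _ => ?_) rfl
        rw [hcongr O _ _ _ hv₃]
        congr 1
        omega
  refine ⟨.seq (.assign (2 * j) (.lit 0)) (.seq (.assign (2 * m + 1) (.lit 0))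
    (.seq (.loop cond body) (.assign 1 (.var (2 * m + 1))))),
    Polynomial.X * (T + 12) + 10, fun O s => ?_⟩
  set s₁ := s.setReg (2 * j) 0 with hs₁
  set s₂ := s₁.setReg (2 * m + 1) 0 with hs₂
  have hv₂ : Agree j s₂.vars s.vars := by
    rw [hs₂, s₁.vars_setReg_odd, hs₁, s.vars_setReg_even]
    exact agree_setReg_self _ _ _
  have hj₂ : s₂.reg (2 * j) = 0 := by
    rw [hs₂, s₁.setReg_reg_of_ne _ (by omega), hs₁, Store.setReg_reg_self]
  have h0₂ : s₂.reg 0 = s.reg 0 := hv₂.reg_zero hj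
  obtain ⟨t₃, s₃, r₃, ht₃, ha₃, hk₃, hv₃⟩ := hloop O (s.reg 0) s₂ (by omega)
  refine ⟨_, _, .seq (.assign _ _ _) (.seq (.assign _ _ _) (.seq r₃ (.assign _ _ _))), ?_, ?_, ?_, ?_⟩
  · rw [h0₂] at ht₃
    simp only [AExp.cost, Polynomial.eval_add, Polynomial.eval_ofNat, Polynomial.eval_mul,
      Polynomial.eval_X]
    omega
  · rw [Store.vars_setReg_one]
    exact ha₃.trans hv₂
  · exact (((keeps_setReg_even m s j _).trans (keeps_setReg_odd m s₁ _)).trans hk₃).trans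
      (keeps_setReg_one _ _ _)
  · rw [Store.setReg_reg_self]
    change s₃.reg (2 * m + 1) = _
    rw [hv₃, hs₂, Store.setReg_reg_self, zero_add]
    refine Finset.sum_congr rfl fun i _ => ?_
    rw [← hs₂, hj₂, zero_add]
    exact hcongr O _ _ _ hv₂

end Compose
end OracleRAM

namespace OracleRAM

/-! ### Properties decided in polynomial time -/

section Decide

variable {j x y a c : ℕ} {v w : (Set ℕ → Prop) → Store → ℕ} {φ ψ : (Set ℕ → Prop) → Store → Prop}

open Classical in
/-- The truth value of a proposition. -/
noncomputable def truth (p : Prop) : ℕ := if p then 1 else 0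

lemma truth_of_true {p : Prop} (h : p) : truth p = 1 := if_pos h

lemma truth_of_false {p : Prop} (h : ¬ p) : truth p = 0 := if_neg h

lemma truth_ne_zero {p : Prop} : truth p ≠ 0 ↔ p := by
  by_cases h : p <;> simp [truth, h]

/-- The property `φ` depends only on the arrays and on the first `j` program variables, and is
decided in polynomial time. -/
def Dec (j : ℕ) (φ : (Set ℕ → Prop) → Store → Prop) : Prop := Comp j fun O σ => truth (φ O σ)

lemma Comp.of_eq (hv : Comp j v) (h : ∀ O σ, v O σ = w O σ) : Comp j w := by
  have : v = w := funext fun O => funext fun σ => h O σ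
  exact this ▸ hv

lemma Dec.of_iff (hφ : Dec j φ) (h : ∀ O σ, φ O σ ↔ ψ O σ) : Dec j ψ :=
  Comp.of_eq hφ fun O σ => by rw [h O σ]

lemma Comp.ne_zero (hv : Comp j v) : Dec j fun O σ => v O σ ≠ 0 := by
  refine (hv.ite (Comp.lit hv.pos 1) (Comp.lit hv.pos 0)).of_eq fun O σ => ?_
  by_cases h : v O σ ≠ 0
  · rw [if_pos h, truth_of_true h]
  · rw [if_neg h, truth_of_false h]

lemma Dec.not (hφ : Dec j φ) : Dec j fun O σ => ¬ φ O σ := by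
  refine ((Comp.lit hφ.pos 1).sub hφ).of_eq fun O σ => ?_
  by_cases h : φ O σ <;> simp [truth, h]

lemma Dec.and (hφ : Dec j φ) (hψ : Dec j ψ) : Dec j fun O σ => φ O σ ∧ ψ O σ := by
  refine (Comp.ite hφ hψ (Comp.lit hφ.pos 0)).of_eq fun O σ => ?_
  by_cases h : φ O σ <;> by_cases h' : ψ O σ <;> simp [truth, h, h']

lemma Dec.query (hj : 0 < j) (a : ℕ) : Dec j fun O σ => O {i | σ.mem a i ≠ 0} :=
  Comp.query hj a

lemma Dec.mem (a : ℕ) (hx : x < j) : Dec j fun _ σ => σ.mem a (σ.reg x) ≠ 0 :=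
  (Comp.get a hx).ne_zero

lemma Comp.le (hv : Comp j v) (hw : Comp j w) : Dec j fun O σ => v O σ ≤ w O σ :=
  (hv.sub hw).ne_zero.not.of_iff fun O σ => by omega

lemma Comp.eq (hv : Comp j v) (hw : Comp j w) : Dec j fun O σ => v O σ = w O σ :=
  ((hv.le hw).and (hw.le hv)).of_iff fun O σ => by omega

lemma Dec.withMem (hφ : Dec j φ) (a c : ℕ) (hx : x < j) :
    Dec j fun O σ => φ O (σ.setMem a (σ.reg x) c) :=
  Comp.withMem hφ a c hx

/-- A family of properties that does not depend on the registers from `j` on. -/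
def IndepAbove (j : ℕ) (φ : (Set ℕ → Prop) → Store → ℕ → Prop) : Prop :=
  ∀ x ≥ j, ∀ O σ i k, φ O (σ.setReg x i) k ↔ φ O σ k

/-- A bounded existential holds exactly if the sum of the truth values is nonzero. Nested
quantifiers use successive program variables. -/
lemma Dec.ex {φ : (Set ℕ → Prop) → Store → ℕ → Prop} (hj : 0 < j)
    (h : Dec (j + 1) fun O σ => φ O σ (σ.reg j)) (hφ : IndepAbove j φ) :
    Dec j fun O σ => ∃ i < σ.reg 0, φ O σ i := by
  refine (Comp.sum (F := fun O σ i => truth (φ O σ i)) hj h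
    fun O σ i => by rw [hφ j le_rfl]).ne_zero.of_iff fun O σ => ?_
  simp [Finset.sum_eq_zero_iff, truth_ne_zero]

/-- The least `i < n` with property `p`, computed as a sum of truth values. -/
noncomputable def first (n : ℕ) (p : ℕ → Prop) : ℕ :=
  ∑ i ∈ Finset.range n, truth (¬ ∃ k < n, k ≤ i ∧ p k)

open Classical in
lemma first_spec {n : ℕ} {p : ℕ → Prop} (h : ∃ i < n, p i) : first n p < n ∧ p (first n p) := by
  have h1 := Nat.find_spec h
  have : first n p = Nat.find h := by
    have h2 : ∀ i ∈ Finset.range n, truth (¬ ∃ k < n, k ≤ i ∧ p k) = if i < Nat.find h then 1 else 0 := by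
      intro i _
      split_ifs with hi
      · refine truth_of_true ?_
        rintro ⟨k, hk, hki, hpk⟩
        exact Nat.find_min h (hki.trans_lt hi) ⟨hk, hpk⟩
      · exact truth_of_false (not_not.2 ⟨_, h1.1, not_lt.1 hi, h1.2⟩)
    rw [first, Finset.sum_congr rfl h2, Finset.sum_boole]
    have h3 : {i ∈ Finset.range n | i < Nat.find h} = Finset.range (Nat.find h) := by
      ext i
      simp only [Finset.mem_filter, Finset.mem_range]
      have := h1.1
      omega
    rw [h3, Finset.card_range, Nat.cast_id]
  rw [this]
  exact h1

lemma Comp.first {φ : (Set ℕ → Prop) → Store → ℕ → Prop} (hj : 0 < j)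
    (h : Dec (j + 2) fun O σ => φ O σ (σ.reg (j + 1))) (hφ : IndepAbove j φ) :
    Comp j fun O σ => first (σ.reg 0) (φ O σ) := by
  refine Comp.sum (F := fun O σ i => truth (¬ ∃ k < σ.reg 0, k ≤ i ∧ φ O σ k)) hj ?_ ?_
  · refine Dec.not (Dec.ex (φ := fun O σ k => k ≤ σ.reg j ∧ φ O σ k) (by omega) ?_ ?_)
    · exact ((Comp.var (by omega)).le (Comp.var (by omega))).and h
    · intro x hx O σ i k
      dsimp only
      rw [hφ x (by omega), σ.setReg_reg_of_ne _ (by omega)]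
  · intro O σ i
    simp only [hφ j le_rfl, σ.setReg_reg_of_ne i hj.ne]

end Decide

/-! ### Store transformations performed in polynomial time -/

section Commands

/-- The state transformation `F` acts only on the arrays and the first `j` program variables, and is
performed in polynomial time. -/
structure Cmd (j : ℕ) (F : (Set ℕ → Prop) → Store → Store) : Prop where
  pos : 0 < j
  reg_zero : ∀ O σ, (F O σ).reg 0 = σ.reg 0
  congr : ∀ O σ τ, Agree j σ τ → Agree j (F O σ) (F O τ)
  run : ∀ m, 1 ≤ m → ∃ (p : Prog) (T : Polynomial ℕ), ∀ O s, ∃ t s', Run O p s t s' ∧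
    t ≤ T.eval (s.reg 0) ∧ Agree j s'.vars (F O s.vars) ∧ Keeps m s s'

variable {j x a : ℕ} {v : (Set ℕ → Prop) → Store → ℕ} {F G : (Set ℕ → Prop) → Store → Store}

lemma Cmd.skip (hj : 0 < j) : Cmd j fun _ σ => σ :=
  ⟨hj, fun _ _ => rfl, fun _ _ _ h => h, fun m _ => ⟨.skip, 1, fun O s =>
    ⟨_, _, .skip s, by simp, Agree.refl _ _, Keeps.refl _ _⟩⟩⟩

/-- Variable 0 holds the size in which all running times are measured, so it is never assigned. -/
lemma Cmd.assign (hv : Comp j v) (hx0 : x ≠ 0) :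
    Cmd j fun O σ => σ.setReg x (v O σ) := by
  refine ⟨hv.pos, fun O σ => σ.setReg_reg_of_ne _ hx0.symm, fun O σ τ h => ?_, fun m hm => ?_⟩
  · rw [hv.congr O σ τ h]
    exact h.setReg _ _
  obtain ⟨p, T, hp⟩ := hv.run m hm
  refine ⟨.seq p (.assign (2 * x) (.var 1)), T + 2, fun O s => ?_⟩
  obtain ⟨t₁, s₁, r₁, ht₁, ha₁, hk₁, hv₁⟩ := hp O s
  refine ⟨_, _, .seq r₁ (.assign _ _ _), ?_, ?_, hk₁.trans (keeps_setReg_even _ _ _ _)⟩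
  · simp only [AExp.cost, Polynomial.eval_add, Polynomial.eval_ofNat]
    omega
  · rw [s₁.vars_setReg_even, show (AExp.var 1).val s₁ = v O s.vars from hv₁]
    exact ha₁.setReg _ _

lemma Cmd.store (hv : Comp j v) (a : ℕ) (hx : x < j) :
    Cmd j fun O σ => σ.setMem a (σ.reg x) (v O σ) := by
  refine ⟨hv.pos, fun O σ => rfl, fun O σ τ h => ?_, fun m hm => ?_⟩
  · rw [hv.congr O σ τ h, h.2 x hx]
    exact h.setMem _ _ _
  obtain ⟨p, T, hp⟩ := hv.run m hm
  refine ⟨.seq p (.store a (.var (2 * x)) (.var 1)), T + 3, fun O s => ?_⟩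
  obtain ⟨t₁, s₁, r₁, ht₁, ha₁, hk₁, hv₁⟩ := hp O s
  refine ⟨_, _, .seq r₁ (.store _ _ _ _), ?_, ?_, hk₁.trans (keeps_setMem _ _ _ _ _)⟩
  · simp only [AExp.cost, Polynomial.eval_add, Polynomial.eval_ofNat]
    omega
  · rw [show (AExp.var 1).val s₁ = v O s.vars from hv₁,
      show (AExp.var (2 * x)).val s₁ = s.vars.reg x from ha₁.2 x hx]
    exact ha₁.setMem _ _ _

lemma Cmd.seq (hF : Cmd j F) (hG : Cmd j G) : Cmd j fun O σ => G O (F O σ) := by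
  refine ⟨hF.pos, fun O σ => by rw [hG.reg_zero, hF.reg_zero],
    fun O σ τ h => hG.congr _ _ _ (hF.congr _ _ _ h), fun m hm => ?_⟩
  obtain ⟨p, T, hp⟩ := hF.run m hm
  obtain ⟨q, U, hq⟩ := hG.run m hm
  refine ⟨.seq p q, T + U, fun O s => ?_⟩
  obtain ⟨t₁, s₁, r₁, ht₁, ha₁, hk₁⟩ := hp O s
  obtain ⟨t₂, s₂, r₂, ht₂, ha₂, hk₂⟩ := hq O s₁
  refine ⟨_, _, .seq r₁ r₂, ?_, ha₂.trans (hG.congr _ _ _ ha₁), hk₁.trans hk₂⟩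
  have h0 : s₁.reg 0 = s.reg 0 := (ha₁.2 0 hF.pos).trans (hF.reg_zero O s.vars)
  rw [h0] at ht₂
  rw [Polynomial.eval_add]
  omega

lemma Cmd.ite {φ : (Set ℕ → Prop) → Store → Prop} [∀ O σ, Decidable (φ O σ)] (hφ : Dec j φ)
    (hF : Cmd j F) (hG : Cmd j G) : Cmd j fun O σ => if φ O σ then F O σ else G O σ := by
  have hcongr : ∀ O σ τ, Agree j σ τ → (φ O σ ↔ φ O τ) := by
    intro O σ τ h
    rw [← truth_ne_zero (p := φ O σ), ← truth_ne_zero (p := φ O τ)]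
    have := Comp.congr hφ O σ τ h
    rw [this]
  refine ⟨hF.pos, fun O σ => ?_, fun O σ τ h => ?_, fun m hm => ?_⟩
  · split_ifs
    · exact hF.reg_zero O σ
    · exact hG.reg_zero O σ
  · by_cases h1 : φ O σ
    · simp only [h1, (hcongr O σ τ h).1 h1, if_true]
      exact hF.congr _ _ _ h
    · have h2 : ¬ φ O τ := fun h2 => h1 ((hcongr O σ τ h).2 h2)
      simp only [h1, h2, if_false]
      exact hG.congr _ _ _ h
  obtain ⟨p, T, hp⟩ := Comp.run hφ m hm
  obtain ⟨q, U, hq⟩ := hF.run m hm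
  obtain ⟨q', U', hq'⟩ := hG.run m hm
  refine ⟨.seq p (.ite (.var 1) q q'), T + U + U' + 2, fun O s => ?_⟩
  obtain ⟨t₁, s₁, r₁, ht₁, ha₁, hk₁, hv₁⟩ := hp O s
  by_cases h : φ O s.vars
  · obtain ⟨t₂, s₂, r₂, ht₂, ha₂, hk₂⟩ := hq O s₁
    refine ⟨_, _, .seq r₁ (.iteTrue (by simpa [AExp.val, hv₁, truth_ne_zero] using h) r₂), ?_, ?_,
      hk₁.trans hk₂⟩
    · rw [ha₁.reg_zero hF.pos] at ht₂
      simp only [AExp.cost, Polynomial.eval_add, Polynomial.eval_ofNat]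
      omega
    · simp only [h, if_true]
      exact ha₂.trans (hF.congr _ _ _ ha₁)
  · obtain ⟨t₂, s₂, r₂, ht₂, ha₂, hk₂⟩ := hq' O s₁
    refine ⟨_, _, .seq r₁ (.iteFalse (by simp [AExp.val, hv₁, truth_of_false h]) r₂), ?_, ?_,
      hk₁.trans hk₂⟩
    · rw [ha₁.reg_zero hF.pos] at ht₂
      simp only [AExp.cost, Polynomial.eval_add, Polynomial.eval_ofNat]
      omega
    · simp only [h, if_false]
      exact ha₂.trans (hG.congr _ _ _ ha₁)

/-- The size is copied to an odd register that counts down and that the body keeps. A body of time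
T(n) thus runs n times, which is again polynomial because it preserves n. -/
lemma Cmd.iterate (hF : Cmd j F) : Cmd j fun O σ => (F O)^[σ.reg 0] σ := by
  have hzero : ∀ O k σ, ((F O)^[k] σ).reg 0 = σ.reg 0 := by
    intro O k
    induction k with
    | zero => exact fun _ => rfl
    | succ k ih => intro σ; rw [Function.iterate_succ_apply, ih, hF.reg_zero]
  have hcongr : ∀ O k σ τ, Agree j σ τ → Agree j ((F O)^[k] σ) ((F O)^[k] τ) := by
    intro O k
    induction k with
    | zero => exact fun _ _ h => h
    | succ k ih =>
      intro σ τ h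
      rw [Function.iterate_succ_apply, Function.iterate_succ_apply]
      exact ih _ _ (hF.congr _ _ _ h)
  refine ⟨hF.pos, fun O σ => hzero O _ σ, fun O σ τ h => ?_, fun m hm => ?_⟩
  · rw [h.2 0 hF.pos]
    exact hcongr _ _ _ _ h
  obtain ⟨p, T, hp⟩ := hF.run (m + 1) (by omega)
  let body : Prog := .seq p (.assign (2 * m + 1) (.sub (.var (2 * m + 1)) (.lit 1)))
  have hloop : ∀ O k s, s.reg (2 * m + 1) = k → ∃ t s', Run O (.loop (.var (2 * m + 1)) body) s t s' ∧
      t ≤ k * (T.eval (s.reg 0) + 6) + 2 ∧ Agree j s'.vars ((F O)^[k] s.vars) ∧ Keeps m s s' := by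
    intro O k
    induction k with
    | zero =>
      intro s hs
      exact ⟨_, _, .loopStop hs, by simp [AExp.cost], Agree.refl _ _, Keeps.refl _ _⟩
    | succ k ih =>
      intro s hs
      obtain ⟨t₁, s₁, r₁, ht₁, ha₁, hk₁⟩ := hp O s
      have hm₁ : s₁.reg (2 * m + 1) = k + 1 := (hk₁ m hm (by omega)).trans hs
      have h0 : s₁.reg 0 = s.reg 0 := (ha₁.2 0 hF.pos).trans (hF.reg_zero O s.vars)
      set s₂ := s₁.setReg (2 * m + 1) (s₁.reg (2 * m + 1) - 1) with hs₂
      obtain ⟨t₃, s₃, r₃, ht₃, ha₃, hk₃⟩ := ih s₂ (by rw [hs₂, Store.setReg_reg_self, hm₁]; rfl)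
      rw [hs₂, s₁.vars_setReg_odd] at ha₃
      refine ⟨_, s₃, .loopStep (s' := s₂) ?_ (.seq r₁ (.assign _ _ _)) r₃, ?_, ?_, ?_⟩
      · simp only [AExp.val]; omega
      · rw [hs₂, s₁.setReg_reg_of_ne _ (by omega), h0] at ht₃
        simp only [AExp.cost]
        rw [add_mul]
        omega
      · rw [Function.iterate_succ_apply]
        exact ha₃.trans (hcongr _ _ _ _ ha₁)
      · exact ((hk₁.mono (by omega)).trans (keeps_setReg_odd m s₁ _)).trans hk₃
  refine ⟨.seq (.assign (2 * m + 1) (.var 0)) (.loop (.var (2 * m + 1)) body),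
    Polynomial.X * (T + 6) + 4, fun O s => ?_⟩
  obtain ⟨t₁, s₁, r₁, ht₁, ha₁, hk₁⟩ := hloop O (s.reg 0) (s.setReg (2 * m + 1) (s.reg 0))
    (s.setReg_reg_self _ _)
  rw [s.vars_setReg_odd] at ha₁
  refine ⟨_, _, .seq (.assign _ _ _) r₁, ?_, ha₁, (keeps_setReg_odd m s _).trans hk₁⟩
  rw [s.setReg_reg_of_ne _ (by omega)] at ht₁
  simp only [AExp.cost, Polynomial.eval_add, Polynomial.eval_ofNat, Polynomial.eval_mul,
    Polynomial.eval_X]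
  omega

end Commands
end OracleRAM

namespace OracleRAM

/-! ## The algorithm

Program variable `0` holds the size `n` of the ground set, arrays `4, 5` hold the current pair and
arrays `2, 3` the current target. The exchanges found so far occupy the output positions below
variable `1` and those from variable `2` on; variable `3` is the total number of exchanges. -/

section Formulas

variable {j x y z a b c : ℕ} {O : Set ℕ → Prop} {σ : Store}

/-- Element `i` lies in the set of array `a` but not in that of array `b`. -/
def InDiff (σ : Store) (a b i : ℕ) : Prop := σ.mem a i ≠ 0 ∧ ¬ σ.mem b i ≠ 0

/-- The oracle rejects the set of array `a` after the exchange of `e` for `f`. -/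
def Rejects (O : Set ℕ → Prop) (σ : Store) (a e f : ℕ) : Prop :=
  ¬ O {i | ((σ.setMem a e 0).setMem a f 1).mem a i ≠ 0}

/-- The test for a `2 × 2` submatrix with exactly one rejected exchange at array `c`. -/
def SingletonTest (O : Set ℕ → Prop) (σ : Store) (c a b : ℕ) : Prop :=
  ∃ p < σ.reg 0, ∃ r < σ.reg 0, ∃ q < σ.reg 0, ∃ s < σ.reg 0,
    (InDiff σ a b p ∧ InDiff σ a b r ∧ InDiff σ b a q ∧ InDiff σ b a s) ∧
    Rejects O σ c p q ∧ ¬ Rejects O σ c r q ∧ ¬ Rejects O σ c p s ∧ ¬ Rejects O σ c r s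

/-- The test for an exchange that is rejected at array `c` but not at array `d`. -/
def MixedTest (O : Set ℕ → Prop) (σ : Store) (c d a b : ℕ) : Prop :=
  ∃ p < σ.reg 0, ∃ q < σ.reg 0,
    (InDiff σ a b p ∧ InDiff σ b a q) ∧ Rejects O σ c p q ∧ ¬ Rejects O σ d q p

/-- The test for dead states. -/
def DeadTest (O : Set ℕ → Prop) (σ : Store) : Prop :=
  ¬ SingletonTest O σ 2 2 4 ∧ ¬ SingletonTest O σ 3 4 2 ∧
    MixedTest O σ 2 3 2 4 ∧ MixedTest O σ 3 2 4 2

/-- The number of elements of the current first base outside of the target. -/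
noncomputable def gap (σ : Store) : ℕ := ∑ i ∈ Finset.range (σ.reg 0), truth (InDiff σ 4 2 i)

/-- The symmetric exchange of `e` and `f` between arrays `a` and `b`. -/
def exchange (a b e f : ℕ) (σ : Store) : Store :=
  (((σ.setMem a e 0).setMem a f 1).setMem b f 0).setMem b e 1

/-- The test whether the exchange of `e` and `f` between arrays `a` and `b` is a suitable next
step. -/
def StepTest (a b : ℕ) (O : Set ℕ → Prop) (σ : Store) (e f : ℕ) : Prop :=
  (InDiff σ a b e ∧ InDiff σ b a f) ∧
  (O {i | (exchange a b e f σ).mem a i ≠ 0} ∧ O {i | (exchange a b e f σ).mem b i ≠ 0}) ∧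
  ¬ DeadTest O (exchange a b e f σ) ∧ gap (exchange a b e f σ) + σ.reg 1 + 1 = σ.reg 2

lemma inDiff_setReg (i v : ℕ) : InDiff (σ.setReg x v) a b i ↔ InDiff σ a b i := Iff.rfl

lemma rejects_setReg (e f v : ℕ) : Rejects O (σ.setReg x v) a e f ↔ Rejects O σ a e f := Iff.rfl

lemma dec_inDiff (a b : ℕ) (hx : x < j) : Dec j fun _ σ => InDiff σ a b (σ.reg x) :=
  (Dec.mem a hx).and (Dec.mem b hx).not

/-- Each `withMem` changes the store before everything it wraps, so the first modification is the
outermost one. -/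
lemma dec_rejects (a : ℕ) (hx : x < j) (hy : y < j) :
    Dec j fun O σ => Rejects O σ a (σ.reg x) (σ.reg y) :=
  ((((Dec.query (by omega) a).withMem a 1 hy).withMem a 0 hx)).not

lemma dec_singletonTest (hj : 0 < j) (c a b : ℕ) : Dec j fun O σ => SingletonTest O σ c a b := by
  refine Dec.ex hj (Dec.ex (by omega) (Dec.ex (by omega) (Dec.ex (by omega) ?_ ?_) ?_) ?_) ?_
  · exact ((dec_inDiff a b (by omega)).and ((dec_inDiff a b (by omega)).and
      ((dec_inDiff b a (by omega)).and (dec_inDiff b a (by omega))))).and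
      ((dec_rejects c (by omega) (by omega)).and ((dec_rejects c (by omega) (by omega)).not.and
      ((dec_rejects c (by omega) (by omega)).not.and (dec_rejects c (by omega) (by omega)).not)))
  all_goals
    intro x hx O σ i k
    simp (disch := omega) only [rejects_setReg, inDiff_setReg, Store.setReg_reg_of_ne]

lemma dec_mixedTest (hj : 0 < j) (c d a b : ℕ) : Dec j fun O σ => MixedTest O σ c d a b := by
  refine Dec.ex hj (Dec.ex (by omega) ?_ ?_) ?_
  · exact ((dec_inDiff a b (by omega)).and (dec_inDiff b a (by omega))).and
      ((dec_rejects c (by omega) (by omega)).and (dec_rejects d (by omega) (by omega)).not)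
  all_goals
    intro x hx O σ i k
    simp (disch := omega) only [rejects_setReg, inDiff_setReg, Store.setReg_reg_of_ne]

lemma dec_deadTest (hj : 0 < j) : Dec j DeadTest :=
  (dec_singletonTest hj _ _ _).not.and ((dec_singletonTest hj _ _ _).not.and
    ((dec_mixedTest hj _ _ _ _).and (dec_mixedTest hj _ _ _ _)))

lemma comp_gap (hj : 0 < j) : Comp j fun _ σ => gap σ :=
  Comp.sum (F := fun _ σ i => truth (InDiff σ 4 2 i)) hj (dec_inDiff 4 2 (by omega))
    fun _ _ _ => rfl

lemma Comp.exchange {v : (Set ℕ → Prop) → Store → ℕ} (hv : Comp j v) (a b : ℕ) (hx : x < j)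
    (hy : y < j) : Comp j fun O σ => v O (exchange a b (σ.reg x) (σ.reg y) σ) :=
  (((hv.withMem b 1 hx).withMem b 0 hy).withMem a 1 hy).withMem a 0 hx

lemma Dec.exchange {φ : (Set ℕ → Prop) → Store → Prop} (hφ : Dec j φ) (a b : ℕ) (hx : x < j)
    (hy : y < j) : Dec j fun O σ => φ O (exchange a b (σ.reg x) (σ.reg y) σ) :=
  Comp.exchange hφ a b hx hy

lemma dec_stepTest (hj : 3 ≤ j) (a b : ℕ) (hx : x < j) (hy : y < j) :
    Dec j fun O σ => StepTest a b O σ (σ.reg x) (σ.reg y) :=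
  ((dec_inDiff a b hx).and (dec_inDiff b a hy)).and
    ((((Dec.query (by omega) a).exchange a b hx hy).and
      ((Dec.query (by omega) b).exchange a b hx hy)).and
    (((dec_deadTest (by omega)).exchange a b hx hy).not.and
      (((((comp_gap (by omega)).exchange a b hx hy).add (Comp.var (by omega))).add
        (Comp.lit (by omega) 1)).eq (Comp.var (by omega)))))

lemma singletonTest_setReg {d : ℕ} (hx : x ≠ 0) (v : ℕ) :
    SingletonTest O (σ.setReg x v) d a b ↔ SingletonTest O σ d a b := by
  simp only [SingletonTest, rejects_setReg, inDiff_setReg, σ.setReg_reg_of_ne v hx.symm]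

lemma mixedTest_setReg {d : ℕ} (hx : x ≠ 0) (v : ℕ) :
    MixedTest O (σ.setReg x v) c d a b ↔ MixedTest O σ c d a b := by
  simp only [MixedTest, rejects_setReg, inDiff_setReg, σ.setReg_reg_of_ne v hx.symm]

lemma deadTest_setReg (hx : x ≠ 0) (v : ℕ) : DeadTest O (σ.setReg x v) ↔ DeadTest O σ := by
  simp only [DeadTest, singletonTest_setReg hx, mixedTest_setReg hx]

lemma gap_setReg (hx : x ≠ 0) (v : ℕ) : gap (σ.setReg x v) = gap σ := by
  simp only [gap, inDiff_setReg, σ.setReg_reg_of_ne v hx.symm]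

lemma stepTest_setReg (hx : 3 ≤ x) (v e f : ℕ) :
    StepTest a b O (σ.setReg x v) e f ↔ StepTest a b O σ e f := by
  have h : exchange a b e f (σ.setReg x v) = (exchange a b e f σ).setReg x v := rfl
  simp (disch := omega) only [StepTest, h, inDiff_setReg, deadTest_setReg, gap_setReg,
    Store.setReg_mem, Store.setReg_reg_of_ne]

end Formulas

/-! ### The algorithm as a polynomial-time program -/

section Program

/-- There is a suitable exchange between arrays `a` and `b`. -/
def HasStep (a b : ℕ) (O : Set ℕ → Prop) (σ : Store) : Prop :=
  ∃ e < σ.reg 0, ∃ f < σ.reg 0, StepTest a b O σ e f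

/-- Put the first element of a suitable exchange between arrays `a` and `b` into variable `4`. -/
noncomputable def pickLeft (a b : ℕ) (O : Set ℕ → Prop) (σ : Store) : Store :=
  σ.setReg 4 (first (σ.reg 0) fun e => ∃ f < σ.reg 0, StepTest a b O σ e f)

/-- Put a partner of variable `4` in a suitable exchange into variable `5`. -/
noncomputable def pickRight (a b : ℕ) (O : Set ℕ → Prop) (σ : Store) : Store :=
  σ.setReg 5 (first (σ.reg 0) fun f => StepTest a b O σ (σ.reg 4) f)

/-- Output the chosen exchange at the front, and perform it on the current pair. -/
def advance (σ : Store) : Store :=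
  let σ₁ := (σ.setMem 0 (σ.reg 1) (σ.reg 4)).setMem 1 (σ.reg 1) (σ.reg 5)
  (exchange 4 5 (σ.reg 4) (σ.reg 5) σ₁).setReg 1 (σ.reg 1 + 1)

/-- Output the reverse of the chosen exchange at the back, and perform it on the target. -/
def retract (σ : Store) : Store :=
  let σ₁ := σ.setReg 2 (σ.reg 2 - 1)
  let σ₂ := (σ₁.setMem 0 (σ₁.reg 2) (σ₁.reg 5)).setMem 1 (σ₁.reg 2) (σ₁.reg 4)
  exchange 2 3 (σ₂.reg 4) (σ₂.reg 5) σ₂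

open Classical in
/-- The body of the main loop. -/
noncomputable def body (O : Set ℕ → Prop) (σ : Store) : Store :=
  if HasStep 4 5 O σ then advance (pickRight 4 5 O (pickLeft 4 5 O σ))
  else if HasStep 2 3 O σ then retract (pickRight 2 3 O (pickLeft 2 3 O σ))
  else σ

/-- Copy one entry of the input. -/
def copy (σ : Store) : Store :=
  ((σ.setMem 4 (σ.reg 1) (σ.mem 0 (σ.reg 1))).setMem 5 (σ.reg 1) (σ.mem 1 (σ.reg 1))).setReg 1
    (σ.reg 1 + 1)

/-- Set up the output positions. -/
noncomputable def setup (O : Set ℕ → Prop) (σ : Store) : Store :=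
  let σ₁ := σ.setReg 1 0
  let σ₂ := σ₁.setReg 3 (gap σ₁ + truth (DeadTest O σ₁))
  σ₂.setReg 2 (σ₂.reg 3)

/-- The main part of the algorithm. -/
noncomputable def main (O : Set ℕ → Prop) (σ : Store) : Store :=
  (body O)^[(setup O (copy^[σ.reg 0] σ)).reg 0] (setup O (copy^[σ.reg 0] σ))

lemma cmd_exchange {j x y : ℕ} (a b : ℕ) (hx : x < j) (hy : y < j) :
    Cmd j fun _ σ => exchange a b (σ.reg x) (σ.reg y) σ :=
  have hj : 0 < j := by omega
  (((Cmd.store (Comp.lit hj 0) a hx).seq (Cmd.store (Comp.lit hj 1) a hy)).seq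
    (Cmd.store (Comp.lit hj 0) b hy)).seq (Cmd.store (Comp.lit hj 1) b hx)

lemma dec_hasStep (a b : ℕ) : Dec 6 (HasStep a b) := by
  refine Dec.ex (by omega) (Dec.ex (by omega) (dec_stepTest (by omega) a b (by omega) (by omega)) ?_) ?_
  all_goals
    intro x hx O σ i k
    simp (disch := omega) only [stepTest_setReg, Store.setReg_reg_of_ne]

lemma cmd_pickLeft (a b : ℕ) : Cmd 6 (pickLeft a b) := by
  refine Cmd.assign (Comp.first (by omega) (Dec.ex (by omega)
    (dec_stepTest (by omega) a b (by omega) (by omega)) ?_) ?_) (by omega)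
  all_goals
    intro x hx O σ i k
    simp (disch := omega) only [stepTest_setReg, Store.setReg_reg_of_ne]

lemma cmd_pickRight (a b : ℕ) : Cmd 6 (pickRight a b) := by
  refine Cmd.assign (Comp.first (by omega) (dec_stepTest (by omega) a b (by omega) (by omega)) ?_)
    (by omega)
  intro x hx O σ i k
  simp (disch := omega) only [stepTest_setReg, Store.setReg_reg_of_ne]

lemma cmd_advance : Cmd 6 fun _ => advance :=
  (((Cmd.store (Comp.var (x := 4) (by omega)) 0 (x := 1) (by omega)).seq
    (Cmd.store (Comp.var (x := 5) (by omega)) 1 (x := 1) (by omega))).seq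
    (cmd_exchange 4 5 (x := 4) (y := 5) (by omega) (by omega))).seq
    (Cmd.assign (x := 1) ((Comp.var (x := 1) (by omega)).add (Comp.lit (by omega) 1)) (by omega))

lemma cmd_retract : Cmd 6 fun _ => retract :=
  (((Cmd.assign (x := 2) ((Comp.var (x := 2) (by omega)).sub (Comp.lit (by omega) 1)) (by omega)).seq
    (Cmd.store (Comp.var (x := 5) (by omega)) 0 (x := 2) (by omega))).seq
    (Cmd.store (Comp.var (x := 4) (by omega)) 1 (x := 2) (by omega))).seq
    (cmd_exchange 2 3 (x := 4) (y := 5) (by omega) (by omega))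

open Classical in
lemma cmd_body : Cmd 6 body :=
  Cmd.ite (dec_hasStep 4 5) (((cmd_pickLeft 4 5).seq (cmd_pickRight 4 5)).seq cmd_advance)
    (Cmd.ite (dec_hasStep 2 3) (((cmd_pickLeft 2 3).seq (cmd_pickRight 2 3)).seq cmd_retract)
      (Cmd.skip (by omega)))

lemma cmd_copy : Cmd 6 fun _ => copy :=
  ((Cmd.store (Comp.get 0 (x := 1) (by omega)) 4 (x := 1) (by omega)).seq
    (Cmd.store (Comp.get 1 (x := 1) (by omega)) 5 (x := 1) (by omega))).seq
    (Cmd.assign (x := 1) ((Comp.var (x := 1) (by omega)).add (Comp.lit (by omega) 1)) (by omega))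

lemma cmd_setup : Cmd 6 setup :=
  ((Cmd.assign (x := 1) (Comp.lit (by omega) 0) (by omega)).seq
    (Cmd.assign (x := 3) ((comp_gap (by omega)).add (dec_deadTest (by omega))) (by omega))).seq
    (Cmd.assign (x := 2) (Comp.var (x := 3) (by omega)) (by omega))

lemma cmd_main : Cmd 6 main :=
  (cmd_copy.iterate.seq cmd_setup).seq cmd_body.iterate

/-- A single program performs the algorithm in polynomial time. -/
theorem exists_prog_main : ∃ (prog : Prog) (time : Polynomial ℕ), ∀ O s, ∃ t s',
    Run O prog s t s' ∧ t ≤ time.eval (s.reg 0) ∧ s'.mem = (main O s.vars).mem ∧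
      s'.reg 0 = (main O s.vars).reg 3 := by
  obtain ⟨p, T, hp⟩ := cmd_main.run 1 le_rfl
  -- Machine register 6 is program variable 3, the number of exchanges, which the output format
  -- expects in register 0.
  refine ⟨.seq p (.assign 0 (.var 6)), T + 2, fun O s => ?_⟩
  obtain ⟨t, s', r, ht, ha, -⟩ := hp O s
  refine ⟨_, _, .seq r (.assign _ _ _), ?_, ha.1, ?_⟩
  · simp only [AExp.cost, Polynomial.eval_add, Polynomial.eval_ofNat]
    omega
  · rw [Store.setReg_reg_self]
    exact ha.2 3 (by omega)

end Program
end OracleRAM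

namespace OracleRAM

open Matroid

/-! ## Correctness of the algorithm -/

section Semantics

variable {n : ℕ} {M : Matroid (Fin n)} {σ τ : Store} {a b c d : ℕ} {e f : Fin n}

/-- The subset of `{0, …, n - 1}` whose characteristic vector is array `a`. -/
def Store.toSet (n : ℕ) (σ : Store) (a : ℕ) : Set (Fin n) := {i | σ.mem a i ≠ 0}

lemma Store.setMem_mem_of_ne (σ : Store) (h : c ≠ a) (i v : ℕ) :
    (σ.setMem a i v).mem c = σ.mem c := by
  simp [Store.setMem, h]

lemma Store.setMem_mem_self (σ : Store) (a i v k : ℕ) :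
    (σ.setMem a i v).mem a k = if k = i then v else σ.mem a k := by
  simp [Store.setMem, Function.update_apply]

lemma toSet_congr (h : σ.mem a = τ.mem a) : σ.toSet n a = τ.toSet n a := by
  simp [Store.toSet, h]

lemma toSet_setMem_setMem (σ : Store) (a : ℕ) (e f : Fin n) :
    ((σ.setMem a e 0).setMem a f 1).toSet n a = insert f (σ.toSet n a \ {e}) := by
  ext i
  simp only [Store.toSet, Store.setMem_mem_self, Set.mem_ofPred_eq, Set.mem_insert_iff,
    Set.mem_sdiff, Set.mem_singleton_iff, Fin.ext_iff]
  split_ifs <;> simp_all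

lemma exchange_mem_of_ne (hca : c ≠ a) (hcb : c ≠ b) (e f : ℕ) :
    (exchange a b e f σ).mem c = σ.mem c := by
  simp only [exchange, Store.setMem_mem_of_ne _ hca, Store.setMem_mem_of_ne _ hcb]

lemma toSet_exchange_left (hab : a ≠ b) (σ : Store) (e f : Fin n) :
    (exchange a b e f σ).toSet n a = insert f (σ.toSet n a \ {e}) := by
  rw [← toSet_setMem_setMem]
  exact toSet_congr (by simp only [exchange, Store.setMem_mem_of_ne _ hab])

lemma toSet_exchange_right (hab : a ≠ b) (σ : Store) (e f : Fin n) :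
    (exchange a b e f σ).toSet n b = insert e (σ.toSet n b \ {f}) := by
  rw [exchange, toSet_setMem_setMem]
  rw [toSet_congr (τ := σ) (by simp only [Store.setMem_mem_of_ne _ hab.symm])]

/-- The oracle only knows independence, but an independent set obtained from a base by an exchange
is a base. -/
lemma rejects_iff (hB : M.IsBase (σ.toSet n a)) (hf : f ∉ σ.toSet n a) :
    Rejects (indepOracle M) σ a e f ↔ M.Blocked (σ.toSet n a) e f := by
  refine not_congr ?_
  change M.Indep (((σ.setMem a e 0).setMem a f 1).toSet n a) ↔ _
  rw [toSet_setMem_setMem]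
  exact ⟨fun h => hB.exchange_isBase_of_indep hf h, fun h => h.indep⟩

lemma singletonTest_iff (hn : σ.reg 0 = n) (hB : M.IsBase (σ.toSet n c))
    (hb : ∀ q ∈ σ.toSet n b \ σ.toSet n a, q ∉ σ.toSet n c) :
    SingletonTest (indepOracle M) σ c a b ↔ HasSingleton (M.Blocked (σ.toSet n c))
      (σ.toSet n a \ σ.toSet n b) (σ.toSet n b \ σ.toSet n a) := by
  rw [SingletonTest, hn]
  constructor
  · rintro ⟨p, hp, p', hp', q, hq, q', hq', ⟨h1, h2, h3, h4⟩, k1, k2, k3, k4⟩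
    lift p to Fin n using hp
    lift p' to Fin n using hp'
    lift q to Fin n using hq
    lift q' to Fin n using hq'
    have hqc := hb q h3
    have hqc' := hb q' h4
    rw [rejects_iff hB (by assumption)] at k1 k2 k3 k4
    exact ⟨p, h1, p', h2, q, h3, q', h4, k1, k2, k3, k4⟩
  · rintro ⟨p, h1, p', h2, q, h3, q', h4, k1, k2, k3, k4⟩
    have hqc := hb q h3
    have hqc' := hb q' h4
    rw [← rejects_iff hB (by assumption)] at k1 k2 k3 k4
    exact ⟨p, p.2, p', p'.2, q, q.2, q', q'.2, ⟨h1, h2, h3, h4⟩, k1, k2, k3, k4⟩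

lemma mixedTest_iff (hn : σ.reg 0 = n) (hB : M.IsBase (σ.toSet n c))
    (hB' : M.IsBase (σ.toSet n d)) (hb : ∀ q ∈ σ.toSet n b \ σ.toSet n a, q ∉ σ.toSet n c)
    (ha : ∀ p ∈ σ.toSet n a \ σ.toSet n b, p ∉ σ.toSet n d) :
    MixedTest (indepOracle M) σ c d a b ↔ ∃ p ∈ σ.toSet n a \ σ.toSet n b,
      ∃ q ∈ σ.toSet n b \ σ.toSet n a, M.Blocked (σ.toSet n c) p q ∧ ¬ M.Blocked (σ.toSet n d) q p := by
  rw [MixedTest, hn]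
  constructor
  · rintro ⟨p, hp, q, hq, ⟨h1, h2⟩, k1, k2⟩
    lift p to Fin n using hp
    lift q to Fin n using hq
    rw [rejects_iff hB (hb q h2)] at k1
    rw [rejects_iff hB' (ha p h1)] at k2
    exact ⟨p, h1, q, h2, k1, k2⟩
  · rintro ⟨p, h1, q, h2, k1, k2⟩
    rw [← rejects_iff hB (hb q h2)] at k1
    rw [← rejects_iff hB' (ha p h1)] at k2
    exact ⟨p, p.2, q, q.2, ⟨h1, h2⟩, k1, k2⟩

/-- The arrays `4, 5` and `2, 3` hold compatible basis pairs. -/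
def Valid (M : Matroid (Fin n)) (σ : Store) : Prop :=
  M.CompatibleBasisPairs (σ.toSet n 4, σ.toSet n 5) (σ.toSet n 2, σ.toSet n 3)

lemma Valid.deadTest_iff (h : Valid M σ) (hn : σ.reg 0 = n) :
    DeadTest (indepOracle M) σ ↔ M.Dead (σ.toSet n 4) (σ.toSet n 2) (σ.toSet n 3) := by
  have hB₁ : M.IsBase (σ.toSet n 2) := h.isBase_right₁
  have hB₂ : M.IsBase (σ.toSet n 3) := h.isBase_right₂
  have h1 : ∀ q ∈ σ.toSet n 4 \ σ.toSet n 2, q ∉ σ.toSet n 2 := fun q hq => hq.2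
  have h2 : ∀ q ∈ σ.toSet n 2 \ σ.toSet n 4, q ∉ σ.toSet n 3 := by
    rw [CompatibleBasisPairs.sdiff_eq (CompatibleBasisPairs.symm h)]
    exact fun q hq => hq.2
  rw [DeadTest, Dead, singletonTest_iff hn hB₁ h1, singletonTest_iff hn hB₂ h2,
    mixedTest_iff hn hB₁ hB₂ h1 h2, mixedTest_iff hn hB₂ hB₁ h2 h1]
  refine and_congr_right' (and_congr_right' (and_congr ?_ ?_))
  · constructor
    · rintro ⟨p, hp, q, hq, k⟩
      exact ⟨q, hq, p, hp, k⟩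
    · rintro ⟨p, hp, q, hq, k⟩
      exact ⟨q, hq, p, hp, k⟩
  · simp only [and_comm]

lemma gap_eq_ncard (hn : σ.reg 0 = n) : gap σ = (σ.toSet n 4 \ σ.toSet n 2).ncard := by
  classical
  rw [gap, hn, Finset.sum_range, Set.ncard_eq_toFinset_card']
  simp only [truth]
  rw [Finset.sum_boole, Nat.cast_id]
  congr 1
  ext i
  simp only [Finset.mem_filter, Finset.mem_univ, true_and, Set.mem_toFinset]
  rfl

/-- The equation with variables 1 and 2 says that the new distance equals the number of output
positions left after this step, as `Within` demands of a state that is not dead. -/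
lemma Valid.stepTest_front (h : Valid M σ) (hn : σ.reg 0 = n) :
    StepTest 4 5 (indepOracle M) σ e f ↔ M.Feasible (σ.toSet n 4) (σ.toSet n 5) e f ∧
      ¬ M.Dead (insert f (σ.toSet n 4 \ {e})) (σ.toSet n 2) (σ.toSet n 3) ∧
      (insert f (σ.toSet n 4 \ {e}) \ σ.toSet n 2).ncard + σ.reg 1 + 1 = σ.reg 2 := by
  set σ' := exchange 4 5 e f σ with hσ'
  have h4 : σ'.toSet n 4 = insert f (σ.toSet n 4 \ {e}) := toSet_exchange_left (by omega) σ e f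
  have h5 : σ'.toSet n 5 = insert e (σ.toSet n 5 \ {f}) := toSet_exchange_right (by omega) σ e f
  have h2 : σ'.toSet n 2 = σ.toSet n 2 := toSet_congr (exchange_mem_of_ne (by omega) (by omega) _ _)
  have h3 : σ'.toSet n 3 = σ.toSet n 3 := toSet_congr (exchange_mem_of_ne (by omega) (by omega) _ _)
  have hX : M.IsBase (σ.toSet n 4) := h.isBase_left₁
  have hY : M.IsBase (σ.toSet n 5) := h.isBase_left₂
  have hf : (InDiff σ 4 5 e ∧ InDiff σ 5 4 f) ∧ (indepOracle M {i | σ'.mem 4 i ≠ 0} ∧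
      indepOracle M {i | σ'.mem 5 i ≠ 0}) ↔ M.Feasible (σ.toSet n 4) (σ.toSet n 5) e f := by
    change (e ∈ σ.toSet n 4 \ σ.toSet n 5 ∧ f ∈ σ.toSet n 5 \ σ.toSet n 4) ∧
      (M.Indep (σ'.toSet n 4) ∧ M.Indep (σ'.toSet n 5)) ↔ _
    rw [h4, h5]
    constructor
    · rintro ⟨⟨k1, k2⟩, k3, k4⟩
      exact ⟨k1, k2, hX.exchange_isBase_of_indep k2.2 k3, hY.exchange_isBase_of_indep k1.2 k4⟩
    · rintro ⟨k1, k2, k3, k4⟩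
      exact ⟨⟨k1, k2⟩, k3.indep, k4.indep⟩
  rw [StepTest, ← hσ', ← and_assoc, hf]
  refine and_congr_right fun hf => ?_
  have hv : Valid M σ' := by
    rw [Valid, h4, h5, h2, h3]
    exact CompatibleBasisPairs.exchange h hf
  rw [hv.deadTest_iff hn, gap_eq_ncard (σ := σ') hn, h4, h2, h3]

lemma Valid.stepTest_back (h : Valid M σ) (hn : σ.reg 0 = n) :
    StepTest 2 3 (indepOracle M) σ e f ↔ M.Feasible (σ.toSet n 2) (σ.toSet n 3) e f ∧
      ¬ M.Dead (σ.toSet n 4) (insert f (σ.toSet n 2 \ {e})) (insert e (σ.toSet n 3 \ {f})) ∧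
      (σ.toSet n 4 \ insert f (σ.toSet n 2 \ {e})).ncard + σ.reg 1 + 1 = σ.reg 2 := by
  set σ' := exchange 2 3 e f σ with hσ'
  have h2 : σ'.toSet n 2 = insert f (σ.toSet n 2 \ {e}) := toSet_exchange_left (by omega) σ e f
  have h3 : σ'.toSet n 3 = insert e (σ.toSet n 3 \ {f}) := toSet_exchange_right (by omega) σ e f
  have h4 : σ'.toSet n 4 = σ.toSet n 4 := toSet_congr (exchange_mem_of_ne (by omega) (by omega) _ _)
  have h5 : σ'.toSet n 5 = σ.toSet n 5 := toSet_congr (exchange_mem_of_ne (by omega) (by omega) _ _)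
  have hX : M.IsBase (σ.toSet n 2) := h.isBase_right₁
  have hY : M.IsBase (σ.toSet n 3) := h.isBase_right₂
  have hf : (InDiff σ 2 3 e ∧ InDiff σ 3 2 f) ∧ (indepOracle M {i | σ'.mem 2 i ≠ 0} ∧
      indepOracle M {i | σ'.mem 3 i ≠ 0}) ↔ M.Feasible (σ.toSet n 2) (σ.toSet n 3) e f := by
    change (e ∈ σ.toSet n 2 \ σ.toSet n 3 ∧ f ∈ σ.toSet n 3 \ σ.toSet n 2) ∧
      (M.Indep (σ'.toSet n 2) ∧ M.Indep (σ'.toSet n 3)) ↔ _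
    rw [h2, h3]
    constructor
    · rintro ⟨⟨k1, k2⟩, k3, k4⟩
      exact ⟨k1, k2, hX.exchange_isBase_of_indep k2.2 k3, hY.exchange_isBase_of_indep k1.2 k4⟩
    · rintro ⟨k1, k2, k3, k4⟩
      exact ⟨⟨k1, k2⟩, k3.indep, k4.indep⟩
  rw [StepTest, ← hσ', ← and_assoc, hf]
  refine and_congr_right fun hf => ?_
  have hv : Valid M σ' := by
    rw [Valid, h4, h5, h2, h3]
    exact CompatibleBasisPairs.exchange_right h hf
  rw [hv.deadTest_iff hn, gap_eq_ncard (σ := σ') hn, h4, h2, h3]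

lemma exists_pick_eq {O : Set ℕ → Prop} (hn : σ.reg 0 = n) (h : HasStep a b O σ) :
    ∃ e f : Fin n, pickRight a b O (pickLeft a b O σ) = (σ.setReg 4 e).setReg 5 f ∧
      StepTest a b O σ e f := by
  obtain ⟨he, h1⟩ := first_spec h
  have hp : pickLeft a b O σ = σ.setReg 4 (first (σ.reg 0) fun e => ∃ f < σ.reg 0, StepTest a b O σ e f) :=
    rfl
  set e := first (σ.reg 0) fun e => ∃ f < σ.reg 0, StepTest a b O σ e f with hee
  obtain ⟨hf, h2⟩ := first_spec h1
  set f := first (σ.reg 0) fun f => StepTest a b O σ e f with hff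
  refine ⟨⟨e, hn ▸ he⟩, ⟨f, hn ▸ hf⟩, ?_, h2⟩
  rw [hp, pickRight]
  simp (disch := omega) only [stepTest_setReg, Store.setReg_reg_of_ne, Store.setReg_reg_self, ← hff]

end Semantics
end OracleRAM

namespace OracleRAM

open Matroid

/-! ### The loop invariant -/

section Correctness

variable {n : ℕ} {M : Matroid (Fin n)} {σ τ : Store} {P Q : Set (Fin n) × Set (Fin n)} {L : ℕ}

/-- The entries of the output arrays from position `k` on are those of the list `l`. -/
def Records (σ : Store) (k : ℕ) (l : List (Fin n × Fin n)) : Prop :=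
  ∀ (i : ℕ) (h : i < l.length), σ.mem 0 (k + i) = l[i].1 ∧ σ.mem 1 (k + i) = l[i].2

lemma Records.congr {l : List (Fin n × Fin n)} {k : ℕ} (h : Records σ k l)
    (h0 : ∀ i < l.length, τ.mem 0 (k + i) = σ.mem 0 (k + i))
    (h1 : ∀ i < l.length, τ.mem 1 (k + i) = σ.mem 1 (k + i)) : Records τ k l :=
  fun i hi => ⟨(h0 i hi).trans (h i hi).1, (h1 i hi).trans (h i hi).2⟩

lemma Records.append {l l' : List (Fin n × Fin n)} {k : ℕ} (h : Records σ k l)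
    (h' : Records σ (k + l.length) l') : Records σ k (l ++ l') := by
  intro i hi
  by_cases hil : i < l.length
  · simpa [List.getElem_append_left hil] using h i hil
  · have hi' : i - l.length < l'.length := by simp at hi; omega
    have := h' (i - l.length) hi'
    rw [show k + l.length + (i - l.length) = k + i by omega] at this
    simpa [List.getElem_append_right (not_lt.1 hil)] using this

lemma records_singleton {k : ℕ} {e f : Fin n} (h0 : σ.mem 0 k = e) (h1 : σ.mem 1 k = f) :
    Records σ k [(e, f)] := by
  intro i hi
  obtain rfl : i = 0 := by simpa using hi
  exact ⟨h0, h1⟩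

/-- The invariant of the main loop: `L` exchanges lead from `P` to `Q`, those at the front and at the
back being known. -/
structure Invariant (M : Matroid (Fin n)) (P Q : Set (Fin n) × Set (Fin n)) (L : ℕ) (σ : Store) :
    Prop where
  size : σ.reg 0 = n
  length : σ.reg 3 = L
  valid : Valid M σ
  le : σ.reg 1 ≤ σ.reg 2
  within : M.Within (σ.toSet n 4) (σ.toSet n 2) (σ.toSet n 3) (σ.reg 2 - σ.reg 1)
  front : ∃ l, l.length = σ.reg 1 ∧ M.ExchangeSeq l P (σ.toSet n 4, σ.toSet n 5) ∧ Records σ 0 l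
  back : ∃ l, σ.reg 2 + l.length = L ∧ M.ExchangeSeq l (σ.toSet n 2, σ.toSet n 3) Q ∧
    Records σ (σ.reg 2) l

/-- The test forces variable 1 below variable 2, so the new entry overwrites neither the front nor
the back of the output. -/
lemma Invariant.body_advance (h : Invariant M P Q L σ) {e f : Fin n}
    (hs : StepTest 4 5 (indepOracle M) σ e f) :
    Invariant M P Q L (advance ((σ.setReg 4 e).setReg 5 f)) ∧
      (advance ((σ.setReg 4 e).setReg 5 f)).reg 2 - (advance ((σ.setReg 4 e).setReg 5 f)).reg 1 =
        σ.reg 2 - σ.reg 1 - 1 := by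
  rw [h.valid.stepTest_front h.size] at hs
  obtain ⟨hf, hd, hg⟩ := hs
  have hX : M.IsBase (σ.toSet n 4) := h.valid.isBase_left₁
  have hY : M.IsBase (σ.toSet n 5) := h.valid.isBase_left₂
  set σ₁ := (σ.setMem 0 (σ.reg 1) e).setMem 1 (σ.reg 1) f with hσ₁
  set σ' := advance ((σ.setReg 4 e).setReg 5 f) with hσ'
  have hmem : σ'.mem = (exchange 4 5 e f σ₁).mem := rfl
  have r0 : σ'.reg 0 = σ.reg 0 := rfl
  have r1 : σ'.reg 1 = σ.reg 1 + 1 := rfl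
  have r2 : σ'.reg 2 = σ.reg 2 := rfl
  have r3 : σ'.reg 3 = σ.reg 3 := rfl
  have hσ₁m : ∀ c, c ≠ 0 → c ≠ 1 → σ₁.mem c = σ.mem c := fun c h0 h1 => by
    rw [hσ₁, Store.setMem_mem_of_ne _ h1, Store.setMem_mem_of_ne _ h0]
  have h4 : σ'.toSet n 4 = insert f (σ.toSet n 4 \ {e}) := by
    rw [toSet_congr (congrFun hmem 4), toSet_exchange_left (by omega),
      toSet_congr (hσ₁m 4 (by omega) (by omega))]
  have h5 : σ'.toSet n 5 = insert e (σ.toSet n 5 \ {f}) := by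
    rw [toSet_congr (congrFun hmem 5), toSet_exchange_right (by omega),
      toSet_congr (hσ₁m 5 (by omega) (by omega))]
  have h23 : ∀ c, c ≠ 0 → c ≠ 1 → c ≠ 4 → c ≠ 5 → σ'.toSet n c = σ.toSet n c := fun c k0 k1 k4 k5 => by
    rw [toSet_congr (congrFun hmem c), toSet_congr (exchange_mem_of_ne k4 k5 _ _),
      toSet_congr (hσ₁m c k0 k1)]
  have h2 := h23 2 (by omega) (by omega) (by omega) (by omega)
  have h3 := h23 3 (by omega) (by omega) (by omega) (by omega)
  have m0 : ∀ i, σ'.mem 0 i = if i = σ.reg 1 then (e : ℕ) else σ.mem 0 i := fun i => by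
    rw [hmem, exchange_mem_of_ne (by omega) (by omega), hσ₁, Store.setMem_mem_of_ne _ (by omega),
      Store.setMem_mem_self]
  have m1 : ∀ i, σ'.mem 1 i = if i = σ.reg 1 then (f : ℕ) else σ.mem 1 i := fun i => by
    rw [hmem, exchange_mem_of_ne (by omega) (by omega), hσ₁, Store.setMem_mem_self,
      Store.setMem_mem_of_ne _ (by omega)]
  obtain ⟨l, hl, hlP, hlr⟩ := h.front
  obtain ⟨l', hl', hlQ, hlr'⟩ := h.back
  refine ⟨⟨r0.trans h.size, r3.trans h.length, ?_, by omega, ?_, ?_, ?_⟩, by omega⟩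
  · rw [Valid, h2, h3, h4, h5]
    exact CompatibleBasisPairs.exchange h.valid hf
  · rw [h2, h3, h4, r1, r2]
    exact Or.inl ⟨hd, by omega⟩
  · refine ⟨l ++ [(e, f)], by simp [hl, r1], ?_, ?_⟩
    · rw [h4, h5]
      exact hlP.append (exchangeSeq_cons hf hX hY ⟨hf.isBase₁, hf.isBase₂, rfl⟩)
    · refine (hlr.congr (fun i hi => ?_) (fun i hi => ?_)).append (records_singleton ?_ ?_)
      · rw [m0, if_neg (by omega)]
      · rw [m1, if_neg (by omega)]
      · rw [m0, if_pos (by omega)]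
      · rw [m1, if_pos (by omega)]
  · refine ⟨l', r2 ▸ hl', ?_, ?_⟩
    · rw [h2, h3]
      exact hlQ
    · rw [r2]
      refine hlr'.congr (fun i hi => ?_) (fun i hi => ?_)
      · rw [m0, if_neg (by omega)]
      · rw [m1, if_neg (by omega)]

/-- The reversed exchange leads from the new target to the old one, so it is recorded just before
the entries already at the back. -/
lemma Invariant.body_retract (h : Invariant M P Q L σ) {e f : Fin n}
    (hs : StepTest 2 3 (indepOracle M) σ e f) :
    Invariant M P Q L (retract ((σ.setReg 4 e).setReg 5 f)) ∧
      (retract ((σ.setReg 4 e).setReg 5 f)).reg 2 - (retract ((σ.setReg 4 e).setReg 5 f)).reg 1 =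
        σ.reg 2 - σ.reg 1 - 1 := by
  rw [h.valid.stepTest_back h.size] at hs
  obtain ⟨hf, hd, hg⟩ := hs
  have hB₁ : M.IsBase (σ.toSet n 2) := h.valid.isBase_right₁
  have hB₂ : M.IsBase (σ.toSet n 3) := h.valid.isBase_right₂
  set σ₁ := (σ.setMem 0 (σ.reg 2 - 1) f).setMem 1 (σ.reg 2 - 1) e with hσ₁
  set σ' := retract ((σ.setReg 4 e).setReg 5 f) with hσ'
  have hmem : σ'.mem = (exchange 2 3 e f σ₁).mem := rfl
  have r0 : σ'.reg 0 = σ.reg 0 := rfl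
  have r1 : σ'.reg 1 = σ.reg 1 := rfl
  have r2 : σ'.reg 2 = σ.reg 2 - 1 := rfl
  have r3 : σ'.reg 3 = σ.reg 3 := rfl
  have hσ₁m : ∀ c, c ≠ 0 → c ≠ 1 → σ₁.mem c = σ.mem c := fun c h0 h1 => by
    rw [hσ₁, Store.setMem_mem_of_ne _ h1, Store.setMem_mem_of_ne _ h0]
  have h2 : σ'.toSet n 2 = insert f (σ.toSet n 2 \ {e}) := by
    rw [toSet_congr (congrFun hmem 2), toSet_exchange_left (by omega),
      toSet_congr (hσ₁m 2 (by omega) (by omega))]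
  have h3 : σ'.toSet n 3 = insert e (σ.toSet n 3 \ {f}) := by
    rw [toSet_congr (congrFun hmem 3), toSet_exchange_right (by omega),
      toSet_congr (hσ₁m 3 (by omega) (by omega))]
  have h45 : ∀ c, c ≠ 0 → c ≠ 1 → c ≠ 2 → c ≠ 3 → σ'.toSet n c = σ.toSet n c := fun c k0 k1 k4 k5 => by
    rw [toSet_congr (congrFun hmem c), toSet_congr (exchange_mem_of_ne k4 k5 _ _),
      toSet_congr (hσ₁m c k0 k1)]
  have h4 := h45 4 (by omega) (by omega) (by omega) (by omega)
  have h5 := h45 5 (by omega) (by omega) (by omega) (by omega)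
  have m0 : ∀ i, σ'.mem 0 i = if i = σ.reg 2 - 1 then (f : ℕ) else σ.mem 0 i := fun i => by
    rw [hmem, exchange_mem_of_ne (by omega) (by omega), hσ₁, Store.setMem_mem_of_ne _ (by omega),
      Store.setMem_mem_self]
  have m1 : ∀ i, σ'.mem 1 i = if i = σ.reg 2 - 1 then (e : ℕ) else σ.mem 1 i := fun i => by
    rw [hmem, exchange_mem_of_ne (by omega) (by omega), hσ₁, Store.setMem_mem_self,
      Store.setMem_mem_of_ne _ (by omega)]
  obtain ⟨l, hl, hlP, hlr⟩ := h.front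
  obtain ⟨l', hl', hlQ, hlr'⟩ := h.back
  refine ⟨⟨r0.trans h.size, r3.trans h.length, ?_, by omega, ?_, ?_, ?_⟩, by omega⟩
  · rw [Valid, h2, h3, h4, h5]
    exact CompatibleBasisPairs.exchange_right h.valid hf
  · rw [h2, h3, h4, r1, r2]
    exact Or.inl ⟨hd, by omega⟩
  · refine ⟨l, r1 ▸ hl, ?_, ?_⟩
    · rw [h4, h5]
      exact hlP
    · refine hlr.congr (fun i hi => ?_) (fun i hi => ?_)
      · rw [m0, if_neg (by omega)]
      · rw [m1, if_neg (by omega)]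
  · refine ⟨[(f, e)] ++ l', by simp only [List.length_append, List.length_singleton]; omega, ?_, ?_⟩
    · rw [h2, h3]
      exact (exchangeSeq_of_feasible hf hB₁ hB₂).append hlQ
    · refine (records_singleton ?_ ?_).append ?_
      · rw [m0, if_pos r2]
      · rw [m1, if_pos r2]
      · rw [List.length_singleton, r2, Nat.sub_add_cancel (by omega)]
        refine hlr'.congr (fun i hi => ?_) (fun i hi => ?_)
        · rw [m0, if_neg (by omega)]
        · rw [m1, if_neg (by omega)]

lemma Invariant.body (h : Invariant M P Q L σ) (hM : M.IsSplit) :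
    Invariant M P Q L (body (indepOracle M) σ) ∧
      (body (indepOracle M) σ).reg 2 - (body (indepOracle M) σ).reg 1 = σ.reg 2 - σ.reg 1 - 1 := by
  rw [OracleRAM.body]
  split_ifs with h1 h2
  · obtain ⟨e, f, heq, hs⟩ := exists_pick_eq h.size h1
    rw [heq]
    exact h.body_advance hs
  · obtain ⟨e, f, heq, hs⟩ := exists_pick_eq h.size h2
    rw [heq]
    exact h.body_retract hs
  · refine ⟨h, ?_⟩
    -- As long as output positions are left, `exists_step` provides a step at one of the two ends,
    -- so the idle branch is reached only when none are left.
    by_contra hne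
    obtain ⟨k, hk⟩ : ∃ k, σ.reg 2 - σ.reg 1 = k + 1 := ⟨σ.reg 2 - σ.reg 1 - 1, by omega⟩
    have hle := h.le
    have hw := h.within
    rw [hk] at hw
    obtain ⟨e, f, hf, hd, hg⟩ | ⟨e, f, hf, hd, hg⟩ := hM.exists_step h.valid hw
    · exact h1 ⟨e, h.size ▸ e.2, f, h.size ▸ f.2,
        (h.valid.stepTest_front h.size).2 ⟨hf, hd, by omega⟩⟩
    · exact h2 ⟨e, h.size ▸ e.2, f, h.size ▸ f.2,
        (h.valid.stepTest_back h.size).2 ⟨hf, hd, by omega⟩⟩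

/-- Once the remaining number is zero, truncated subtraction keeps it there, so surplus rounds do no
harm. -/
lemma Invariant.iterate (h : Invariant M P Q L σ) (hM : M.IsSplit) (k : ℕ) :
    Invariant M P Q L ((OracleRAM.body (indepOracle M))^[k] σ) ∧
      ((OracleRAM.body (indepOracle M))^[k] σ).reg 2 -
        ((OracleRAM.body (indepOracle M))^[k] σ).reg 1 = σ.reg 2 - σ.reg 1 - k := by
  induction k with
  | zero => exact ⟨h, rfl⟩
  | succ k ih =>
    rw [Function.iterate_succ_apply']
    have := ih.1.body hM
    exact ⟨this.1, by omega⟩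

/-- With nothing left, the current pair coincides with the current target, and the front and the
back of the output join up. -/
lemma Invariant.exists_exchangeSeq (h : Invariant M P Q L σ) (h0 : σ.reg 2 - σ.reg 1 = 0) :
    ∃ l, l.length = L ∧ M.ExchangeSeq l P Q ∧ Records σ 0 l := by
  obtain ⟨l, hl, hlP, hlr⟩ := h.front
  obtain ⟨l', hl', hlQ, hlr'⟩ := h.back
  have hle := h.le
  have hw := h.within
  rw [h0] at hw
  have hz : (σ.toSet n 4 \ σ.toSet n 2).ncard = 0 := by
    obtain ⟨-, hk⟩ | ⟨-, hk⟩ := hw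
    · exact hk
    · omega
  obtain ⟨e1, e2⟩ := CompatibleBasisPairs.eq_of_ncard_eq_zero h.valid hz
  rw [e1, e2] at hlP
  refine ⟨l ++ l', by simp only [List.length_append]; omega, hlP.append hlQ, hlr.append ?_⟩
  rwa [zero_add, show l.length = σ.reg 2 by omega]

/-- The initial pair arrives in arrays 0 and 1, which also have to receive the output, so it is
moved to arrays 4 and 5. -/
lemma copy_iterate (σ : Store) (h1 : σ.reg 1 = 0) (k : ℕ) :
    (∀ x, x ≠ 1 → (copy^[k] σ).reg x = σ.reg x) ∧ (copy^[k] σ).reg 1 = k ∧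
      (∀ a, a ≠ 4 → a ≠ 5 → (copy^[k] σ).mem a = σ.mem a) ∧
      ∀ i < k, (copy^[k] σ).mem 4 i = σ.mem 0 i ∧ (copy^[k] σ).mem 5 i = σ.mem 1 i := by
  induction k with
  | zero => exact ⟨fun _ _ => rfl, h1, fun _ _ _ => rfl, fun i hi => by omega⟩
  | succ k ih =>
    rw [Function.iterate_succ_apply']
    obtain ⟨i1, i2, i3, i4⟩ := ih
    set τ := copy^[k] σ with hτ
    have hmem : (copy τ).mem =
      ((τ.setMem 4 (τ.reg 1) (τ.mem 0 (τ.reg 1))).setMem 5 (τ.reg 1) (τ.mem 1 (τ.reg 1))).mem := rfl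
    have m4 : (copy τ).mem 4 = (τ.setMem 4 (τ.reg 1) (τ.mem 0 (τ.reg 1))).mem 4 := by
      rw [hmem, Store.setMem_mem_of_ne _ (by omega)]
    have m5 : ∀ i, (copy τ).mem 5 i = if i = τ.reg 1 then τ.mem 1 (τ.reg 1) else τ.mem 5 i := by
      intro i
      rw [hmem, Store.setMem_mem_self, Store.setMem_mem_of_ne _ (by omega)]
    refine ⟨fun x hx => ?_, ?_, fun a h4 h5 => ?_, fun i hi => ?_⟩
    · rw [← i1 x hx]
      exact Store.setReg_reg_of_ne _ _ hx
    · rw [← i2]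
      rfl
    · rw [hmem, Store.setMem_mem_of_ne _ h5, Store.setMem_mem_of_ne _ h4, i3 a h4 h5]
    · rw [m4, m5, Store.setMem_mem_self, i2, i3 0 (by omega) (by omega), i3 1 (by omega) (by omega)]
      by_cases hik : i = k
      · simp [hik]
      · simpa [hik] using i4 i (by omega)

lemma toSet_charArray (X : Set (Fin n)) : {i : Fin n | charArray X i ≠ 0} = X := by
  ext i
  simp [charArray, ← Fin.ext_iff]

theorem main_correct (hM : M.IsSplit) {A₁ A₂ B₁ B₂ : Set (Fin n)} {r : ℕ} (hr : M.eRank = r)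
    (h : M.CompatibleBasisPairs (A₁, A₂) (B₁, B₂)) :
    ∃ l, (main (indepOracle M) (inputStore (A₁, A₂) (B₁, B₂)).vars).reg 3 = l.length ∧
      M.ExchangeSeq l (A₁, A₂) (B₁, B₂) ∧
      Records (main (indepOracle M) (inputStore (A₁, A₂) (B₁, B₂)).vars) 0 l ∧
      l.length ≤ min r (r - (A₁ ∩ B₁).ncard + 1) := by
  set σ := (inputStore (A₁, A₂) (B₁, B₂)).vars with hσ
  have hσ0 : σ.reg 0 = n := rfl
  have hσ1 : σ.reg 1 = 0 := rfl
  obtain ⟨c1, c2, c3, c4⟩ := copy_iterate σ hσ1 n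
  set τ := copy^[n] σ with hτ
  have hτ0 : τ.reg 0 = n := c1 0 (by omega)
  have t4 : τ.toSet n 4 = A₁ := by
    rw [← toSet_charArray A₁]
    ext i
    change τ.mem 4 i ≠ 0 ↔ _
    rw [(c4 i i.2).1]
    rfl
  have t5 : τ.toSet n 5 = A₂ := by
    rw [← toSet_charArray A₂]
    ext i
    change τ.mem 5 i ≠ 0 ↔ _
    rw [(c4 i i.2).2]
    rfl
  have t2 : τ.toSet n 2 = B₁ := by
    rw [← toSet_charArray B₁, toSet_congr (c3 2 (by omega) (by omega))]
    rfl
  have t3 : τ.toSet n 3 = B₂ := by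
    rw [← toSet_charArray B₂, toSet_congr (c3 3 (by omega) (by omega))]
    rfl
  set υ := setup (indepOracle M) τ with hυ
  have hmain : main (indepOracle M) σ = (body (indepOracle M))^[υ.reg 0] υ := by
    rw [main, hσ0]
  have u0 : υ.reg 0 = n := hτ0
  have u1 : υ.reg 1 = 0 := rfl
  have u3 : υ.reg 3 = υ.reg 2 := rfl
  have hv : Valid M (τ.setReg 1 0) := by
    change Valid M τ
    rw [Valid, t2, t3, t4, t5]
    exact h
  have hw : M.Within A₁ B₁ B₂ (υ.reg 2) := by
    have hval : υ.reg 2 = gap (τ.setReg 1 0) + truth (DeadTest (indepOracle M) (τ.setReg 1 0)) := rfl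
    have h0 : (τ.setReg 1 0).reg 0 = n := hτ0
    rw [hval, gap_eq_ncard h0, hv.deadTest_iff h0]
    change M.Within A₁ B₁ B₂ ((τ.toSet n 4 \ τ.toSet n 2).ncard +
      truth (M.Dead (τ.toSet n 4) (τ.toSet n 2) (τ.toSet n 3)))
    rw [t4, t2, t3]
    by_cases hd : M.Dead A₁ B₁ B₂
    · exact Or.inr ⟨hd, by rw [truth_of_true hd]⟩
    · exact Or.inl ⟨hd, by rw [truth_of_false hd, add_zero]⟩
  have hle := hM.within_le h hr hw
  -- The sequence has at most r exchanges, so n rounds of the main loop suffice.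
  have hrn : r ≤ n := by
    have hA : M.IsBase A₁ := h.isBase_left₁
    have h1 : A₁.ncard = r := by
      rw [← hA.encard_eq_eRank, ← hA.finite.cast_ncard_eq] at hr
      exact_mod_cast hr
    have h2 := Set.ncard_le_ncard (Set.subset_univ A₁) Set.finite_univ
    rw [Set.ncard_univ, Nat.card_fin] at h2
    omega
  have hinv : Invariant M (A₁, A₂) (B₁, B₂) (υ.reg 2) υ := by
    have k4 : υ.toSet n 4 = A₁ := t4
    have k5 : υ.toSet n 5 = A₂ := t5
    have k2 : υ.toSet n 2 = B₁ := t2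
    have k3 : υ.toSet n 3 = B₂ := t3
    refine ⟨u0, u3, hv, by omega, ?_, ⟨[], by simp [u1], ?_, ?_⟩, ⟨[], by simp, ?_, ?_⟩⟩
    · rw [k4, k2, k3, u1]
      exact hw
    · rw [k4, k5]
      exact ⟨h.isBase_left₁, h.isBase_left₂, rfl⟩
    · exact fun i hi => absurd hi (by simp)
    · rw [k2, k3]
      exact ⟨h.isBase_right₁, h.isBase_right₂, rfl⟩
    · exact fun i hi => absurd hi (by simp)
  obtain ⟨f1, f2⟩ := hinv.iterate hM (υ.reg 0)
  rw [← hmain] at f1 f2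
  obtain ⟨l, hl, hlP, hlr⟩ := f1.exists_exchangeSeq (by omega)
  exact ⟨l, by rw [f1.length, hl], hlP, hlr, by omega⟩

end Correctness
end OracleRAM

theorem theorem3p2 :
    (∀ (α : Type*) (M : Matroid α) (r : ℕ) (A₁ A₂ B₁ B₂ : Set α),
      M.Finite → M.IsSplit → M.eRank = r →
      M.CompatibleBasisPairs (A₁, A₂) (B₁, B₂) →
      M.exchangeDist (A₁, A₂) (B₁, B₂) ≤ (min r (r - (A₁ ∩ B₁).ncard + 1) : ℕ)) ∧
    (∃ (prog : OracleRAM.Prog) (time : Polynomial ℕ),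
      ∀ (n : ℕ) (M : Matroid (Fin n)) (r : ℕ) (A₁ A₂ B₁ B₂ : Set (Fin n)),
        M.E = Set.univ → M.IsSplit → M.eRank = r →
        M.CompatibleBasisPairs (A₁, A₂) (B₁, B₂) →
        ∃ (t : ℕ) (s : OracleRAM.Store) (l : List (Fin n × Fin n)),
          OracleRAM.Run (OracleRAM.indepOracle M) prog
            (OracleRAM.inputStore (A₁, A₂) (B₁, B₂)) t s ∧
          t ≤ time.eval n ∧
          s.Outputs l ∧
          M.ExchangeSeq l (A₁, A₂) (B₁, B₂) ∧
          l.length ≤ min r (r - (A₁ ∩ B₁).ncard + 1)) := by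
  refine ⟨fun α M r A₁ A₂ B₁ B₂ hfin hM hr h => hM.exchangeDist_le h hr, ?_⟩
  obtain ⟨prog, time, hprog⟩ := OracleRAM.exists_prog_main
  refine ⟨prog, time, fun n M r A₁ A₂ B₁ B₂ _ hM hr h => ?_⟩
  obtain ⟨t, s, hrun, ht, hmem, hreg⟩ :=
    hprog (OracleRAM.indepOracle M) (OracleRAM.inputStore (A₁, A₂) (B₁, B₂))
  obtain ⟨l, hl, hseq, hrec, hle⟩ := OracleRAM.main_correct hM hr h
  refine ⟨t, s, l, hrun, ht, ⟨hreg.trans hl, fun i hi => ?_⟩, hseq, hle⟩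
  have := hrec i hi
  rwa [zero_add, ← hmem] at this
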